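/- Let $\Gamma'$ be the group of affine transformations of $\mathbb{R}^5$ (written as $6\times 6$ matrices $\begin{bmatrix} A & a\\ 0 & 1\end{bmatrix}$ acting by $x\mapsto Ax+a$) generated by $$ \begin{bmatrix} 1&0&0&0&0&-1/3\\ 0&0&-1&0&0&0\\ 0&1&-1&0&0&0\\ 0&0&-1&1&0&0\\ 0&0&-1&0&1&0\\ 0&0&0&0&0&1 \end{bmatrix},\qquad \begin{bmatrix} -1&0&0&0&0&0\\ 0&0&-1&1&1&1/2\\ 0&-1&0&1&1&0\\ 0&0&0&1&0&-1/2\\ 0&0&0&0&1&0\\ 0&0&0&0&0&1 \end{bmatrix} $$ and the translations $a_1,\dots,a_5$ by the standard basis vectors of $\mathbb{Z}^5$ (this group has the name min.134.1.2.2 in CARAT). Let $E(5)=O(5)\ltimes\mathbb{R}^5$ be the group of isometries of Euclidean space and $r\colon E(5)\to O(5)$ the map taking the rotational part. There is an affine isomorphism of $\mathbb{R}^5$ that conjugates $\Gamma'$ into $E(5)$. For every such affine isomorphism, denote the resulting subgroup of $E(5)$ again by $\Gamma'$. Then: 1. $\Gamma'$ is a Bieberbach group, i.e. a discrete, cocompact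 and torsion-free subgroup of $E(5)$; its elements preserve the orientation; and its holonomy group $r(\Gamma')$ is isomorphic to $S_4$. 2. Every Sylow $2$-subgroup $G$ of the holonomy group is isomorphic to the dihedral group $D_8$ of order $8$, and the flat manifold $\mathbb{R}^5/\Gamma$, where $\Gamma=\Gamma'\cap r^{-1}(G)$, has exactly $8$ spin structures. For one such $G$, the group $\Gamma$ is generated by (the conjugates of) $a_1,\dots,a_5$ and $$ A=\begin{bmatrix} 1&0&0&0&0&0\\ 0&-1&0&1&1&0\\ 0&0&-1&1&1&1/2\\ 0&0&0&1&0&1/2\\ 0&0&0&0&1&1/2\\ 0&0&0&0&0&1 \end{bmatrix},\qquad B=\begin{bmatrix} -1&0&0&0&0&2/3\\ 0&1&0&-1&-1&0\\ 0&1&-1&0&0&1/2\\ 0&1&0&0&-1&1/2\\ 0&1&0&-1&0&0\\ 0&0&0&0&0&1 \end{bmatrix}. $$ 3. The flat manifold $X=\mathbb{R}^5/\Gamma'$ admits a spin structure, $H^1(X;\mathbb{Z}_2)\cong\mathbb{Z}_2^2$, and $X$ has exactly four spin structures. Here a spin structure on an oriented flat manifold $X=\mathbb{R}^n/\Gamma$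 is a pair $(P,\Lambda)$ of a principal $\mathrm{Spin}(n)$-bundle $P$ over $X$ and a $2$-fold covering $\Lambda\colon P\to Q$ of the principal $SO(n)$-tangent bundle $Q$ of $X$, such that $\Lambda$ is a map over $X$ and $\Lambda(p\,s)=\Lambda(p)\,\lambda_n(s)$ for all $p\in P$, $s\in\mathrm{Spin}(n)$, where $\lambda_n\colon\mathrm{Spin}(n)\to SO(n)$ is the standard $2$-fold covering. Spin structures are counted up to isomorphisms of principal $\mathrm{Spin}(n)$-bundles that commute with the maps to $Q$. -/

import Mathlib

noncomputable section

namespace FlatSpin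

open CliffordAlgebra

/-! ## The spin group and its covering of the special orthogonal group -/

/-- The negative definite form `v ↦ -(v₁² + ⋯ + vₙ²)` on `ℝⁿ`; its Clifford algebra is generated by
`e₁, …, eₙ` subject to `eᵢ² = -1` and `eᵢ eⱼ = - eⱼ eᵢ` for `i ≠ j`. -/
def negForm (n : ℕ) : QuadraticForm ℝ (Fin n → ℝ) :=
  QuadraticMap.weightedSumSquares ℝ (fun _ : Fin n => (-1 : ℝ))

/-- The group `Spin(n)`, inside the Clifford algebra of the negative definite form. -/
abbrev Spin (n : ℕ) : Type := spinGroup (negForm n)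

/-- `Spin(n)` carries the topology induced by the canonical (vector space) topology of the finite
dimensional real algebra that contains it. -/
instance instTopologicalSpaceSpin (n : ℕ) : TopologicalSpace (Spin n) :=
  TopologicalSpace.induced (fun x => (x : CliffordAlgebra (negForm n)))
    (moduleTopology ℝ (CliffordAlgebra (negForm n)))

/-- The group `SO(n)`, with the topology of a subspace of the space of matrices. -/
abbrev SO (n : ℕ) : Type := Matrix.specialOrthogonalGroup (Fin n) ℝ

theorem negForm_apply (n : ℕ) (v : Fin n → ℝ) : negForm n v = -(v ⬝ᵥ v) := by
  simp [negForm, QuadraticMap.weightedSumSquares_apply, dotProduct]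

theorem algebraMap_inj (n : ℕ) :
    Function.Injective (algebraMap ℝ (CliffordAlgebra (negForm n))) :=
  (algebraMap ℝ (CliffordAlgebra (negForm n))).injective

theorem iota_inj (n : ℕ) : Function.Injective (ι (negForm n)) := by
  intro v w h
  have := congrArg (equivExterior (negForm n)) h
  simp only [equivExterior, changeFormEquiv_apply, changeForm_ι] at this
  exact ExteriorAlgebra.ι_leftInverse.injective this

theorem spin_conj_mem (n : ℕ) (x : Spin n) (v : Fin n → ℝ) :
    (x : CliffordAlgebra (negForm n)) * ι (negForm n) v * star (x : CliffordAlgebra (negForm n))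
      ∈ LinearMap.range (ι (negForm n)) :=
  spinGroup.conjAct_smul_ι_mem_range_ι (x := spinGroup.toUnits x) x.2 v

/-- The linear map `v ↦ x v x̄` of `ℝⁿ`, for `x ∈ Spin(n)`. -/
def spinRot {n : ℕ} (x : Spin n) : (Fin n → ℝ) →ₗ[ℝ] (Fin n → ℝ) :=
  (LinearEquiv.ofInjective (ι (negForm n)) (iota_inj n)).symm.toLinearMap ∘ₗ
    LinearMap.codRestrict (LinearMap.range (ι (negForm n)))
      ((LinearMap.mulRight ℝ (star (x : CliffordAlgebra (negForm n)))) ∘ₗ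
        (LinearMap.mulLeft ℝ (x : CliffordAlgebra (negForm n))) ∘ₗ ι (negForm n))
      (spin_conj_mem n x)

theorem iota_spinRot {n : ℕ} (x : Spin n) (v : Fin n → ℝ) :
    ι (negForm n) (spinRot x v) =
      (x : CliffordAlgebra (negForm n)) * ι (negForm n) v *
        star (x : CliffordAlgebra (negForm n)) := by
  have := congrArg Subtype.val ((LinearEquiv.ofInjective (ι (negForm n)) (iota_inj n)).apply_symm_apply
    (LinearMap.codRestrict (LinearMap.range (ι (negForm n)))
      ((LinearMap.mulRight ℝ (star (x : CliffordAlgebra (negForm n)))) ∘ₗ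
        (LinearMap.mulLeft ℝ (x : CliffordAlgebra (negForm n))) ∘ₗ ι (negForm n))
      (spin_conj_mem n x) v))
  exact this

theorem spinRot_one (n : ℕ) : spinRot (1 : Spin n) = LinearMap.id := by
  refine LinearMap.ext fun v => iota_inj n ?_
  simp [iota_spinRot]

theorem spinRot_mul {n : ℕ} (x y : Spin n) : spinRot (x * y) = spinRot x ∘ₗ spinRot y := by
  refine LinearMap.ext fun v => iota_inj n ?_
  simp only [iota_spinRot, LinearMap.comp_apply, Submonoid.coe_mul, star_mul, mul_assoc]

theorem spinRot_dot_self {n : ℕ} (x : Spin n) (v : Fin n → ℝ) :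
    spinRot x v ⬝ᵥ spinRot x v = v ⬝ᵥ v := by
  have h : negForm n (spinRot x v) = negForm n v := by
    apply algebraMap_inj n
    have hx := spinGroup.coe_star_mul_self x
    have hx' := spinGroup.mul_star_self_of_mem x.2
    rw [← ι_sq_scalar, ← ι_sq_scalar, iota_spinRot]
    calc _ = (x : CliffordAlgebra (negForm n)) * ι (negForm n) v *
              (star (x : CliffordAlgebra (negForm n)) * x) * ι (negForm n) v *
              star (x : CliffordAlgebra (negForm n)) := by simp only [mul_assoc]
      _ = x * (ι (negForm n) v * ι (negForm n) v) * star (x : CliffordAlgebra (negForm n)) := by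
          rw [hx]; simp only [mul_assoc, one_mul]
      _ = _ := by
          rw [ι_sq_scalar, ← Algebra.commutes, mul_assoc, hx', mul_one]
  simpa [negForm_apply] using h

theorem spinRot_dot {n : ℕ} (x : Spin n) (v w : Fin n → ℝ) :
    spinRot x v ⬝ᵥ spinRot x w = v ⬝ᵥ w := by
  have h := spinRot_dot_self x (v + w)
  simp only [map_add, add_dotProduct, dotProduct_add, spinRot_dot_self] at h
  rw [dotProduct_comm (spinRot x w) (spinRot x v), dotProduct_comm w v] at h
  linarith

theorem lipschitz_det {n : ℕ} (u : (CliffordAlgebra (negForm n))ˣ)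
    (hu : u ∈ lipschitzGroup (negForm n)) :
    ∃ f : (Fin n → ℝ) →ₗ[ℝ] (Fin n → ℝ),
      (∀ v, ι (negForm n) (f v) = involute (u : CliffordAlgebra (negForm n)) * ι (negForm n) v *
        ((u⁻¹ : (CliffordAlgebra (negForm n))ˣ) : CliffordAlgebra (negForm n))) ∧
      involute (u : CliffordAlgebra (negForm n)) =
        LinearMap.det f • (u : CliffordAlgebra (negForm n)) := by
  have key : ∀ (u : (CliffordAlgebra (negForm n))ˣ) (a : Fin n → ℝ), ι (negForm n) a = u →
      ∃ f : (Fin n → ℝ) →ₗ[ℝ] (Fin n → ℝ),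
      (∀ v, ι (negForm n) (f v) = involute (u : CliffordAlgebra (negForm n)) * ι (negForm n) v *
        ((u⁻¹ : (CliffordAlgebra (negForm n))ˣ) : CliffordAlgebra (negForm n))) ∧
      involute (u : CliffordAlgebra (negForm n)) =
        LinearMap.det f • (u : CliffordAlgebra (negForm n)) := by
    intro u a ha
    let := u.invertible
    let : Invertible (ι (negForm n) a) := by rwa [ha]
    let : Invertible (negForm n a) := invertibleOfInvertibleι (negForm n) a
    refine ⟨LinearMap.transvection
      (-(⅟(negForm n a)) • (QuadraticMap.polarBilin (negForm n) a)) a, ?_, ?_⟩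
    · intro v
      simp_rw [← invOf_units u, ← ha, involute_ι, neg_mul, ι_mul_ι_mul_invOf_ι, ← map_neg]
      congr 1
      simp [LinearMap.transvection.apply, sub_eq_add_neg]
    · rw [LinearMap.transvection.det, ← ha, involute_ι]
      simp only [LinearMap.smul_apply, QuadraticMap.polarBilin_apply_apply, QuadraticMap.polar_self,
        smul_eq_mul]
      have : 1 + -⅟(negForm n a) * ((2 : ℕ) • negForm n a) = -1 := by
        have := invOf_mul_self (negForm n a)
        simp only [nsmul_eq_mul, Nat.cast_ofNat]
        linear_combination -2 * this
      rw [this]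
      simp
  unfold lipschitzGroup at hu
  induction hu using Subgroup.closure_induction'' with
  | mem x hx =>
    obtain ⟨a, ha⟩ := hx
    exact key x a ha
  | inv_mem x hx =>
    obtain ⟨a, ha⟩ := hx
    let := x.invertible
    let : Invertible (ι (negForm n) a) := by rwa [ha]
    let : Invertible (negForm n a) := invertibleOfInvertibleι (negForm n) a
    refine key x⁻¹ (⅟(negForm n a) • a) ?_
    rw [← invOf_ι]
    simp_rw [← invOf_units x, ← ha]
  | one =>
    refine ⟨LinearMap.id, ?_, ?_⟩ <;> simp
  | mul y z _ _ hy hz =>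
    obtain ⟨f, hf, hfd⟩ := hy
    obtain ⟨g, hg, hgd⟩ := hz
    refine ⟨f ∘ₗ g, ?_, ?_⟩
    · intro v
      simp only [LinearMap.comp_apply, hf, hg, Units.val_mul, map_mul, mul_inv_rev, mul_assoc]
    · rw [Units.val_mul, map_mul, hfd, hgd, LinearMap.det_comp, smul_mul_smul_comm]

theorem spinRot_det {n : ℕ} (x : Spin n) : LinearMap.det (spinRot x) = 1 := by
  obtain ⟨f, hf, hfd⟩ := lipschitz_det (spinGroup.toUnits x)
    (spinGroup.units_mem_lipschitzGroup (x := spinGroup.toUnits x) x.2)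
  have hinv : involute (x : CliffordAlgebra (negForm n)) = x := spinGroup.involute_eq x.2
  have hff : f = spinRot x := by
    refine LinearMap.ext fun v => iota_inj n ?_
    rw [hf, iota_spinRot]
    change involute (x : CliffordAlgebra (negForm n)) * _ * star (x : CliffordAlgebra (negForm n)) = _
    rw [hinv]
  subst hff
  change involute (x : CliffordAlgebra (negForm n)) =
    LinearMap.det (spinRot x) • (x : CliffordAlgebra (negForm n)) at hfd
  rw [hinv] at hfd
  have h := congrArg (· * star (x : CliffordAlgebra (negForm n))) hfd
  simp only [smul_mul_assoc, spinGroup.mul_star_self_of_mem x.2] at h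
  rw [← Algebra.algebraMap_eq_smul_one, ← map_one (algebraMap ℝ _)] at h
  exact (algebraMap_inj n h).symm

/-- The homomorphism `λₙ : Spin(n) → SO(n)`, `λₙ(x) v = x v x̄`. -/
def spinCover (n : ℕ) : Spin n →* SO n where
  toFun x := ⟨LinearMap.toMatrix' (spinRot x), by
    rw [Matrix.mem_specialOrthogonalGroup_iff, Matrix.mem_orthogonalGroup_iff']
    refine ⟨?_, by rw [LinearMap.det_toMatrix', spinRot_det]⟩
    ext i j
    have h := spinRot_dot x (Pi.single i 1) (Pi.single j 1)
    rw [Matrix.mul_apply, Matrix.one_apply]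
    simp only [Matrix.transpose_apply, LinearMap.toMatrix'_apply]
    rw [dotProduct] at h
    rw [h]
    simp [Pi.single_apply, eq_comm]⟩
  map_one' := by
    apply Subtype.ext
    simp [spinRot_one]
  map_mul' x y := by
    apply Subtype.ext
    simp [spinRot_mul, LinearMap.toMatrix'_comp]

/-! ## Groups of isometries, flat manifolds and their frame bundles -/

/-- The group `E(n) = O(n) ⋉ ℝⁿ` of isometries of Euclidean `n`-space. -/
abbrev Isom (n : ℕ) : Type := EuclideanSpace ℝ (Fin n) ≃ᵃⁱ[ℝ] EuclideanSpace ℝ (Fin n)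

/-- `E(n)` carries the topology of pointwise convergence, which is the topology of
`O(n) ⋉ ℝⁿ`. -/
instance instTopologicalSpaceIsom (n : ℕ) : TopologicalSpace (Isom n) :=
  TopologicalSpace.induced (fun γ => (γ : EuclideanSpace ℝ (Fin n) → EuclideanSpace ℝ (Fin n)))
    inferInstance

/-- The rotational part `r(A, a) = A` of an isometry `(A, a)`. -/
def rotPart (n : ℕ) : Isom n →* (EuclideanSpace ℝ (Fin n) ≃ₗᵢ[ℝ] EuclideanSpace ℝ (Fin n)) where
  toFun γ := γ.linearIsometryEquiv
  map_one' := by ext v; rfl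
  map_mul' γ δ := by ext v; rfl

/-- The matrix of the rotational part of an isometry in the standard basis. -/
def rotMatrix {n : ℕ} (γ : Isom n) : Matrix (Fin n) (Fin n) ℝ :=
  LinearMap.toMatrixAlgEquiv (EuclideanSpace.basisFun (Fin n) ℝ).toBasis
    (rotPart n γ).toLinearEquiv.toLinearMap

theorem rotMatrix_one (n : ℕ) : rotMatrix (1 : Isom n) = 1 := by
  rw [rotMatrix, map_one]
  exact map_one _

theorem rotMatrix_mul {n : ℕ} (γ δ : Isom n) :
    rotMatrix (γ * δ) = rotMatrix γ * rotMatrix δ := by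
  rw [rotMatrix, rotMatrix, rotMatrix, ← map_mul, map_mul (rotPart n)]
  rfl

/-- The holonomy group `r(Γ)`. -/
def holonomy {n : ℕ} (Γ : Subgroup (Isom n)) :
    Subgroup (EuclideanSpace ℝ (Fin n) ≃ₗᵢ[ℝ] EuclideanSpace ℝ (Fin n)) :=
  Γ.map (rotPart n)

/-- The preimage `r⁻¹(S) ⊆ Γ` of a subgroup `S` of the holonomy group of `Γ`. -/
def holonomyPreimage {n : ℕ} (Γ : Subgroup (Isom n)) (S : Subgroup (holonomy Γ)) :
    Subgroup (Isom n) :=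
  Γ ⊓ (S.map (holonomy Γ).subtype).comap (rotPart n)

/-- The orbit relation of `Γ` on Euclidean space. -/
def orbitSetoid {n : ℕ} (Γ : Subgroup (Isom n)) : Setoid (EuclideanSpace ℝ (Fin n)) where
  r x y := ∃ γ ∈ Γ, γ x = y
  iseqv :=
    { refl := fun x => ⟨1, Γ.one_mem, rfl⟩
      symm := by
        rintro x y ⟨γ, hγ, rfl⟩
        exact ⟨γ⁻¹, Γ.inv_mem hγ, γ.symm_apply_apply x⟩
      trans := by
        rintro x y z ⟨γ, hγ, rfl⟩ ⟨δ, hδ, rfl⟩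
        exact ⟨δ * γ, Γ.mul_mem hδ hγ, rfl⟩ }

/-- The orbit space `ℝⁿ/Γ`, with the quotient topology. -/
def FlatManifold {n : ℕ} (Γ : Subgroup (Isom n)) : Type := Quotient (orbitSetoid Γ)

instance instTopologicalSpaceFlatManifold {n : ℕ} (Γ : Subgroup (Isom n)) :
    TopologicalSpace (FlatManifold Γ) :=
  inferInstanceAs (TopologicalSpace (Quotient (orbitSetoid Γ)))

/-- A Bieberbach group: a torsion-free, discrete and cocompact subgroup of `E(n)`. -/
structure IsBieberbach {n : ℕ} (Γ : Subgroup (Isom n)) : Prop where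
  discrete : DiscreteTopology Γ
  cocompact : CompactSpace (FlatManifold Γ)
  torsionFree : ∀ γ ∈ Γ, ∀ k : ℕ, 0 < k → γ ^ k = 1 → γ = 1

/-- `Γ` acts by orientation preserving isometries, so that `ℝⁿ/Γ` inherits the orientation
of `ℝⁿ`. -/
def IsOrientable {n : ℕ} (Γ : Subgroup (Isom n)) : Prop := ∀ γ ∈ Γ, (rotMatrix γ).det = 1

/-- The relation on the oriented orthonormal frame bundle `ℝⁿ × SO(n)` of Euclidean space given by
the action of `Γ` through differentials: `γ (x, F) = (γ x, r(γ) F)`. The columns of `F` are the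
vectors of a frame at `x`. -/
def frameSetoid {n : ℕ} (Γ : Subgroup (Isom n)) : Setoid (EuclideanSpace ℝ (Fin n) × SO n) where
  r p q := ∃ γ ∈ Γ, γ p.1 = q.1 ∧
    rotMatrix γ * (p.2 : Matrix (Fin n) (Fin n) ℝ) = (q.2 : Matrix (Fin n) (Fin n) ℝ)
  iseqv :=
    { refl := fun p => ⟨1, Γ.one_mem, rfl, by rw [rotMatrix_one, one_mul]⟩
      symm := by
        rintro p q ⟨γ, hγ, h1, h2⟩
        refine ⟨γ⁻¹, Γ.inv_mem hγ, ?_, ?_⟩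
        · rw [← h1]; exact γ.symm_apply_apply p.1
        · rw [← h2, ← mul_assoc, ← rotMatrix_mul, inv_mul_cancel, rotMatrix_one, one_mul]
      trans := by
        rintro p q s ⟨γ, hγ, h1, h2⟩ ⟨δ, hδ, h3, h4⟩
        refine ⟨δ * γ, Γ.mul_mem hδ hγ, ?_, ?_⟩
        · rw [← h3, ← h1]; rfl
        · rw [← h4, ← h2, ← mul_assoc, rotMatrix_mul] }

/-- The principal `SO(n)`-tangent bundle of the oriented flat manifold `ℝⁿ/Γ`: the quotient by `Γ`
of the bundle `ℝⁿ × SO(n)` of oriented orthonormal frames of Euclidean space. -/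
def FrameBundle {n : ℕ} (Γ : Subgroup (Isom n)) : Type := Quotient (frameSetoid Γ)

instance instTopologicalSpaceFrameBundle {n : ℕ} (Γ : Subgroup (Isom n)) :
    TopologicalSpace (FrameBundle Γ) :=
  inferInstanceAs (TopologicalSpace (Quotient (frameSetoid Γ)))

/-- The base point of a frame. -/
def frameProj {n : ℕ} (Γ : Subgroup (Isom n)) : FrameBundle Γ → FlatManifold Γ :=
  Quotient.map (sa := frameSetoid Γ) (sb := orbitSetoid Γ) Prod.fst
    (by rintro p q ⟨γ, hγ, h, -⟩; exact ⟨γ, hγ, h⟩)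

/-- The right action of `SO(n)` on frames. -/
def frameAct {n : ℕ} (Γ : Subgroup (Isom n)) (q : FrameBundle Γ) (A : SO n) : FrameBundle Γ :=
  Quotient.map (sa := frameSetoid Γ) (sb := frameSetoid Γ) (fun p => (p.1, p.2 * A))
    (by
      rintro p q ⟨γ, hγ, h1, h2⟩
      refine ⟨γ, hγ, h1, ?_⟩
      simp only [Submonoid.coe_mul]
      rw [← mul_assoc, h2]) q

/-! ## Spin structures -/

/-- A (topological) principal `G`-bundle over `X`: a space over `X` with a continuous right action
of `G` that is locally isomorphic, over `X` and equivariantly, to `U × G`. -/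
structure PrincipalBundle (G X : Type) [Group G] [TopologicalSpace G] [TopologicalSpace X] where
  Total : Type
  topTotal : TopologicalSpace Total
  proj : Total → X
  continuous_proj : Continuous proj
  act : Total → G → Total
  continuous_act : Continuous (fun p : Total × G => act p.1 p.2)
  act_one : ∀ p, act p 1 = p
  act_mul : ∀ p g h, act p (g * h) = act (act p g) h
  locally_trivial : ∀ x : X, ∃ U : Set X, IsOpen U ∧ x ∈ U ∧
    ∃ φ : (U × G) ≃ₜ (proj ⁻¹' U),
      (∀ (u : U) (g : G), proj (φ (u, g)) = u) ∧
      (∀ (u : U) (g h : G), act (φ (u, g)) h = φ (u, g * h))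

attribute [instance] PrincipalBundle.topTotal

/-- A spin structure `(P, Λ)` on the oriented flat manifold `ℝⁿ/Γ`: a principal `Spin(n)`-bundle
`P` and a 2-fold covering `Λ` of the frame bundle by `P`, over `ℝⁿ/Γ`, with
`Λ(p s) = Λ(p) λₙ(s)`. -/
structure SpinStructure {n : ℕ} (Γ : Subgroup (Isom n)) extends
    PrincipalBundle (Spin n) (FlatManifold Γ) where
  cov : Total → FrameBundle Γ
  isCoveringMap_cov : IsCoveringMap cov
  two_fold : ∀ q : FrameBundle Γ, Nat.card (cov ⁻¹' {q}) = 2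
  frameProj_cov : ∀ p, frameProj Γ (cov p) = proj p
  cov_act : ∀ p s, cov (act p s) = frameAct Γ (cov p) (spinCover n s)

/-- Two spin structures are identified if there is an isomorphism of principal `Spin(n)`-bundles
that commutes with the coverings of the frame bundle. -/
def spinSetoid {n : ℕ} (Γ : Subgroup (Isom n)) : Setoid (SpinStructure Γ) where
  r P P' := ∃ f : P.Total ≃ₜ P'.Total,
    (∀ p s, f (P.act p s) = P'.act (f p) s) ∧ (∀ p, P'.cov (f p) = P.cov p)
  iseqv :=
    { refl := fun P => ⟨Homeomorph.refl _, fun _ _ => rfl, fun _ => rfl⟩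
      symm := by
        rintro P P' ⟨f, h1, h2⟩
        refine ⟨f.symm, fun p s => ?_, fun p => ?_⟩
        · apply f.injective
          rw [h1, f.apply_symm_apply, f.apply_symm_apply]
        · rw [← h2, f.apply_symm_apply]
      trans := by
        rintro P P' P'' ⟨f, h1, h2⟩ ⟨g, h3, h4⟩
        refine ⟨f.trans g, fun p s => ?_, fun p => ?_⟩
        · simp only [Homeomorph.trans_apply, h1, h3]
        · simp only [Homeomorph.trans_apply, h4, h2] }

/-- The set of spin structures on `ℝⁿ/Γ`, up to isomorphism. -/
def SpinClasses {n : ℕ} (Γ : Subgroup (Isom n)) : Type 1 := Quotient (spinSetoid Γ)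

/-! ## First singular cohomology -/

/-- The singular `k`-simplices of `X`. -/
abbrev SingularSimplex (X : Type) [TopologicalSpace X] (k : ℕ) : Type :=
  C(stdSimplex ℝ (Fin (k + 1)), X)

/-- The inclusion of the `i`-th face, opposite to the vertex `i`. -/
def faceInclusion (k : ℕ) (i : Fin (k + 2)) :
    C(stdSimplex ℝ (Fin (k + 1)), stdSimplex ℝ (Fin (k + 2))) :=
  ⟨stdSimplex.map i.succAbove, stdSimplex.continuous_map _⟩

/-- The coboundary `(δ f)(σ) = ∑ᵢ (-1)ⁱ f(σ ∘ dᵢ)` on singular `k`-cochains. -/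
def coboundary (R X : Type) [CommRing R] [TopologicalSpace X] (k : ℕ) :
    (SingularSimplex X k → R) →ₗ[R] (SingularSimplex X (k + 1) → R) where
  toFun f σ := ∑ i : Fin (k + 2), (-1 : R) ^ (i : ℕ) * f (σ.comp (faceInclusion k i))
  map_add' f g := by
    funext σ
    simp [mul_add, Finset.sum_add_distrib]
  map_smul' c f := by
    funext σ
    simp only [Pi.smul_apply, smul_eq_mul, RingHom.id_apply, Finset.mul_sum]
    exact Finset.sum_congr rfl fun i _ => by ring

/-- The first singular cohomology `H¹(X; R)`: 1-cocycles modulo coboundaries of 0-cochains. -/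
abbrev SingularH1 (R X : Type) [CommRing R] [TopologicalSpace X] : Type :=
  LinearMap.ker (coboundary R X 1) ⧸
    (LinearMap.range (coboundary R X 0)).submoduleOf (LinearMap.ker (coboundary R X 1))

/-! ## The group min.134.1.2.2 -/

/-- The affine map of `ℝⁿ` given by an `(n+1) × (n+1)` matrix in block form `[A a; 0 1]`,
`x ↦ A x + a`. -/
def affineApply {n : ℕ} (g : Matrix (Fin (n + 1)) (Fin (n + 1)) ℝ) (x : Fin n → ℝ) : Fin n → ℝ :=
  fun i => (∑ j : Fin n, g i.castSucc j.castSucc * x j) + g i.castSucc (Fin.last n)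

/-- `Γ ⊆ E(n)` is the group of affine transformations `C`, read in the affine coordinates of
Euclidean space given by `φ`. -/
def IsEuclideanForm {n : ℕ} (C : Subgroup (GL (Fin (n + 1)) ℝ))
    (φ : (Fin n → ℝ) ≃ᵃ[ℝ] EuclideanSpace ℝ (Fin n)) (Γ : Subgroup (Isom n)) : Prop :=
  (∀ g ∈ C, ∃ γ ∈ Γ, ∀ x, γ (φ x) = φ (affineApply (g : Matrix _ _ ℝ) x)) ∧
    (∀ γ ∈ Γ, ∃ g ∈ C, ∀ x, γ (φ x) = φ (affineApply (g : Matrix _ _ ℝ) x))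

/-- The matrix of the translation by the `i`-th standard basis vector of `ℤ⁵`. -/
def transMatrix (i : Fin 5) : Matrix (Fin 6) (Fin 6) ℝ :=
  1 + Matrix.single i.castSucc (Fin.last 5) 1

def genMatrix₁ : Matrix (Fin 6) (Fin 6) ℝ :=
  !![1, 0,  0, 0, 0, -1/3;
     0, 0, -1, 0, 0,    0;
     0, 1, -1, 0, 0,    0;
     0, 0, -1, 1, 0,    0;
     0, 0, -1, 0, 1,    0;
     0, 0,  0, 0, 0,    1]

def genMatrix₂ : Matrix (Fin 6) (Fin 6) ℝ :=
  !![-1,  0,  0, 0, 0,    0;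
      0,  0, -1, 1, 1,  1/2;
      0, -1,  0, 1, 1,    0;
      0,  0,  0, 1, 0, -1/2;
      0,  0,  0, 0, 1,    0;
      0,  0,  0, 0, 0,    1]

def sylowMatrixA : Matrix (Fin 6) (Fin 6) ℝ :=
  !![1,  0,  0, 0, 0,   0;
     0, -1,  0, 1, 1,   0;
     0,  0, -1, 1, 1, 1/2;
     0,  0,  0, 1, 0, 1/2;
     0,  0,  0, 0, 1, 1/2;
     0,  0,  0, 0, 0,   1]

def sylowMatrixB : Matrix (Fin 6) (Fin 6) ℝ :=
  !![-1, 0,  0,  0,  0, 2/3;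
      0, 1,  0, -1, -1,   0;
      0, 1, -1,  0,  0, 1/2;
      0, 1,  0,  0, -1, 1/2;
      0, 1,  0, -1,  0,   0;
      0, 0,  0,  0,  0,   1]

/-- The group min.134.1.2.2 of affine transformations of `ℝ⁵`, generated by the translations by
`ℤ⁵` and two further elements. -/
def caratGroup : Subgroup (GL (Fin 6) ℝ) :=
  Subgroup.closure {g | (g : Matrix (Fin 6) (Fin 6) ℝ) = genMatrix₁ ∨
    (g : Matrix (Fin 6) (Fin 6) ℝ) = genMatrix₂ ∨
    ∃ i, (g : Matrix (Fin 6) (Fin 6) ℝ) = transMatrix i}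

/-- The group generated by the translations by `ℤ⁵` and the two elements `A` and `B`. -/
def caratSylowGroup : Subgroup (GL (Fin 6) ℝ) :=
  Subgroup.closure {g | (g : Matrix (Fin 6) (Fin 6) ℝ) = sylowMatrixA ∨
    (g : Matrix (Fin 6) (Fin 6) ℝ) = sylowMatrixB ∨
    ∃ i, (g : Matrix (Fin 6) (Fin 6) ℝ) = transMatrix i}

end FlatSpin

end

noncomputable section
namespace FlatSpin
open CliffordAlgebra

/-! ## The center of the even Clifford algebra and the kernel of the spin covering -/

/-! Spin structures on ℝⁿ/Γ are the same as lifts ε : Γ → Spin(n) of the rotational part. Since ℝⁿ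
is simply connected, the standard framing of ℝⁿ lifts to the total space of the spin structure, and
Γ moves this lift by constants; conversely ε yields the bundle (ℝⁿ × Spin(n))/Γ
(`spinClassesEquiv`). The covering Spin(n) → SO(n) is surjective with central kernel ±1, so once one
lift exists the lifts form a torsor under Hom(Γ, ±1) (`card_spinClasses`). Integrating cocycles
along segments similarly identifies H¹(ℝⁿ/Γ; R) with Hom(Γ, R) (`singularH1Equiv`). What remains is
algebra of the group.

In adapted affine coordinates the group becomes `model.group`. It is generated by a Hantzsche–Wendt
group of elements h(a, b, c), a + b + c even, acting on the last three coordinates, by A, which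
permutes these cyclically and shifts the first coordinate, and by B, which reverses the first
coordinate, shifts the other four and exchanges the last two. The relations in `HWRep` bring every
element to the form h(a, b, c) Aᵐ Bⁿ, and this form is unique (`HWRep.mem_group_iff`,
`model_faithful`). Hence any solution of these relations in another group defines a homomorphism
(`HWRep.Faithful.exists_hom`). This is applied to units of the Clifford algebra, to S₄ and to groups
of exponent two.

Whatever affine isomorphism is used, the images of the adapted coordinate directions are orthogonal,
and the three permuted by A have equal length (`inner_frameVec`, `norm_frameVec`). Normalizing gives
an orthonormal frame e₀, …, e₄, in which h(a, b, c) lifts to e₃ᵃ e₄⁻ᵇ e₂ᶜ and A, B lift to products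
of two unit vectors (`spinRep`, `exists_spin_lift`).

A non-trivial element moves some adapted coordinate by at least 1 (`model_displacement`); this
uniform freeness gives discreteness, torsion-freeness and all the coverings. The rotational part and
the image in S₄ of a normal form are trivial under the same congruences (`rotPart_eq_one_iff`,
`s4Rep_nf_eq_one_iff`), so the holonomy group is S₄. Characters of order two are free on the values
at A and B, which gives 4; over a Sylow 2-subgroup they are free on the values at A³, B and h(0, 1,
1), which gives 8. -/

instance exteriorAlgebra_finite (n : ℕ) : Module.Finite ℝ (ExteriorAlgebra ℝ (Fin n → ℝ)) := by
  rw [Module.finite_def]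
  have h := (DirectSum.Decomposition.isInternal
    (fun i : ℕ => ⋀[ℝ]^i (Fin n → ℝ))).submodule_iSup_eq_top
  have h2 : (⨆ i ∈ Finset.range (n + 1), ⋀[ℝ]^i (Fin n → ℝ)) = ⊤ := by
    rw [← top_le_iff, ← h]
    refine iSup_le fun i => ?_
    by_cases hi : i ∈ Finset.range (n + 1)
    · exact le_iSup₂_of_le i hi le_rfl
    · have h0 : Module.finrank ℝ (⋀[ℝ]^i (Fin n → ℝ)) = 0 := by
        rw [exteriorPower.finrank_eq, Module.finrank_fin_fun]
        exact Nat.choose_eq_zero_of_lt (by simpa using hi)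
      rw [Submodule.finrank_eq_zero.mp h0]
      exact bot_le
  rw [← h2]
  refine Submodule.fg_biSup _ _ fun i _ => ?_
  exact Module.Finite.iff_fg.mp inferInstance

/-- Finite dimension is what makes multiplication continuous for the module topology, and provides
the coordinates that separate points of Spin(n). -/
instance cliffordAlgebra_finite (n : ℕ) : Module.Finite ℝ (CliffordAlgebra (negForm n)) :=
  Module.Finite.equiv (equivExterior (negForm n)).symm

/-- The Euler operator of the exterior algebra, which multiplies forms of degree `k` by `k`. -/
def eulerOp (n : ℕ) : ExteriorAlgebra ℝ (Fin n → ℝ) →ₗ[ℝ] ExteriorAlgebra ℝ (Fin n → ℝ) :=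
  ∑ i : Fin n, LinearMap.mulLeft ℝ (ExteriorAlgebra.ι ℝ (Pi.single i 1)) ∘ₗ
    contractLeft (Q := (0 : QuadraticForm ℝ (Fin n → ℝ))) (LinearMap.proj i)

theorem eulerOp_apply (n : ℕ) (x : ExteriorAlgebra ℝ (Fin n → ℝ)) :
    eulerOp n x = ∑ i : Fin n, ExteriorAlgebra.ι ℝ (Pi.single i 1) *
      contractLeft (Q := (0 : QuadraticForm ℝ (Fin n → ℝ))) (LinearMap.proj i) x := by
  simp [eulerOp]

/-- Contraction is an antiderivation and eᵢ anticommutes with v, so the two signs cancel; the extra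
term is ∑ vᵢ eᵢ = v. This is the degree count by induction. -/
theorem eulerOp_ι_mul (n : ℕ) (v : Fin n → ℝ) (x : ExteriorAlgebra ℝ (Fin n → ℝ)) :
    eulerOp n (ExteriorAlgebra.ι ℝ v * x) =
      ExteriorAlgebra.ι ℝ v * x + ExteriorAlgebra.ι ℝ v * eulerOp n x := by
  rw [eulerOp_apply, eulerOp_apply, Finset.mul_sum]
  have hv : ExteriorAlgebra.ι ℝ v = ∑ i : Fin n, v i • ExteriorAlgebra.ι ℝ (Pi.single i (1 : ℝ)) := by
    conv_lhs => rw [pi_eq_sum_univ' v]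
    simp [map_sum, map_smul]
  have hc : ∀ i, contractLeft (Q := (0 : QuadraticForm ℝ (Fin n → ℝ))) (LinearMap.proj i)
      (ExteriorAlgebra.ι ℝ v * x) = v i • x - ExteriorAlgebra.ι ℝ v *
        contractLeft (Q := (0 : QuadraticForm ℝ (Fin n → ℝ))) (LinearMap.proj i) x := fun i =>
    contractLeft_ι_mul _ _ _
  have hanti : ∀ w, ExteriorAlgebra.ι ℝ w * ExteriorAlgebra.ι ℝ v =
      - (ExteriorAlgebra.ι ℝ v * ExteriorAlgebra.ι ℝ w) := fun w =>
    eq_neg_of_add_eq_zero_left (ExteriorAlgebra.ι_add_mul_swap w v)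
  simp_rw [hc, mul_sub, Finset.sum_sub_distrib, ← mul_assoc, hanti]
  simp only [neg_mul, Finset.sum_neg_distrib, sub_neg_eq_add, add_left_inj]
  conv_rhs => rw [hv]
  simp [Finset.sum_mul]

theorem eulerOp_of_mem (n k : ℕ) (x : ExteriorAlgebra ℝ (Fin n → ℝ))
    (hx : x ∈ ⋀[ℝ]^k (Fin n → ℝ)) : eulerOp n x = (k : ℝ) • x := by
  induction k generalizing x with
  | zero =>
    rw [ExteriorAlgebra.exteriorPower, pow_zero, Submodule.mem_one] at hx
    obtain ⟨r, rfl⟩ := hx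
    rw [eulerOp_apply]
    simp only [Nat.cast_zero, zero_smul]
    refine Finset.sum_eq_zero fun i _ => ?_
    have := contractLeft_algebraMap (Q := (0 : QuadraticForm ℝ (Fin n → ℝ))) (LinearMap.proj i) r
    exact (congrArg _ this).trans (mul_zero _)
  | succ k ih =>
    rw [ExteriorAlgebra.exteriorPower, pow_succ'] at hx
    induction hx using Submodule.mul_induction_on' with
    | mem_mul_mem a ha b hb =>
      obtain ⟨v, rfl⟩ := ha
      rw [eulerOp_ι_mul, ih b hb]
      simp [add_smul, add_comm]
    | add a _ b _ iha ihb => rw [map_add, iha, ihb, smul_add]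

theorem decompose_eulerOp {n : ℕ} (x : ExteriorAlgebra ℝ (Fin n → ℝ)) (k : ℕ) :
    (DirectSum.decompose (fun i : ℕ => ⋀[ℝ]^i (Fin n → ℝ)) (eulerOp n x) k :
      ExteriorAlgebra ℝ (Fin n → ℝ)) =
      (k : ℝ) • (DirectSum.decompose (fun i : ℕ => ⋀[ℝ]^i (Fin n → ℝ)) x k :
        ExteriorAlgebra ℝ (Fin n → ℝ)) := by
  induction x using DirectSum.Decomposition.inductionOn (fun i : ℕ => ⋀[ℝ]^i (Fin n → ℝ)) with
  | zero => simp
  | @homogeneous i m =>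
    rw [eulerOp_of_mem n i m m.2, DirectSum.decompose_smul, DirectSum.smul_apply,
      Submodule.coe_smul, DirectSum.decompose_coe]
    by_cases h : i = k
    · subst h; rfl
    · rw [DirectSum.of_eq_of_ne _ _ _ (Ne.symm h)]; simp
  | add a b ha hb =>
    rw [map_add, DirectSum.decompose_add, DirectSum.decompose_add, DirectSum.add_apply,
      DirectSum.add_apply, Submodule.coe_add, Submodule.coe_add, ha, hb, smul_add]

/-- If all contractions vanish then so does the Euler operator, which multiplies the component of
degree k by k. Over ℝ only degree zero survives. -/
theorem exterior_scalar_of_contract {n : ℕ} (x : ExteriorAlgebra ℝ (Fin n → ℝ))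
    (hx : ∀ d : Module.Dual ℝ (Fin n → ℝ),
      contractLeft (Q := (0 : QuadraticForm ℝ (Fin n → ℝ))) d x = 0) :
    ∃ r : ℝ, x = algebraMap ℝ _ r := by
  classical
  have h0 : eulerOp n x = 0 := by
    rw [eulerOp_apply]
    exact Finset.sum_eq_zero fun i _ => (congrArg _ (hx _)).trans (mul_zero _)
  let 𝒜 := fun i : ℕ => ⋀[ℝ]^i (Fin n → ℝ)
  have hk : ∀ k : ℕ, k ≠ 0 → DirectSum.decompose 𝒜 x k = 0 := by
    intro k hk
    have := decompose_eulerOp x k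
    rw [h0, DirectSum.decompose_zero] at this
    simpa [hk] using this.symm
  have hx0 : x = (DirectSum.decompose 𝒜 x 0 : ExteriorAlgebra ℝ (Fin n → ℝ)) := by
    conv_lhs => rw [← DirectSum.sum_support_decompose 𝒜 x]
    refine Finset.sum_eq_single 0 (fun k _ h => by rw [hk k h]; rfl) ?_
    intro h
    rw [DFinsupp.notMem_support_iff.mp h]; rfl
  have hmem : (DirectSum.decompose 𝒜 x 0 : ExteriorAlgebra ℝ (Fin n → ℝ)) ∈
      (1 : Submodule ℝ (ExteriorAlgebra ℝ (Fin n → ℝ))) := by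
    have := (DirectSum.decompose 𝒜 x 0).2
    rwa [← pow_zero (LinearMap.range (ExteriorAlgebra.ι ℝ (M := Fin n → ℝ)))]
  obtain ⟨r, hr⟩ := Submodule.mem_one.mp hmem
  exact ⟨r, hx0.trans hr.symm⟩

/-- Both sides are antiderivations in x that agree on vectors, by vw + wv = polar(v, w). Commuting
with vectors thus becomes a statement about contractions, which can be read in the exterior algebra.
-/
theorem ι_mul_sub_involute_mul {n : ℕ} (v : Fin n → ℝ) (x : CliffordAlgebra (negForm n)) :
    ι (negForm n) v * x - involute x * ι (negForm n) v =
      contractLeft (QuadraticMap.polarBilin (negForm n) v) x := by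
  induction x using CliffordAlgebra.left_induction with
  | algebraMap r =>
    rw [contractLeft_algebraMap, AlgHom.commutes, Algebra.commutes, sub_self]
  | add x y hx hy => rw [map_add, map_add, ← hx, ← hy]; noncomm_ring
  | ι_mul x w hx =>
    rw [contractLeft_ι_mul, ← hx, map_mul, involute_ι]
    have h := ι_mul_ι_add_swap (Q := negForm n) v w
    rw [QuadraticMap.polarBilin_apply_apply, Algebra.smul_def, ← h]
    noncomm_ring

theorem scalar_of_commute {n : ℕ} (x : CliffordAlgebra (negForm n)) (hinv : involute x = x)
    (hx : ∀ v, ι (negForm n) v * x = x * ι (negForm n) v) : ∃ r : ℝ, x = algebraMap ℝ _ r := by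
  have hc : ∀ d : Module.Dual ℝ (Fin n → ℝ), contractLeft d x = 0 := by
    intro d
    -- The polar form of the quadratic form is -2 v·w, hence the factor -1/2: the form is
    -- nondegenerate, so every covector arises from a vector.
    have hd : d = QuadraticMap.polarBilin (negForm n) (fun i => -(1 / 2) * d (Pi.single i 1)) := by
      refine LinearMap.pi_ext' fun i => LinearMap.ext_ring ?_
      simp only [LinearMap.comp_apply, LinearMap.single_apply, QuadraticMap.polarBilin_apply_apply,
        QuadraticMap.polar, negForm_apply]
      simp only [add_dotProduct, dotProduct_add, dotProduct_single, single_dotProduct]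
      simp
      ring
    rw [hd, ← ι_mul_sub_involute_mul, hinv, hx, sub_self]
  -- The linear identification of the Clifford and exterior algebras respects contractions and
  -- scalars.
  obtain ⟨r, hr⟩ := exterior_scalar_of_contract (equivExterior (negForm n) x) (by
    intro d
    have h := changeForm_contractLeft
      (changeForm.associated_neg_proof (Q := negForm n)) d x
    rw [hc, map_zero] at h
    exact h.symm)
  refine ⟨r, (equivExterior (negForm n)).injective ?_⟩
  rw [hr]
  exact (changeForm_algebraMap
    (changeForm.associated_neg_proof (Q := negForm n)) r).symm

theorem spinCover_apply {n : ℕ} (x : Spin n) :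
    (spinCover n x : Matrix (Fin n) (Fin n) ℝ) = LinearMap.toMatrix' (spinRot x) := rfl

/-- The element ȳx is even and commutes with all vectors, so it is a scalar r; lying in the spin
group forces r² = 1. -/
theorem eq_or_eq_neg_of_spinCover_eq {n : ℕ} {x y : Spin n} (h : spinCover n x = spinCover n y) :
    (x : CliffordAlgebra (negForm n)) = y ∨ (x : CliffordAlgebra (negForm n)) = -y := by
  have hrot : spinRot x = spinRot y := LinearMap.toMatrix'.injective (congrArg Subtype.val h)
  have hy := spinGroup.coe_star_mul_self y
  have hx := spinGroup.coe_star_mul_self x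
  have hyx := (y⁻¹ * x).2
  set z : CliffordAlgebra (negForm n) := star (y : CliffordAlgebra (negForm n)) * x with hz
  have hzmem : z ∈ spinGroup (negForm n) := hyx
  obtain ⟨r, hr⟩ := scalar_of_commute z (spinGroup.involute_eq hzmem) (by
    intro v
    have hv := congrArg (ι (negForm n)) (LinearMap.congr_fun hrot v)
    rw [iota_spinRot, iota_spinRot] at hv
    have h1 := congrArg (fun w => star (y : CliffordAlgebra (negForm n)) * w * x) hv
    simp only [mul_assoc] at h1
    rw [hx, mul_one] at h1
    rw [← mul_assoc, hz, mul_assoc (star _), h1, ← mul_assoc, hy, one_mul]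
    simp only [mul_assoc])
  have h1 : r * r = 1 := by
    have h2 := spinGroup.star_mul_self_of_mem hzmem
    rw [hr, star_algebraMap, ← map_mul, ← map_one (algebraMap ℝ _)] at h2
    simpa using algebraMap_inj n h2
  have hxz : (x : CliffordAlgebra (negForm n)) = y * z := by
    rw [hz, ← mul_assoc, spinGroup.mul_star_self_of_mem y.2, one_mul]
  rcases mul_self_eq_one_iff.mp h1 with h | h
  · left; rw [hxz, hr, h, map_one, mul_one]
  · right; rw [hxz, hr, h, map_neg, map_one, mul_neg, mul_one]

end FlatSpin
end
noncomputable section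
namespace FlatSpin
open CliffordAlgebra Topology

/-! ## The topology of the spin group -/

/-- The vector space topology of the Clifford algebra. -/
@[reducible] def cliffordTopology (n : ℕ) : TopologicalSpace (CliffordAlgebra (negForm n)) :=
  moduleTopology ℝ (CliffordAlgebra (negForm n))

theorem continuous_spin_iff {n : ℕ} {X : Type*} [TopologicalSpace X] {f : X → Spin n} :
    Continuous f ↔ Continuous[_, cliffordTopology n]
      (fun x => (f x : CliffordAlgebra (negForm n))) :=
  continuous_induced_rng

theorem continuous_spin_coe (n : ℕ) :
    Continuous[_, cliffordTopology n] (fun x : Spin n => (x : CliffordAlgebra (negForm n))) :=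
  continuous_induced_dom

theorem continuous_clifford_mul (n : ℕ) {X : Type*} [TopologicalSpace X]
    {f g : X → CliffordAlgebra (negForm n)} (hf : Continuous[_, cliffordTopology n] f)
    (hg : Continuous[_, cliffordTopology n] g) :
    Continuous[_, cliffordTopology n] (fun x => f x * g x) := by
  let := cliffordTopology n
  have : IsModuleTopology ℝ (CliffordAlgebra (negForm n)) := ⟨rfl⟩
  exact (IsModuleTopology.continuous_mul_of_finite ℝ
    (CliffordAlgebra (negForm n))).comp (hf.prodMk hg)

theorem continuous_clifford_linear {n : ℕ} {V : Type*} [AddCommGroup V] [Module ℝ V]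
    [TopologicalSpace V] [IsTopologicalAddGroup V] [ContinuousSMul ℝ V]
    (f : CliffordAlgebra (negForm n) →ₗ[ℝ] V) : Continuous[cliffordTopology n, _] f := by
  let := cliffordTopology n
  have : IsModuleTopology ℝ (CliffordAlgebra (negForm n)) := ⟨rfl⟩
  exact IsModuleTopology.continuous_of_linearMap f

theorem continuous_to_clifford_linear {n : ℕ} {V : Type*} [AddCommGroup V] [Module ℝ V]
    [TopologicalSpace V] [IsModuleTopology ℝ V]
    (f : V →ₗ[ℝ] CliffordAlgebra (negForm n)) : Continuous[_, cliffordTopology n] f := by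
  let := cliffordTopology n
  have : IsModuleTopology ℝ (CliffordAlgebra (negForm n)) := ⟨rfl⟩
  have := IsModuleTopology.toContinuousAdd ℝ (CliffordAlgebra (negForm n))
  exact IsModuleTopology.continuous_of_linearMap f

theorem continuous_clifford_star (n : ℕ) :
    Continuous[cliffordTopology n, cliffordTopology n]
      (star : CliffordAlgebra (negForm n) → CliffordAlgebra (negForm n)) := by
  let := cliffordTopology n
  have : IsModuleTopology ℝ (CliffordAlgebra (negForm n)) := ⟨rfl⟩
  exact continuous_to_clifford_linear
    (reverse (Q := negForm n) ∘ₗ (involute (Q := negForm n)).toLinearMap)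

instance spin_t2Space (n : ℕ) : T2Space (Spin n) := by
  let b := Module.finBasis ℝ (CliffordAlgebra (negForm n))
  refine T2Space.of_injective_continuous
    (f := fun x : Spin n => b.equivFun (x : CliffordAlgebra (negForm n))) ?_ ?_
  · exact b.equivFun.injective.comp Subtype.val_injective
  · exact @Continuous.comp _ _ _ _ (cliffordTopology n) _ _ _
      (continuous_clifford_linear b.equivFun.toLinearMap) (continuous_spin_coe n)

instance spin_continuousMul (n : ℕ) : ContinuousMul (Spin n) where
  continuous_mul := by
    rw [continuous_spin_iff]
    exact continuous_clifford_mul n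
      (@Continuous.comp _ _ _ _ _ (cliffordTopology n) _ _ (continuous_spin_coe n) continuous_fst)
      (@Continuous.comp _ _ _ _ _ (cliffordTopology n) _ _ (continuous_spin_coe n) continuous_snd)

theorem continuous_spinCover (n : ℕ) : Continuous (spinCover n) := by
  -- A linear left inverse of ι turns each matrix entry into a linear functional of x eⱼ x̄, which
  -- is visibly continuous in x.
  obtain ⟨l, hl⟩ := (ι (negForm n)).exists_leftInverse_of_injective
    (LinearMap.ker_eq_bot.mpr (iota_inj n))
  refine Continuous.subtype_mk (continuous_matrix fun i j => ?_) _
  have h : ∀ x : Spin n, LinearMap.toMatrix' (spinRot x) i j =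
      (LinearMap.proj i ∘ₗ l : _ →ₗ[ℝ] ℝ) ((x : CliffordAlgebra (negForm n)) *
        ι (negForm n) (Pi.single j 1) * star (x : CliffordAlgebra (negForm n))) := by
    intro x
    rw [← iota_spinRot, LinearMap.toMatrix'_apply]
    exact congrFun (LinearMap.congr_fun hl _).symm i
  simp_rw [h]
  let := cliffordTopology n
  exact (continuous_clifford_linear _).comp (continuous_clifford_mul n
    (continuous_clifford_mul n (continuous_spin_coe n) continuous_const)
    ((continuous_clifford_star n).comp (continuous_spin_coe n)))

/-! ## Products of two unit vectors -/

theorem ι_mul_self_of_unit {n : ℕ} {u : Fin n → ℝ} (hu : u ⬝ᵥ u = 1) :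
    ι (negForm n) u * ι (negForm n) u = -1 := by
  rw [ι_sq_scalar, negForm_apply, hu, map_neg, map_one]

theorem star_ι' {n : ℕ} (u : Fin n → ℝ) : star (ι (negForm n) u) = -ι (negForm n) u := by
  rw [star_def, involute_ι, map_neg, reverse_ι]

theorem ι_mem_pinGroup {n : ℕ} {u : Fin n → ℝ} (hu : u ⬝ᵥ u = 1) :
    ι (negForm n) u ∈ pinGroup (negForm n) := by
  have h := ι_mul_self_of_unit hu
  rw [pinGroup.mem_iff]
  refine ⟨⟨⟨ι (negForm n) u, -ι (negForm n) u, by rw [mul_neg, h, neg_neg],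
    by rw [neg_mul, h, neg_neg]⟩, Subgroup.subset_closure ⟨u, rfl⟩, rfl⟩, ?_⟩
  rw [Unitary.mem_iff, star_ι', neg_mul, mul_neg, h, neg_neg]
  exact ⟨rfl, rfl⟩

theorem ι_mul_ι_mem_spinGroup {n : ℕ} {u v : Fin n → ℝ} (hu : u ⬝ᵥ u = 1) (hv : v ⬝ᵥ v = 1) :
    ι (negForm n) u * ι (negForm n) v ∈ spinGroup (negForm n) :=
  spinGroup.mem_iff.mpr ⟨mul_mem (ι_mem_pinGroup hu) (ι_mem_pinGroup hv),
    (ι_mul_ι_mem_evenOdd_zero (Q := negForm n) u v)⟩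

/-- The product of two unit vectors, as an element of the spin group. -/
def spinPair {n : ℕ} (u v : {u : Fin n → ℝ // u ⬝ᵥ u = 1}) : Spin n :=
  ⟨ι (negForm n) u * ι (negForm n) v, ι_mul_ι_mem_spinGroup u.2 v.2⟩

/-- The matrix of the reflection in the hyperplane orthogonal to a unit vector. -/
def reflMatrix {n : ℕ} (u : Fin n → ℝ) : Matrix (Fin n) (Fin n) ℝ :=
  1 - (2 : ℝ) • Matrix.vecMulVec u u

theorem reflMatrix_mulVec {n : ℕ} (u w : Fin n → ℝ) :
    (reflMatrix u).mulVec w = w - (2 * (u ⬝ᵥ w)) • u := by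
  rw [reflMatrix, Matrix.sub_mulVec, Matrix.one_mulVec, Matrix.smul_mulVec,
    Matrix.vecMulVec_mulVec]
  ext i
  simp
  ring

/-- Reflection in the hyperplane u^⊥ is w ↦ -u w u⁻¹, and u⁻¹ = -u because u² = -1. -/
theorem ι_reflMatrix {n : ℕ} {u : Fin n → ℝ} (hu : u ⬝ᵥ u = 1) (w : Fin n → ℝ) :
    ι (negForm n) ((reflMatrix u).mulVec w) =
      ι (negForm n) u * ι (negForm n) w * ι (negForm n) u := by
  have h := ι_mul_ι_add_swap (Q := negForm n) u w
  have hp : QuadraticMap.polar (negForm n) u w = -(2 * (u ⬝ᵥ w)) := by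
    simp only [QuadraticMap.polar, negForm_apply, add_dotProduct, dotProduct_add]
    rw [dotProduct_comm w u]; ring
  rw [hp] at h
  rw [eq_sub_of_add_eq h, sub_mul, mul_assoc, ι_mul_self_of_unit hu, reflMatrix_mulVec, map_sub,
    map_smul, Algebra.smul_def, map_neg]
  noncomm_ring

theorem spinCover_spinPair {n : ℕ} (u v : {u : Fin n → ℝ // u ⬝ᵥ u = 1}) :
    (spinCover n (spinPair u v) : Matrix (Fin n) (Fin n) ℝ) =
      reflMatrix (u : Fin n → ℝ) * reflMatrix (v : Fin n → ℝ) := by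
  rw [spinCover_apply]
  apply Matrix.toLin'.injective
  rw [Matrix.toLin'_toMatrix']
  refine LinearMap.ext fun w => iota_inj n ?_
  rw [iota_spinRot, Matrix.toLin'_apply, ← Matrix.mulVec_mulVec, ι_reflMatrix u.2,
    ι_reflMatrix v.2]
  simp only [spinPair, star_mul, star_ι', neg_mul, mul_neg, neg_neg, mul_assoc]

theorem continuous_spinPair (n : ℕ) :
    Continuous (fun p : {u : Fin n → ℝ // u ⬝ᵥ u = 1} × {u : Fin n → ℝ // u ⬝ᵥ u = 1} =>
      spinPair p.1 p.2) := by
  rw [continuous_spin_iff]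
  let := cliffordTopology n
  have h : Continuous (ι (negForm n)) := continuous_to_clifford_linear _
  exact continuous_clifford_mul n (h.comp (continuous_subtype_val.comp continuous_fst))
    (h.comp (continuous_subtype_val.comp continuous_snd))

theorem reflMatrix_mul_self {n : ℕ} {u : Fin n → ℝ} (hu : u ⬝ᵥ u = 1) :
    reflMatrix u * reflMatrix u = 1 := by
  apply Matrix.toLin'.injective
  refine LinearMap.ext fun w => ?_
  rw [Matrix.toLin'_apply, ← Matrix.mulVec_mulVec, reflMatrix_mulVec, reflMatrix_mulVec,
    Matrix.toLin'_one, dotProduct_sub, dotProduct_smul, hu, smul_eq_mul, LinearMap.id_apply]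
  module

theorem det_reflMatrix {n : ℕ} {u : Fin n → ℝ} (hu : u ⬝ᵥ u = 1) : (reflMatrix u).det = -1 := by
  have h : reflMatrix u = 1 + Matrix.replicateCol Unit (-(2 : ℝ) • u) * Matrix.replicateRow Unit u := by
    rw [reflMatrix, ← Matrix.vecMulVec_eq, Matrix.smul_vecMulVec, neg_smul, sub_eq_add_neg]
  rw [h, Matrix.det_one_add_replicateCol_mul_replicateRow, dotProduct_smul, hu]
  norm_num

instance compactSpace_unit (n : ℕ) : CompactSpace {u : Fin n → ℝ // u ⬝ᵥ u = 1} := by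
  have h : IsCompact {u : Fin n → ℝ | u ⬝ᵥ u = 1} := by
    refine Metric.isCompact_of_isClosed_isBounded
      (isClosed_eq (by unfold dotProduct; fun_prop) continuous_const) ?_
    refine (Metric.isBounded_closedBall (x := (0 : Fin n → ℝ)) (r := 1)).subset fun u hu => ?_
    rw [mem_closedBall_zero_iff, pi_norm_le_iff_of_nonneg zero_le_one]
    intro i
    rw [Real.norm_eq_abs, abs_le_one_iff_mul_self_le_one, ← show u ⬝ᵥ u = 1 from hu]
    exact Finset.single_le_sum (f := fun i => u i * u i) (fun i _ => mul_self_nonneg _)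
      (Finset.mem_univ i)
  exact isCompact_iff_compactSpace.mp h

end FlatSpin
end
noncomputable section
namespace FlatSpin
open CliffordAlgebra Topology Pointwise

/-! ## Surjectivity of the spin covering -/

/-- The first alternative is the degenerate case v = 0, where the hyperplane is the whole space; it
cannot be excluded from the list supplied by the Cartan–Dieudonné theorem. -/
theorem exists_reflMatrix_of_reflection {n : ℕ} (v : EuclideanSpace ℝ (Fin n)) :
    (∀ w, (ℝ ∙ v)ᗮ.reflection w = w) ∨ ∃ u : {u : Fin n → ℝ // u ⬝ᵥ u = 1},
      ∀ w, ((ℝ ∙ v)ᗮ.reflection w).ofLp = (reflMatrix (u : Fin n → ℝ)).mulVec w.ofLp := by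
  by_cases hv : v = 0
  · left
    intro w
    rw [Submodule.reflection_orthogonal_apply, Submodule.reflection_singleton_apply, hv]
    simp
  right
  have hn : ‖v‖ ≠ 0 := norm_ne_zero_iff.mpr hv
  have hdot : ∀ w : EuclideanSpace ℝ (Fin n), inner ℝ v w = v.ofLp ⬝ᵥ w.ofLp := fun w => by
    rw [EuclideanSpace.inner_eq_star_dotProduct, dotProduct_comm]; simp
  have hvv : v.ofLp ⬝ᵥ v.ofLp = ‖v‖ ^ 2 := by rw [← hdot, real_inner_self_eq_norm_sq]
  refine ⟨⟨(‖v‖⁻¹) • v.ofLp, ?_⟩, fun w => ?_⟩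
  · rw [smul_dotProduct, dotProduct_smul, hvv, smul_eq_mul, smul_eq_mul]
    field_simp
  · rw [Submodule.reflection_orthogonal_apply, Submodule.reflection_singleton_apply,
      reflMatrix_mulVec, hdot]
    ext i
    simp
    field_simp

/-- The unit vectors of `ℝⁿ`. -/
abbrev UnitVec (n : ℕ) : Type := {u : Fin n → ℝ // u ⬝ᵥ u = 1}

/-- The linear isometry of Euclidean space given by an orthogonal matrix. -/
def orthogonalIsometry {n : ℕ} (M : Matrix (Fin n) (Fin n) ℝ) (hM : M.transpose * M = 1) :
    EuclideanSpace ℝ (Fin n) ≃ₗᵢ[ℝ] EuclideanSpace ℝ (Fin n) :=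
  LinearIsometry.toLinearIsometryEquiv ⟨Matrix.toEuclideanLin M, fun x => by
    have h : ∀ y : EuclideanSpace ℝ (Fin n), ‖y‖ ^ 2 = y.ofLp ⬝ᵥ y.ofLp := fun y => by
      rw [EuclideanSpace.real_norm_sq_eq, dotProduct]
      exact Finset.sum_congr rfl fun i _ => by ring
    refine (sq_eq_sq₀ (norm_nonneg _) (norm_nonneg _)).mp ?_
    rw [h, h, Matrix.ofLp_toLpLin, Matrix.toLin'_apply, Matrix.dotProduct_mulVec,
      Matrix.vecMul_mulVec, hM, Matrix.vecMul_one]⟩ rfl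

theorem ofLp_orthogonalIsometry {n : ℕ} (M : Matrix (Fin n) (Fin n) ℝ)
    (hM : M.transpose * M = 1) (x : EuclideanSpace ℝ (Fin n)) :
    (orthogonalIsometry M hM x).ofLp = M.mulVec x.ofLp := rfl

/-- Cartan–Dieudonné theorem in matrix form; dropping degenerate reflections only shortens the list.
The bound on the length is what later gives one compact set covering SO(n). -/
theorem exists_reflMatrix_prod {n : ℕ} (M : Matrix (Fin n) (Fin n) ℝ)
    (hM : M.transpose * M = 1) :
    ∃ l : List (UnitVec n), l.length ≤ n ∧
      M = (l.map fun u : UnitVec n => reflMatrix u.1).prod := by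
  obtain ⟨l, hl, h⟩ := (orthogonalIsometry M hM).reflections_generate_dim
  rw [finrank_euclideanSpace_fin] at hl
  have key : ∀ l : List (EuclideanSpace ℝ (Fin n)),
      ∃ l' : List (UnitVec n), l'.length ≤ l.length ∧
      ∀ w, ((l.map fun v => (ℝ ∙ v)ᗮ.reflection).prod w).ofLp =
        ((l'.map fun u : UnitVec n => reflMatrix u.1).prod).mulVec w.ofLp := by
    intro l
    induction l with
    | nil => exact ⟨[], le_rfl, fun w => by simp⟩
    | cons v l ih =>
      obtain ⟨l', hl', h'⟩ := ih
      rcases exists_reflMatrix_of_reflection v with hv | ⟨u, hu⟩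
      · refine ⟨l', hl'.trans (by simp), fun w => ?_⟩
        rw [List.map_cons, List.prod_cons, ← h', LinearIsometryEquiv.coe_mul, Function.comp_apply, hv]
      · refine ⟨u :: l', by simpa using hl', fun w => ?_⟩
        rw [List.map_cons, List.prod_cons, List.map_cons, List.prod_cons, ← Matrix.mulVec_mulVec,
          ← h', LinearIsometryEquiv.coe_mul, Function.comp_apply, hu]
  obtain ⟨l', hl', h'⟩ := key l
  refine ⟨l', hl'.trans hl, Matrix.toLin'.injective (LinearMap.ext fun w => ?_)⟩
  rw [Matrix.toLin'_apply, Matrix.toLin'_apply, ← WithLp.ofLp_toLp 2 w, ← h',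
    ← ofLp_orthogonalIsometry M hM, h]

/-- The set of products of two unit vectors in the spin group. -/
def spinPairs (n : ℕ) : Set (Spin n) :=
  Set.range fun p : {u : Fin n → ℝ // u ⬝ᵥ u = 1} × {u : Fin n → ℝ // u ⬝ᵥ u = 1} =>
    spinPair p.1 p.2

theorem isCompact_spinPairs_pow (n k : ℕ) : IsCompact (spinPairs n ^ k) := by
  induction k with
  | zero => rw [pow_zero]; exact isCompact_singleton
  | succ k ih => rw [pow_succ]; exact ih.mul (isCompact_range (continuous_spinPair n))

theorem one_mem_spinPairs {n : ℕ} (u : {u : Fin n → ℝ // u ⬝ᵥ u = 1}) :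
    (1 : Spin n) ∈ spinPairs n := by
  refine ⟨(u, ⟨-u, by rw [neg_dotProduct_neg, u.2]⟩), Subtype.ext ?_⟩
  change ι (negForm n) u * ι (negForm n) (-u) = 1
  rw [map_neg, mul_neg, ι_mul_self_of_unit u.2, neg_neg]

theorem exists_mem_spinPairs_pow {n : ℕ} (j : ℕ) (l : List (UnitVec n))
    (hl : l.length = 2 * j) : ∃ x ∈ spinPairs n ^ j,
      (spinCover n x : Matrix (Fin n) (Fin n) ℝ) =
        (l.map fun u : UnitVec n => reflMatrix u.1).prod := by
  induction j generalizing l with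
  | zero =>
    rw [mul_zero, List.length_eq_zero_iff] at hl
    exact ⟨1, by simp, by simp [hl]⟩
  | succ j ih =>
    match l, hl with
    | u :: v :: l, hl =>
      obtain ⟨x, hx, h⟩ := ih l (by simpa [mul_add] using hl)
      refine ⟨spinPair u v * x, ?_, ?_⟩
      · rw [pow_succ']; exact Set.mul_mem_mul ⟨(u, v), rfl⟩ hx
      · rw [map_mul, Submonoid.coe_mul, spinCover_spinPair, h]
        simp [mul_assoc]

/-- Determinant 1 forces an even number of reflections, which pair up into products of two unit
vectors. The exponent n is generous but independent of A. -/
theorem exists_spinPairs_pow_spinCover_eq {n : ℕ} (A : SO n) :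
    ∃ x ∈ spinPairs n ^ n, spinCover n x = A := by
  obtain ⟨hA, hdet⟩ := Matrix.mem_specialOrthogonalGroup_iff.mp A.2
  obtain ⟨l, hl, h⟩ := exists_reflMatrix_prod A.1 ((Matrix.mem_orthogonalGroup_iff' (Fin n) ℝ).mp hA)
  have hd : (A : Matrix (Fin n) (Fin n) ℝ).det = (-1) ^ l.length := by
    rw [h]
    clear h hl
    induction l with
    | nil => simp
    | cons u l ih =>
      rw [List.map_cons, List.prod_cons, Matrix.det_mul, ih, det_reflMatrix u.2, List.length_cons,
        pow_succ']
  have heven : Even l.length := by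
    by_contra ho
    rw [hdet, (Nat.not_even_iff_odd.mp ho).neg_one_pow] at hd
    norm_num at hd
  obtain ⟨j, hj⟩ := heven
  obtain ⟨x, hx, hxA⟩ := exists_mem_spinPairs_pow j l (by omega)
  refine ⟨x, ?_, Subtype.ext (hxA.trans h.symm)⟩
  -- Padding with the factor 1 needs a unit vector, so it works only for n > 0; for n = 0 no padding
  -- is needed.
  rcases Nat.eq_zero_or_pos n with hn | hn
  · have : j = n := by omega
    exact this ▸ hx
  · exact Set.pow_subset_pow_right (one_mem_spinPairs ⟨Pi.single ⟨0, hn⟩ 1, by simp⟩)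
      (show j ≤ n by omega) hx

theorem spinCover_surjective (n : ℕ) : Function.Surjective (spinCover n) := fun A =>
  (exists_spinPairs_pow_spinCover_eq A).imp fun _ h => h.2

/-- A fixed compact subset of Spin(n) already maps onto SO(n), so a set with closed preimage is the
image of a compact set, hence closed. -/
theorem isQuotientMap_spinCover (n : ℕ) : IsQuotientMap (spinCover n) := by
  rw [isQuotientMap_iff_isClosed]
  refine ⟨spinCover_surjective n, fun s => ⟨fun h => h.preimage (continuous_spinCover n), fun h => ?_⟩⟩
  have hs : s = spinCover n '' (spinPairs n ^ n ∩ spinCover n ⁻¹' s) := by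
    ext A
    constructor
    · intro hA
      obtain ⟨x, hx, rfl⟩ := exists_spinPairs_pow_spinCover_eq A
      exact ⟨x, ⟨hx, hA⟩, rfl⟩
    · rintro ⟨x, ⟨-, hx⟩, rfl⟩
      exact hx
  rw [hs]
  exact (((isCompact_spinPairs_pow n n).inter_right h).image (continuous_spinCover n)).isClosed

/-- The element `-1` of the spin group. -/
def spinNegOne (n : ℕ) [NeZero n] : Spin n :=
  spinPair ⟨Pi.single 0 1, by simp⟩ ⟨Pi.single 0 1, by simp⟩

theorem coe_spinNegOne (n : ℕ) [NeZero n] :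
    (spinNegOne n : CliffordAlgebra (negForm n)) = -1 :=
  ι_mul_self_of_unit (by simp)

theorem spinNegOne_mul_self (n : ℕ) [NeZero n] : spinNegOne n * spinNegOne n = 1 :=
  Subtype.ext (by rw [Submonoid.coe_mul, coe_spinNegOne, neg_mul_neg, one_mul]; rfl)

theorem spinNegOne_ne_one (n : ℕ) [NeZero n] : spinNegOne n ≠ 1 := by
  intro h
  have h1 := congrArg Subtype.val h
  rw [coe_spinNegOne] at h1
  have h2 : algebraMap ℝ (CliffordAlgebra (negForm n)) (-1) = algebraMap ℝ _ 1 := by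
    rw [map_neg, map_one]; exact h1
  have := algebraMap_inj n h2
  norm_num at this

theorem spinNegOne_comm {n : ℕ} [NeZero n] (x : Spin n) : spinNegOne n * x = x * spinNegOne n :=
  Subtype.ext (by rw [Submonoid.coe_mul, Submonoid.coe_mul, coe_spinNegOne]; noncomm_ring)

theorem spinCover_eq_iff {n : ℕ} [NeZero n] {x y : Spin n} :
    spinCover n x = spinCover n y ↔ x = y ∨ x = y * spinNegOne n := by
  constructor
  · intro h
    rcases eq_or_eq_neg_of_spinCover_eq h with h | h
    · exact Or.inl (Subtype.ext h)
    · right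
      apply Subtype.ext
      rw [h, Submonoid.coe_mul, coe_spinNegOne, mul_neg, mul_one]
  · have h1 : spinCover n (spinNegOne n) = 1 := by
      apply Subtype.ext
      rw [spinNegOne, spinCover_spinPair, reflMatrix_mul_self (by simp)]
      rfl
    rintro (rfl | rfl)
    · rfl
    · rw [map_mul, h1, mul_one]

theorem spinCover_spinNegOne (n : ℕ) [NeZero n] : spinCover n (spinNegOne n) = 1 := by
  rw [← map_one (spinCover n), spinCover_eq_iff]
  exact Or.inr (one_mul _).symm

theorem mul_spinNegOne_ne {n : ℕ} [NeZero n] (x : Spin n) : x ≠ x * spinNegOne n := fun h =>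
  spinNegOne_ne_one n (left_eq_mul.mp h)

/-- The saturation of U is the union of U and its translate by -1. -/
theorem isOpenMap_spinCover (n : ℕ) [NeZero n] : IsOpenMap (spinCover n) := by
  intro U hU
  rw [← (isQuotientMap_spinCover n).isOpen_preimage]
  have h : spinCover n ⁻¹' (spinCover n '' U) = U ∪ (· * spinNegOne n) ⁻¹' U := by
    ext x
    constructor
    · rintro ⟨y, hy, hxy⟩
      rcases spinCover_eq_iff.mp hxy with rfl | rfl
      · exact Or.inl hy
      · exact Or.inr hy
    · rintro (hx | hx)
      · exact ⟨x, hx, rfl⟩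
      · exact ⟨_, hx, by rw [map_mul, spinCover_spinNegOne, mul_one]⟩
  rw [h]
  exact hU.union (hU.preimage (continuous_mul_const _))

end FlatSpin
end
noncomputable section
namespace FlatSpin
open CliffordAlgebra Topology Pointwise

/-! ## Rotational parts -/

theorem rotMatrix_mulVec {n : ℕ} (γ : Isom n) (w : EuclideanSpace ℝ (Fin n)) :
    (rotMatrix γ).mulVec w.ofLp = (rotPart n γ w).ofLp := by
  have h := LinearMap.toMatrix_mulVec_repr (EuclideanSpace.basisFun (Fin n) ℝ).toBasis
    (EuclideanSpace.basisFun (Fin n) ℝ).toBasis (rotPart n γ).toLinearEquiv.toLinearMap w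
  ext i
  have h1 : (EuclideanSpace.basisFun (Fin n) ℝ).toBasis.repr w = (w.ofLp : Fin n → ℝ) := by
    ext j; simp
  rw [h1] at h
  have := congrFun h i
  simpa [rotMatrix, LinearMap.toMatrixAlgEquiv] using this

theorem rotMatrix_transpose_mul {n : ℕ} (γ : Isom n) :
    (rotMatrix γ).transpose * rotMatrix γ = 1 := by
  have hd : ∀ v w : Fin n → ℝ,
      (rotMatrix γ).mulVec v ⬝ᵥ (rotMatrix γ).mulVec w = v ⬝ᵥ w := by
    intro v w
    have h := (rotPart n γ).inner_map_map (WithLp.toLp 2 v) (WithLp.toLp 2 w)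
    rw [EuclideanSpace.inner_eq_star_dotProduct, EuclideanSpace.inner_eq_star_dotProduct] at h
    rw [← WithLp.ofLp_toLp 2 v, ← WithLp.ofLp_toLp 2 w, rotMatrix_mulVec, rotMatrix_mulVec,
      dotProduct_comm]
    simpa [dotProduct_comm] using h
  ext i j
  have h := hd (Pi.single i 1) (Pi.single j 1)
  rw [Matrix.mulVec_single_one, Matrix.mulVec_single_one] at h
  rw [Matrix.mul_apply', Matrix.one_apply]
  refine Eq.trans h ?_
  simp [Pi.single_apply, eq_comm]

/-- The rotational part, as a homomorphism to the special orthogonal group. -/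
def rotSO {n : ℕ} {Γ : Subgroup (Isom n)} (hΓ : IsOrientable Γ) : Γ →* SO n where
  toFun γ := ⟨rotMatrix γ.1, Matrix.mem_specialOrthogonalGroup_iff.mpr
    ⟨(Matrix.mem_orthogonalGroup_iff' (Fin n) ℝ).mpr (rotMatrix_transpose_mul γ.1), hΓ γ.1 γ.2⟩⟩
  map_one' := Subtype.ext (rotMatrix_one n)
  map_mul' γ δ := Subtype.ext (rotMatrix_mul γ.1 δ.1)

/-! ## Groups that move every point by a definite amount -/

/-- Every non-trivial element of `Γ` moves every point by at least a fixed positive amount. -/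
def UniformlyFree {n : ℕ} (Γ : Subgroup (Isom n)) : Prop :=
  ∃ c > 0, ∀ γ ∈ Γ, γ ≠ 1 → ∀ x, c ≤ dist (γ x) x

theorem UniformlyFree.mono {n : ℕ} {Γ Δ : Subgroup (Isom n)} (h : UniformlyFree Γ) (hΔ : Δ ≤ Γ) :
    UniformlyFree Δ :=
  h.imp fun _ hc => ⟨hc.1, fun γ hγ => hc.2 γ (hΔ hγ)⟩

theorem UniformlyFree.eq_one {n : ℕ} {Γ : Subgroup (Isom n)} (h : UniformlyFree Γ) {γ : Isom n}
    (hγ : γ ∈ Γ) {x : EuclideanSpace ℝ (Fin n)} (hx : γ x = x) : γ = 1 := by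
  obtain ⟨c, hc, h⟩ := h
  by_contra hne
  have := h γ hγ hne x
  rw [hx, dist_self] at this
  linarith

theorem isom_continuous_eval {n : ℕ} (x : EuclideanSpace ℝ (Fin n)) :
    Continuous fun γ : Isom n => γ x :=
  (continuous_apply x).comp continuous_induced_dom

theorem UniformlyFree.discreteTopology {n : ℕ} {Γ : Subgroup (Isom n)} (h : UniformlyFree Γ) :
    DiscreteTopology Γ := by
  obtain ⟨c, hc, h⟩ := h
  rw [discreteTopology_iff_isOpen_singleton]
  intro γ
  have h1 : ({γ} : Set Γ) = (fun δ : Γ => δ.1 0) ⁻¹' Metric.ball (γ.1 0) c := by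
    ext δ
    simp only [Set.mem_singleton_iff, Set.mem_preimage, Metric.mem_ball]
    constructor
    · rintro rfl; simpa using hc
    · intro hd
      by_contra hne
      -- The distance from γ0 to δ0 is the displacement of the origin under γ⁻¹δ.
      have h2 := h _ (Γ.mul_mem (Γ.inv_mem γ.2) δ.2)
        (fun h3 => hne (Subtype.ext (inv_mul_eq_one.mp h3).symm)) 0
      have h3 : dist ((γ.1⁻¹ * δ.1) 0) 0 = dist (δ.1 0) (γ.1 0) := by
        have h4 := γ.1.symm.dist_map (δ.1 0) (γ.1 0)
        rwa [γ.1.symm_apply_apply 0] at h4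
      linarith
  rw [h1]
  exact Metric.isOpen_ball.preimage ((isom_continuous_eval 0).comp continuous_subtype_val)

/-- The centroid of the orbit of the origin under a finite cyclic group of affine maps is fixed. -/
theorem exists_fixed_point_of_pow_eq_one {n : ℕ} {γ : Isom n} {k : ℕ} (hk : 0 < k)
    (h : γ ^ k = 1) : ∃ x, γ x = x := by
  have hγ : ∀ x, γ x = rotPart n γ x + γ 0 := fun x => by
    have := γ.map_vadd 0 x
    rwa [vadd_eq_add, add_zero, vadd_eq_add] at this
  have hpow : ∀ i, (γ ^ (i + 1)) 0 = γ ((γ ^ i) 0) := fun i => by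
    rw [pow_succ']; rfl
  have hk' : (k : ℝ) ≠ 0 := by positivity
  refine ⟨(k : ℝ)⁻¹ • ∑ i ∈ Finset.range k, (γ ^ i) 0, ?_⟩
  rw [hγ, map_smul, map_sum]
  have h1 : ∀ i ∈ Finset.range k, rotPart n γ ((γ ^ i) 0) = (γ ^ (i + 1)) 0 - γ 0 := by
    intro i _
    rw [hpow, hγ ((γ ^ i) 0), add_sub_cancel_right]
  have h2 : ∑ i ∈ Finset.range k, (γ ^ (i + 1)) 0 = ∑ i ∈ Finset.range k, (γ ^ i) 0 := by
    have h3 := Finset.sum_range_succ' (fun i => (γ ^ i) (0 : EuclideanSpace ℝ (Fin n))) k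
    rw [Finset.sum_range_succ, h, pow_zero] at h3
    exact (add_right_cancel h3).symm
  rw [Finset.sum_congr rfl h1, Finset.sum_sub_distrib, h2, Finset.sum_const, Finset.card_range,
    smul_sub, ← Nat.cast_smul_eq_nsmul ℝ, smul_smul, inv_mul_cancel₀ hk', one_smul,
    sub_add_cancel]

theorem UniformlyFree.torsionFree {n : ℕ} {Γ : Subgroup (Isom n)} (h : UniformlyFree Γ)
    (γ : Isom n) (hγ : γ ∈ Γ) (k : ℕ) (hk : 0 < k) (hpow : γ ^ k = 1) : γ = 1 := by
  obtain ⟨x, hx⟩ := exists_fixed_point_of_pow_eq_one hk hpow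
  exact h.eq_one hγ hx

/-! ## Quotients of products with Euclidean space -/

section Twisted

variable {n : ℕ} {Γ : Subgroup (Isom n)} {H : Type} [Group H]

/-- The action of `Γ` on `ℝⁿ × H` through a homomorphism `Γ → H`. -/
@[reducible] def twistedAction (ρ : Γ →* H) : MulAction Γ (EuclideanSpace ℝ (Fin n) × H) where
  smul γ p := (γ.1 p.1, ρ γ * p.2)
  one_smul p := Prod.ext rfl (by change ρ 1 * p.2 = p.2; rw [map_one, one_mul])
  mul_smul γ δ p := Prod.ext rfl (by
    change ρ (γ * δ) * p.2 = ρ γ * (ρ δ * p.2)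
    rw [map_mul, mul_assoc])

/-- The displacement bound on the Euclidean factor alone suffices: a tube over a ball of radius c/2
meets none of its translates. Applied with H = SO(n) for the frame bundle and H = Spin(n) for the
lifts. -/
theorem isQuotientCoveringMap_twisted [TopologicalSpace H] [ContinuousMul H] (ρ : Γ →* H)
    (hfree : UniformlyFree Γ) {Z : Type} [TopologicalSpace Z]
    {f : EuclideanSpace ℝ (Fin n) × H → Z} (hf : IsQuotientMap f)
    (hfG : ∀ p q, f p = f q ↔ ∃ γ : Γ, γ.1 q.1 = p.1 ∧ ρ γ * q.2 = p.2) :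
    letI := twistedAction ρ
    IsQuotientCoveringMap f Γ := by
  let := twistedAction ρ
  have hsmul : ∀ (γ : Γ) (p : EuclideanSpace ℝ (Fin n) × H), γ • p = (γ.1 p.1, ρ γ * p.2) :=
    fun _ _ => rfl
  have : ContinuousConstSMul Γ (EuclideanSpace ℝ (Fin n) × H) := ⟨fun γ =>
    (γ.1.continuous.comp continuous_fst).prodMk (continuous_const.mul continuous_snd)⟩
  obtain ⟨c, hc, h⟩ := hfree
  refine ⟨hf, this, ?_, ?_⟩
  · intro p q
    rw [hfG]
    exact exists_congr fun γ => (Prod.ext_iff (x := γ • q)).symm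
  · intro p
    refine ⟨Prod.fst ⁻¹' Metric.ball p.1 (c / 2),
      continuous_fst.continuousAt.preimage_mem_nhds (Metric.ball_mem_nhds _ (by linarith)), ?_⟩
    rintro γ ⟨_, ⟨q, hq, rfl⟩, hq'⟩
    by_contra hne
    have h1 := h γ.1 γ.2 (fun h => hne (Subtype.ext h)) q.1
    simp only [Set.mem_preimage, Metric.mem_ball, hsmul] at hq hq'
    have := dist_triangle_right (γ.1 q.1) q.1 p.1
    linarith

end Twisted

variable {n : ℕ} {Γ : Subgroup (Isom n)}

/-- The projection of Euclidean space to its quotient by `Γ`. -/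
def orbitMk (Γ : Subgroup (Isom n)) (x : EuclideanSpace ℝ (Fin n)) : FlatManifold Γ :=
  Quotient.mk (orbitSetoid Γ) x

theorem orbitMk_eq_iff {x y : EuclideanSpace ℝ (Fin n)} :
    orbitMk Γ x = orbitMk Γ y ↔ ∃ γ ∈ Γ, γ x = y :=
  Quotient.eq (r := orbitSetoid Γ)

theorem orbitMk_smul {γ : Isom n} (hγ : γ ∈ Γ) (x : EuclideanSpace ℝ (Fin n)) :
    orbitMk Γ (γ x) = orbitMk Γ x :=
  (orbitMk_eq_iff.mpr ⟨γ, hγ, rfl⟩).symm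

theorem isQuotientMap_orbitMk : IsQuotientMap (orbitMk Γ) := isQuotientMap_quot_mk

theorem orbitMk_surjective : Function.Surjective (orbitMk Γ) := Quotient.mk_surjective

theorem UniformlyFree.isCoveringMap_orbitMk (h : UniformlyFree Γ) :
    IsCoveringMap (orbitMk Γ) := by
  let : MulAction Γ (EuclideanSpace ℝ (Fin n)) :=
    { smul := fun γ x => γ.1 x, one_smul := fun _ => rfl, mul_smul := fun _ _ _ => rfl }
  have h1 : ContinuousConstSMul Γ (EuclideanSpace ℝ (Fin n)) := ⟨fun γ => γ.1.continuous⟩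
  have h2 : IsQuotientCoveringMap (orbitMk Γ) Γ := by
    refine ⟨isQuotientMap_orbitMk, h1, ?_, fun x => ?_⟩
    · intro x y
      rw [eq_comm, orbitMk_eq_iff]
      exact ⟨fun ⟨γ, hγ, h⟩ => ⟨⟨γ, hγ⟩, h⟩, fun ⟨γ, h⟩ => ⟨γ.1, γ.2, h⟩⟩
    · obtain ⟨c, hc, h⟩ := h
      refine ⟨Metric.ball x (c / 2), Metric.ball_mem_nhds _ (by linarith), ?_⟩
      rintro γ ⟨_, ⟨y, hy, rfl⟩, hy'⟩
      by_contra hne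
      have h1 := h γ.1 γ.2 (fun h => hne (Subtype.ext h)) y
      change γ.1 y ∈ _ at hy'
      rw [Metric.mem_ball] at hy hy'
      have := dist_triangle_right (γ.1 y) y x
      linarith
  exact h2.isCoveringMap

/-- The projection of the frame bundle of Euclidean space to that of its quotient by `Γ`. -/
def frameMk (Γ : Subgroup (Isom n)) (p : EuclideanSpace ℝ (Fin n) × SO n) : FrameBundle Γ :=
  Quotient.mk (frameSetoid Γ) p

theorem frameMk_eq_iff (hΓ : IsOrientable Γ) (p q : EuclideanSpace ℝ (Fin n) × SO n) :
    frameMk Γ p = frameMk Γ q ↔ ∃ γ : Γ, γ.1 q.1 = p.1 ∧ rotSO hΓ γ * q.2 = p.2 := by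
  rw [eq_comm]
  refine (Quotient.eq (r := frameSetoid Γ)).trans ?_
  exact ⟨fun ⟨γ, hγ, h, h'⟩ => ⟨⟨γ, hγ⟩, h, Subtype.ext h'⟩,
    fun ⟨γ, h, h'⟩ => ⟨γ.1, γ.2, h, congrArg Subtype.val h'⟩⟩

theorem isQuotientMap_frameMk : IsQuotientMap (frameMk Γ) := isQuotientMap_quot_mk

theorem UniformlyFree.isOpenQuotientMap_frameMk (h : UniformlyFree Γ) (hΓ : IsOrientable Γ) :
    IsOpenQuotientMap (frameMk Γ) := by
  let := twistedAction (rotSO hΓ)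
  exact (isQuotientCoveringMap_twisted (rotSO hΓ) h isQuotientMap_frameMk
    (frameMk_eq_iff hΓ)).isOpenQuotientMap

theorem frameProj_frameMk (p : EuclideanSpace ℝ (Fin n) × SO n) :
    frameProj Γ (frameMk Γ p) = orbitMk Γ p.1 := rfl

theorem frameAct_frameMk (p : EuclideanSpace ℝ (Fin n) × SO n) (A : SO n) :
    frameAct Γ (frameMk Γ p) A = frameMk Γ (p.1, p.2 * A) := rfl

end FlatSpin
end
noncomputable section
namespace FlatSpin
open CliffordAlgebra Topology Pointwise

/-! ## The spin structure of a lift of the rotational part -/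

variable {n : ℕ} {Γ : Subgroup (Isom n)}

/-- One radius serves all centres; such a ball embeds in the quotient and trivializes the bundles
over it. -/
theorem UniformlyFree.exists_ball (h : UniformlyFree Γ) :
    ∃ r > 0, ∀ (x y z : EuclideanSpace ℝ (Fin n)), y ∈ Metric.ball x r → z ∈ Metric.ball x r →
      ∀ γ : Γ, γ.1 y = z → γ = 1 := by
  obtain ⟨c, hc, h⟩ := h
  refine ⟨c / 2, by linarith, fun x y z hy hz γ hγ => ?_⟩
  by_contra hne
  have h1 := h γ.1 γ.2 (fun h => hne (Subtype.ext h)) y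
  rw [Metric.mem_ball] at hy hz
  rw [hγ] at h1
  have := dist_triangle_right z y x
  linarith

/-- The orbit relation of the action of `Γ` on `ℝⁿ × Spin(n)` through `ε`. -/
def liftSetoid (ε : Γ →* Spin n) : Setoid (EuclideanSpace ℝ (Fin n) × Spin n) where
  r q p := ∃ γ : Γ, γ.1 q.1 = p.1 ∧ ε γ * q.2 = p.2
  iseqv :=
    { refl := fun p => ⟨1, rfl, by rw [map_one, one_mul]⟩
      symm := by
        rintro p q ⟨γ, h1, h2⟩
        refine ⟨γ⁻¹, ?_, ?_⟩
        · rw [← h1]; exact γ.1.symm_apply_apply p.1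
        · rw [← h2, ← mul_assoc, ← map_mul, inv_mul_cancel, map_one, one_mul]
      trans := by
        rintro p q s ⟨γ, h1, h2⟩ ⟨δ, h3, h4⟩
        refine ⟨δ * γ, ?_, ?_⟩
        · rw [← h3, ← h1]; rfl
        · rw [← h4, ← h2, ← mul_assoc, map_mul] }

/-- The quotient of `ℝⁿ × Spin(n)` by the action of `Γ` through `ε`. -/
def LiftBundle (ε : Γ →* Spin n) : Type := Quotient (liftSetoid ε)

instance (ε : Γ →* Spin n) : TopologicalSpace (LiftBundle ε) :=
  inferInstanceAs (TopologicalSpace (Quotient (liftSetoid ε)))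

/-- The quotient map `ℝⁿ × Spin(n) → (ℝⁿ × Spin(n)) / Γ`. -/
def liftMk (ε : Γ →* Spin n) (p : EuclideanSpace ℝ (Fin n) × Spin n) : LiftBundle ε :=
  Quotient.mk (liftSetoid ε) p

theorem liftMk_surjective (ε : Γ →* Spin n) : Function.Surjective (liftMk ε) :=
  Quotient.mk_surjective

theorem liftMk_eq_iff (ε : Γ →* Spin n) (p q : EuclideanSpace ℝ (Fin n) × Spin n) :
    liftMk ε p = liftMk ε q ↔ ∃ γ : Γ, γ.1 q.1 = p.1 ∧ ε γ * q.2 = p.2 := by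
  rw [eq_comm]
  exact Quotient.eq (r := liftSetoid ε)

theorem isQuotientMap_liftMk (ε : Γ →* Spin n) : IsQuotientMap (liftMk ε) := isQuotientMap_quot_mk

theorem UniformlyFree.isOpenQuotientMap_liftMk (h : UniformlyFree Γ) (ε : Γ →* Spin n) :
    IsOpenQuotientMap (liftMk ε) := by
  let := twistedAction ε
  exact (isQuotientCoveringMap_twisted ε h (isQuotientMap_liftMk ε)
    (liftMk_eq_iff ε)).isOpenQuotientMap

/-- The projection of the bundle `(ℝⁿ × Spin(n)) / Γ` to `ℝⁿ / Γ`. -/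
def liftProj (ε : Γ →* Spin n) : LiftBundle ε → FlatManifold Γ :=
  Quotient.map (sa := liftSetoid ε) (sb := orbitSetoid Γ) Prod.fst
    (by rintro p q ⟨γ, h, -⟩; exact ⟨γ.1, γ.2, h⟩)

/-- The right action of `Spin(n)` on `(ℝⁿ × Spin(n)) / Γ`. -/
def liftAct (ε : Γ →* Spin n) (q : LiftBundle ε) (g : Spin n) : LiftBundle ε :=
  Quotient.map (sa := liftSetoid ε) (sb := liftSetoid ε) (fun p => (p.1, p.2 * g))
    (by rintro p q ⟨γ, h1, h2⟩; exact ⟨γ, h1, by rw [← mul_assoc, h2]⟩) q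

theorem liftAct_liftMk (ε : Γ →* Spin n) (p : EuclideanSpace ℝ (Fin n) × Spin n) (g : Spin n) :
    liftAct ε (liftMk ε p) g = liftMk ε (p.1, p.2 * g) := rfl

theorem continuous_liftProj (ε : Γ →* Spin n) : Continuous (liftProj ε) := by
  rw [(isQuotientMap_liftMk ε).continuous_iff]
  exact isQuotientMap_orbitMk.continuous.comp continuous_fst

theorem UniformlyFree.continuous_liftAct (h : UniformlyFree Γ) (ε : Γ →* Spin n) :
    Continuous (fun p : LiftBundle ε × Spin n => liftAct ε p.1 p.2) := by
  rw [((h.isOpenQuotientMap_liftMk ε).prodMap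
    (IsOpenQuotientMap.id (X := Spin n))).isQuotientMap.continuous_iff]
  exact (isQuotientMap_liftMk ε).continuous.comp
    ((continuous_fst.comp continuous_fst).prodMk
      ((continuous_snd.comp continuous_fst).mul continuous_snd))

/-- Over a small ball B both B and B × Spin(n) embed openly in their quotients, and the
trivialization compares these two embeddings. -/
theorem UniformlyFree.lift_locally_trivial (h : UniformlyFree Γ) (ε : Γ →* Spin n)
    (x : FlatManifold Γ) : ∃ U : Set (FlatManifold Γ), IsOpen U ∧ x ∈ U ∧
    ∃ φ : (U × Spin n) ≃ₜ (liftProj ε ⁻¹' U),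
      (∀ (u : U) (g : Spin n), liftProj ε (φ (u, g)) = u) ∧
      (∀ (u : U) (g k : Spin n), liftAct ε (φ (u, g)) k = φ (u, g * k)) := by
  obtain ⟨e, rfl⟩ := orbitMk_surjective x
  obtain ⟨r, hr, hball⟩ := h.exists_ball
  let B : Set (EuclideanSpace ℝ (Fin n)) := Metric.ball e r
  have hB : IsOpen B := Metric.isOpen_ball
  let k : B → FlatManifold Γ := fun b => orbitMk Γ b
  let j : B × Spin n → LiftBundle ε := fun p => liftMk ε (p.1, p.2)
  have hk : IsOpenEmbedding k := by
    refine IsOpenEmbedding.of_continuous_injective_isOpenMap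
      (isQuotientMap_orbitMk.continuous.comp continuous_subtype_val) ?_
      (h.isCoveringMap_orbitMk.isOpenMap.comp hB.isOpenMap_subtype_val)
    intro b b' hb
    obtain ⟨γ, hγ, h1⟩ := orbitMk_eq_iff.mp hb
    have := hball e b b' b.2 b'.2 ⟨γ, hγ⟩ h1
    rw [Subtype.ext_iff] at this
    rw [show γ = 1 from this] at h1
    exact Subtype.ext h1
  have hj : IsOpenEmbedding j := by
    refine IsOpenEmbedding.of_continuous_injective_isOpenMap
      ((isQuotientMap_liftMk ε).continuous.comp
        (continuous_subtype_val.prodMap continuous_id)) ?_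
      ((h.isOpenQuotientMap_liftMk ε).isOpenMap.comp
        (hB.isOpenMap_subtype_val.prodMap IsOpenMap.id))
    rintro ⟨b, g⟩ ⟨b', g'⟩ hb
    obtain ⟨γ, h1, h2⟩ := (liftMk_eq_iff ε _ _).mp hb
    have := hball e b' b b'.2 b.2 γ h1
    subst this
    rw [map_one, one_mul] at h2
    exact Prod.ext (Subtype.ext h1.symm) h2.symm
  -- A class lying over the image of B has a representative over B: move it by the element of Γ that
  -- brings its base point there.
  have hrange : Set.range j = liftProj ε ⁻¹' Set.range k := by
    ext q
    obtain ⟨⟨y, g⟩, rfl⟩ := liftMk_surjective ε q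
    constructor
    · rintro ⟨⟨b, g'⟩, hb⟩
      exact ⟨b, by rw [← hb]; rfl⟩
    · rintro ⟨b, hb⟩
      obtain ⟨γ, hγ, h1⟩ := orbitMk_eq_iff.mp hb.symm
      refine ⟨(b, ε ⟨γ, hγ⟩ * g), ?_⟩
      rw [liftMk_eq_iff]
      exact ⟨⟨γ, hγ⟩, h1, rfl⟩
  refine ⟨Set.range k, hk.isOpen_range, ⟨⟨e, Metric.mem_ball_self hr⟩, rfl⟩,
    ((hk.isEmbedding.toHomeomorph.symm.prodCongr (Homeomorph.refl _)).trans
      hj.isEmbedding.toHomeomorph).trans (Homeomorph.setCongr hrange), ?_, ?_⟩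
  · intro u g
    exact congrArg Subtype.val (hk.isEmbedding.toHomeomorph.apply_symm_apply u)
  · intro u g g'
    rfl

/-- The map `(ℝⁿ × Spin(n)) / Γ → (ℝⁿ × SO(n)) / Γ` induced by the covering of `SO(n)`. -/
def liftCov (hΓ : IsOrientable Γ) (ε : Γ →* Spin n)
    (hε : ∀ γ, spinCover n (ε γ) = rotSO hΓ γ) : LiftBundle ε → FrameBundle Γ :=
  Quotient.map (sa := liftSetoid ε) (sb := frameSetoid Γ) (fun p => (p.1, spinCover n p.2))
    (by
      rintro p q ⟨γ, h1, h2⟩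
      refine ⟨γ.1, γ.2, h1, ?_⟩
      rw [← h2, map_mul, hε]
      rfl)

section Cov

variable (hΓ : IsOrientable Γ) (ε : Γ →* Spin n) (hε : ∀ γ, spinCover n (ε γ) = rotSO hΓ γ)

theorem liftCov_liftMk (p : EuclideanSpace ℝ (Fin n) × Spin n) :
    liftCov hΓ ε hε (liftMk ε p) = frameMk Γ (p.1, spinCover n p.2) := rfl

variable [NeZero n]

theorem liftCov_eq_iff (p q : LiftBundle ε) :
    liftCov hΓ ε hε p = liftCov hΓ ε hε q ↔ p = q ∨ p = liftAct ε q (spinNegOne n) := by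
  obtain ⟨⟨x, g⟩, rfl⟩ := liftMk_surjective ε p
  obtain ⟨⟨y, k⟩, rfl⟩ := liftMk_surjective ε q
  rw [liftCov_liftMk, liftCov_liftMk, frameMk_eq_iff hΓ, liftAct_liftMk, liftMk_eq_iff,
    liftMk_eq_iff, ← exists_or]
  refine exists_congr fun γ => ?_
  rw [← and_or_left, ← hε, ← map_mul, eq_comm (b := spinCover n g), spinCover_eq_iff,
    eq_comm (a := g), eq_comm (a := g), mul_assoc]

theorem isQuotientMap_liftCov (h : UniformlyFree Γ) : IsQuotientMap (liftCov hΓ ε hε) := by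
  have h1 : IsOpenQuotientMap (spinCover n) :=
    ⟨spinCover_surjective n, continuous_spinCover n, isOpenMap_spinCover n⟩
  have h2 : IsOpenQuotientMap (liftCov hΓ ε hε ∘ liftMk ε) :=
    (h.isOpenQuotientMap_frameMk hΓ).comp (IsOpenQuotientMap.id.prodMap h1)
  refine IsQuotientMap.of_comp (isQuotientMap_liftMk ε).continuous ?_ h2.isQuotientMap
  rw [(isQuotientMap_liftMk ε).continuous_iff]
  exact h2.continuous

theorem isCoveringMap_liftCov (h : UniformlyFree Γ) : IsCoveringMap (liftCov hΓ ε hε) := by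
  -- The covering is the quotient by the kernel ±1; the inverse turns the right action into a left
  -- one.
  let : MulAction (spinCover n).ker (LiftBundle ε) :=
    { smul := fun k p => liftAct ε p k.1⁻¹
      one_smul := fun p => by
        obtain ⟨p, rfl⟩ := liftMk_surjective ε p
        change liftMk ε (p.1, p.2 * 1⁻¹) = liftMk ε p
        rw [inv_one, mul_one]
      mul_smul := fun k l p => by
        obtain ⟨p, rfl⟩ := liftMk_surjective ε p
        change liftMk ε (p.1, p.2 * (k.1 * l.1)⁻¹) = liftMk ε (p.1, p.2 * l.1⁻¹ * k.1⁻¹)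
        rw [mul_inv_rev, mul_assoc] }
  have hsmul : ∀ (k : (spinCover n).ker) p, k • p = liftAct ε p k.1⁻¹ := fun _ _ => rfl
  have hinv : (spinNegOne n)⁻¹ = spinNegOne n := inv_eq_of_mul_eq_one_left (spinNegOne_mul_self n)
  have hker : ∀ k : (spinCover n).ker, k = 1 ∨ k.1 = spinNegOne n := fun k => by
    have h1 := k.2
    rw [MonoidHom.mem_ker, ← map_one (spinCover n), spinCover_eq_iff, one_mul] at h1
    exact h1.imp (fun h => Subtype.ext h) id
  have hcov : IsQuotientCoveringMap (liftCov hΓ ε hε) (spinCover n).ker := by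
    refine ⟨isQuotientMap_liftCov hΓ ε hε h, ⟨fun k => (h.continuous_liftAct ε).comp
      (continuous_id.prodMk continuous_const)⟩, ?_, fun p => ?_⟩
    · intro p q
      rw [liftCov_eq_iff hΓ ε hε]
      constructor
      · rintro (rfl | rfl)
        · exact MulAction.mem_orbit_self p
        · refine ⟨⟨spinNegOne n, spinCover_spinNegOne n⟩, ?_⟩
          change liftAct ε q (spinNegOne n)⁻¹ = _
          rw [hinv]
      · rintro ⟨k, rfl⟩
        rcases hker k with rfl | hk
        · exact Or.inl (one_smul _ q)
        · right
          change liftAct ε q k.1⁻¹ = _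
          rw [hk, hinv]
    · obtain ⟨⟨x, g⟩, rfl⟩ := liftMk_surjective ε p
      obtain ⟨r, hr, hball⟩ := h.exists_ball
      -- On W, multiplication by -1 lands in v, which is disjoint from u. Together with the small
      -- ball, which rules out all γ ≠ 1, this makes the action of ±1 properly discontinuous on the
      -- quotient.
      obtain ⟨u, v, hu, hv, hgu, hgv, huv⟩ := t2_separation (mul_spinNegOne_ne g)
      let W := u ∩ (· * spinNegOne n) ⁻¹' v
      have hW : IsOpen W := hu.inter (hv.preimage (continuous_mul_const _))
      refine ⟨liftMk ε '' (Metric.ball x r ×ˢ W),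
        ((h.isOpenQuotientMap_liftMk ε).isOpenMap _ (Metric.isOpen_ball.prod hW)).mem_nhds
          ⟨(x, g), ⟨Metric.mem_ball_self hr, hgu, hgv⟩, rfl⟩, ?_⟩
      rintro k ⟨_, ⟨_, ⟨⟨y, a⟩, ⟨hy, ha⟩, rfl⟩, rfl⟩, ⟨⟨z, b⟩, ⟨hz, hb⟩, h1⟩⟩
      rcases hker k with hk | hk
      · exact hk
      exfalso
      simp only [hsmul] at h1
      rw [liftAct_liftMk, liftMk_eq_iff] at h1
      obtain ⟨γ, h1, h2⟩ := h1
      have := hball x y z hy hz γ h1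
      subst this
      rw [map_one, one_mul, hk, hinv] at h2
      refine Set.disjoint_left.mp huv hb.1 ?_
      rw [show b = a * spinNegOne n from h2.symm]
      exact ha.2
  exact hcov.isCoveringMap

/-- The spin structure `(ℝⁿ × Spin(n)) / Γ` given by a lift `ε` of the rotational part. -/
def liftSpinStructure (h : UniformlyFree Γ) : SpinStructure Γ where
  Total := LiftBundle ε
  topTotal := inferInstance
  proj := liftProj ε
  continuous_proj := continuous_liftProj ε
  act := liftAct ε
  continuous_act := h.continuous_liftAct ε
  act_one p := by
    obtain ⟨p, rfl⟩ := liftMk_surjective ε p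
    rw [liftAct_liftMk, mul_one]
  act_mul p g k := by
    obtain ⟨p, rfl⟩ := liftMk_surjective ε p
    rw [liftAct_liftMk, liftAct_liftMk, liftAct_liftMk, mul_assoc]
  locally_trivial := h.lift_locally_trivial ε
  cov := liftCov hΓ ε hε
  isCoveringMap_cov := isCoveringMap_liftCov hΓ ε hε h
  two_fold q := by
    obtain ⟨p, rfl⟩ := (isQuotientMap_liftCov hΓ ε hε h).surjective q
    have h1 : liftCov hΓ ε hε ⁻¹' {liftCov hΓ ε hε p} = {p, liftAct ε p (spinNegOne n)} := by
      ext q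
      exact liftCov_eq_iff hΓ ε hε q p
    rw [h1, Nat.card_coe_set_eq]
    refine Set.ncard_pair ?_
    obtain ⟨⟨x, g⟩, rfl⟩ := liftMk_surjective ε p
    rw [liftAct_liftMk, Ne, liftMk_eq_iff]
    rintro ⟨γ, h2, h3⟩
    have := h.eq_one γ.2 h2
    rw [show γ = 1 from Subtype.ext this, map_one, one_mul] at h3
    exact mul_spinNegOne_ne g h3.symm
  frameProj_cov p := by
    obtain ⟨p, rfl⟩ := liftMk_surjective ε p
    rfl
  cov_act p s := by
    obtain ⟨p, rfl⟩ := liftMk_surjective ε p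
    rw [liftAct_liftMk, liftCov_liftMk, liftCov_liftMk, frameAct_frameMk, map_mul]

end Cov

end FlatSpin
end
noncomputable section
namespace FlatSpin
open CliffordAlgebra Topology Pointwise

/-! ## Classification of spin structures -/

theorem PrincipalBundle.act_free {G X : Type} [Group G] [TopologicalSpace G] [TopologicalSpace X]
    (P : PrincipalBundle G X) {p : P.Total} {g h : G} (hp : P.act p g = P.act p h) : g = h := by
  obtain ⟨U, -, hxU, φ, h1, h2⟩ := P.locally_trivial (P.proj p)
  obtain ⟨⟨u, k⟩, hu⟩ := φ.surjective ⟨p, hxU⟩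
  have h3 : (φ (u, k) : P.Total) = p := congrArg Subtype.val hu
  rw [← h3, h2, h2] at hp
  have := φ.injective (Subtype.ext hp)
  exact mul_left_cancel (congrArg Prod.snd this)

theorem PrincipalBundle.exists_act_eq {G X : Type} [Group G] [TopologicalSpace G]
    [TopologicalSpace X] (P : PrincipalBundle G X) {p q : P.Total} (hpq : P.proj p = P.proj q) :
    ∃ g, P.act p g = q := by
  obtain ⟨U, -, hxU, φ, h1, h2⟩ := P.locally_trivial (P.proj p)
  obtain ⟨⟨u, k⟩, hu⟩ := φ.surjective ⟨p, hxU⟩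
  obtain ⟨⟨v, l⟩, hv⟩ := φ.surjective ⟨q, show P.proj q ∈ U from hpq ▸ hxU⟩
  have h3 : (φ (u, k) : P.Total) = p := congrArg Subtype.val hu
  have h4 : (φ (v, l) : P.Total) = q := congrArg Subtype.val hv
  have huv : u = v := Subtype.ext (by rw [← h1 u k, ← h1 v l, h3, h4, hpq])
  refine ⟨k⁻¹ * l, ?_⟩
  rw [← h3, h2, mul_inv_cancel_left, huv, h4]

variable {n : ℕ} {Γ : Subgroup (Isom n)}

theorem frameMk_eq_frameMk_iff (h : UniformlyFree Γ) (x : EuclideanSpace ℝ (Fin n)) (A B : SO n) :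
    frameMk Γ (x, A) = frameMk Γ (x, B) ↔ A = B := by
  constructor
  · intro hAB
    obtain ⟨γ, hγ, h1, h2⟩ := Quotient.exact (s := frameSetoid Γ) hAB
    rw [h.eq_one hγ h1, rotMatrix_one, one_mul] at h2
    exact Subtype.ext h2
  · rintro rfl; rfl

theorem frameMk_smul (hΓ : IsOrientable Γ) (γ : Γ) (x : EuclideanSpace ℝ (Fin n)) (A : SO n) :
    frameMk Γ (γ.1 x, A) = frameMk Γ (x, (rotSO hΓ γ)⁻¹ * A) :=
  (frameMk_eq_iff hΓ _ _).mpr ⟨γ, rfl, mul_inv_cancel_left _ _⟩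

theorem continuous_frameMk_left (A : SO n) : Continuous fun x => frameMk Γ (x, A) :=
  isQuotientMap_frameMk.continuous.comp (continuous_id.prodMk continuous_const)

/-- The spin structure `P` has character `ε` if the section of standard frames of `ℝⁿ` lifts
to `P` so that the elements of `Γ` act on the lift through `ε`. -/
def HasCharacter (P : SpinStructure Γ) (ε : Γ →* Spin n) : Prop :=
  ∃ s : EuclideanSpace ℝ (Fin n) → P.Total, Continuous s ∧ (∀ x, P.cov (s x) = frameMk Γ (x, 1)) ∧
    ∀ (γ : Γ) x, s (γ.1 x) = P.act (s x) (ε γ)⁻¹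

theorem continuous_act_const {P : SpinStructure Γ} {s : EuclideanSpace ℝ (Fin n) → P.Total}
    (hs : Continuous s) (g : Spin n) : Continuous fun x => P.act (s x) g :=
  P.continuous_act.comp (hs.prodMk continuous_const)

/-- The section of standard frames lifts through the covering because ℝⁿ is simply connected. For
each γ the maps s ∘ γ and s · t lift the same map, for the t that makes them agree at the origin, so
they agree everywhere. The elements t compose in reverse order, whence the inverses. -/
theorem exists_hasCharacter (h : UniformlyFree Γ) (hΓ : IsOrientable Γ) (P : SpinStructure Γ) :
    ∃ ε : Γ →* Spin n, (∀ γ, spinCover n (ε γ) = rotSO hΓ γ) ∧ HasCharacter P ε := by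
  have hne : (P.cov ⁻¹' {frameMk Γ (0, 1)}).Nonempty := by
    have := P.two_fold (frameMk Γ (0, 1))
    rw [Nat.card_coe_set_eq] at this
    exact Set.nonempty_of_ncard_ne_zero (by omega)
  obtain ⟨p₀, hp₀⟩ := hne
  obtain ⟨s, ⟨-, hs⟩, -⟩ := P.isCoveringMap_cov.existsUnique_continuousMap_lifts
    (⟨fun x => frameMk Γ (x, 1), continuous_frameMk_left 1⟩ : C(EuclideanSpace ℝ (Fin n), _)) 0 p₀ hp₀
  replace hs : ∀ x, P.cov (s x) = frameMk Γ (x, 1) := fun x => congrFun hs x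
  have hact : ∀ x g, P.cov (P.act (s x) g) = frameMk Γ (x, spinCover n g) := fun x g => by
    rw [P.cov_act, hs, frameAct_frameMk, one_mul]
  have key : ∀ γ : Γ, ∃ t : Spin n, spinCover n t = rotSO hΓ γ ∧
      ∀ x, s (γ.1 x) = P.act (s x) t⁻¹ := by
    intro γ
    obtain ⟨t, ht⟩ := P.exists_act_eq (p := s 0) (q := s (γ.1 0)) (by
      rw [← P.frameProj_cov, ← P.frameProj_cov, hs, hs, frameProj_frameMk, frameProj_frameMk,
        orbitMk_smul γ.2])
    have h1 : spinCover n t = (rotSO hΓ γ)⁻¹ := by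
      have h2 := congrArg P.cov ht
      rwa [hact, hs, frameMk_smul hΓ, mul_one, frameMk_eq_frameMk_iff h] at h2
    refine ⟨t⁻¹, by rw [map_inv, h1, inv_inv], fun x => ?_⟩
    rw [inv_inv]
    refine congrFun (P.isCoveringMap_cov.eq_of_comp_eq (s.continuous.comp γ.1.continuous)
      (continuous_act_const s.continuous t) ?_ 0 ht.symm) x
    funext y
    change P.cov (s (γ.1 y)) = P.cov (P.act (s y) t)
    rw [hact, hs, frameMk_smul hΓ, mul_one, h1]
  choose ε hε hs' using key
  refine ⟨MonoidHom.mk' ε fun γ δ => ?_, hε, s, s.continuous, hs, hs'⟩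
  have h1 := hs' (γ * δ) 0
  rw [show ((γ * δ : Γ) : Isom n) 0 = γ.1 (δ.1 0) from rfl, hs', hs', ← P.act_mul] at h1
  rw [← inv_inj, mul_inv_rev, P.act_free h1]

/-- Two lifts of the standard section differ by a constant in the kernel ±1, which is central and so
leaves the character unchanged. The character is therefore a complete invariant of the isomorphism
class. -/
theorem HasCharacter.unique [NeZero n] {P P' : SpinStructure Γ} {ε ε' : Γ →* Spin n}
    (h : UniformlyFree Γ) (hP : HasCharacter P ε) (hP' : HasCharacter P' ε')
    (hPP' : spinSetoid Γ P P') : ε = ε' := by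
  obtain ⟨s, hs, hs1, hs2⟩ := hP
  obtain ⟨s', hs', hs1', hs2'⟩ := hP'
  obtain ⟨f, hf1, hf2⟩ := hPP'
  obtain ⟨t, ht⟩ := P'.exists_act_eq (p := s' 0) (q := f (s 0)) (by
      rw [← P'.frameProj_cov, ← P'.frameProj_cov, hf2, hs1, hs1'])
  have h1 : spinCover n t = 1 := by
    have h2 := congrArg P'.cov ht
    rwa [P'.cov_act, hs1', frameAct_frameMk, one_mul, hf2, hs1, frameMk_eq_frameMk_iff h] at h2
  have hcomm : ∀ g, g * t = t * g := by
    rw [← map_one (spinCover n), spinCover_eq_iff] at h1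
    rcases h1 with rfl | rfl
    · intro g; rw [one_mul, mul_one]
    · intro g; rw [one_mul, spinNegOne_comm]
  have h2 : ∀ x, f (s x) = P'.act (s' x) t := by
    intro x
    refine congrFun (P'.isCoveringMap_cov.eq_of_comp_eq (f.continuous.comp hs)
      (continuous_act_const hs' t) ?_ 0 ht.symm) x
    funext y
    change P'.cov (f (s y)) = P'.cov (P'.act (s' y) t)
    rw [P'.cov_act, hf2, hs1, hs1', frameAct_frameMk, h1, one_mul]
  ext1 γ
  have h3 := h2 (γ.1 0)
  rw [hs2, hs2', hf1, h2, ← P'.act_mul, ← P'.act_mul, ← hcomm] at h3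
  exact inv_injective (mul_right_cancel (P'.act_free h3))

theorem hasCharacter_liftSpinStructure [NeZero n] (h : UniformlyFree Γ) (hΓ : IsOrientable Γ)
    (ε : Γ →* Spin n) (hε : ∀ γ, spinCover n (ε γ) = rotSO hΓ γ) :
    HasCharacter (liftSpinStructure hΓ ε hε h) ε := by
  refine ⟨fun x => liftMk ε (x, 1), (isQuotientMap_liftMk ε).continuous.comp
    (continuous_id.prodMk continuous_const), fun x => ?_, fun γ x => ?_⟩
  · change frameMk Γ (x, spinCover n 1) = _
    rw [map_one]
  · change liftMk ε _ = liftMk ε (x, 1 * (ε γ)⁻¹)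
    rw [liftMk_eq_iff]
    exact ⟨γ, rfl, by rw [one_mul, mul_inv_cancel]⟩

/-- The isomorphism is [x, g] ↦ s(x)g: well defined by equivariance of s, and bijective because
Spin(n) acts simply transitively on fibres. -/
theorem HasCharacter.equiv_liftSpinStructure [NeZero n] (h : UniformlyFree Γ)
    (hΓ : IsOrientable Γ) {ε : Γ →* Spin n} (hε : ∀ γ, spinCover n (ε γ) = rotSO hΓ γ)
    {P : SpinStructure Γ} (hP : HasCharacter P ε) :
    spinSetoid Γ (liftSpinStructure hΓ ε hε h) P := by
  obtain ⟨s, hs, hs1, hs2⟩ := hP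
  let f : LiftBundle ε → P.Total := Quotient.lift (s := liftSetoid ε) (fun p => P.act (s p.1) p.2) (by
    rintro ⟨x, g⟩ ⟨_, _⟩ ⟨γ, rfl, rfl⟩
    change P.act (s x) g = P.act (s (γ.1 x)) (ε γ * g)
    rw [hs2, ← P.act_mul, inv_mul_cancel_left])
  have hf : ∀ p, f (liftMk ε p) = P.act (s p.1) p.2 := fun _ => rfl
  have hcont : Continuous f := by
    rw [(isQuotientMap_liftMk ε).continuous_iff]
    exact P.continuous_act.comp ((hs.comp continuous_fst).prodMk continuous_snd)
  have hcov : P.cov ∘ f = liftCov hΓ ε hε := by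
    funext q
    obtain ⟨⟨x, g⟩, rfl⟩ := liftMk_surjective ε q
    rw [Function.comp_apply, hf, P.cov_act, hs1, frameAct_frameMk, liftCov_liftMk, one_mul]
  -- Openness of f follows from its being a map between two coverings of the frame bundle.
  have hloc : IsLocalHomeomorph f := by
    have h1 : IsLocalHomeomorph (P.cov ∘ f) := by
      rw [hcov]
      exact (isCoveringMap_liftCov hΓ ε hε h).isLocalHomeomorph
    exact h1.of_comp P.isCoveringMap_cov.isLocalHomeomorph hcont
  have hproj : ∀ p, P.proj (f (liftMk ε p)) = orbitMk Γ p.1 := fun p => by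
    rw [← P.frameProj_cov, ← Function.comp_apply (f := P.cov), hcov]
    rfl
  have hinj : Function.Injective f := by
    intro q q' hq
    obtain ⟨⟨x, g⟩, rfl⟩ := liftMk_surjective ε q
    obtain ⟨⟨y, k⟩, rfl⟩ := liftMk_surjective ε q'
    have h1 := congrArg P.proj hq
    rw [hproj, hproj] at h1
    obtain ⟨γ, hγ, rfl⟩ := orbitMk_eq_iff.mp h1
    rw [hf, hf, hs2 ⟨γ, hγ⟩, ← P.act_mul] at hq
    have h2 := P.act_free hq
    rw [eq_comm, liftMk_eq_iff]
    exact ⟨⟨γ, hγ⟩, rfl, by rw [show g = _ from h2, mul_inv_cancel_left]⟩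
  have hsurj : Function.Surjective f := by
    intro p
    obtain ⟨x, hx⟩ := orbitMk_surjective (P.proj p)
    obtain ⟨g, hg⟩ := P.exists_act_eq (p := s x) (q := p) (by
      rw [← P.frameProj_cov, hs1, frameProj_frameMk, hx])
    exact ⟨liftMk ε (x, g), hg⟩
  refine ⟨(Equiv.ofBijective f ⟨hinj, hsurj⟩).toHomeomorphOfContinuousOpen hcont hloc.isOpenMap,
    fun q g => ?_, fun q => congrFun hcov q⟩
  obtain ⟨⟨x, k⟩, rfl⟩ := liftMk_surjective ε q
  exact P.act_mul _ _ _

/-- Spin structures correspond to the lifts of the rotational part to the spin group. -/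
def spinClassesEquiv [NeZero n] (h : UniformlyFree Γ) (hΓ : IsOrientable Γ) :
    {ε : Γ →* Spin n // ∀ γ, spinCover n (ε γ) = rotSO hΓ γ} ≃ SpinClasses Γ :=
  Equiv.ofBijective (fun ε => Quotient.mk (spinSetoid Γ) (liftSpinStructure hΓ ε.1 ε.2 h)) <| by
    constructor
    · intro ε ε' hεε'
      exact Subtype.ext ((hasCharacter_liftSpinStructure h hΓ ε.1 ε.2).unique h
        (hasCharacter_liftSpinStructure h hΓ ε'.1 ε'.2) (Quotient.exact hεε'))
    · intro P
      induction P using Quotient.inductionOn with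
      | _ P =>
        obtain ⟨ε, hε, hP⟩ := exists_hasCharacter h hΓ P
        exact ⟨⟨ε, hε⟩, Quotient.sound (hP.equiv_liftSpinStructure h hΓ hε)⟩

/-- Two lifts of the rotational part differ by a homomorphism to `ℤ/2`. -/
theorem card_spinClasses [NeZero n] (h : UniformlyFree Γ) (hΓ : IsOrientable Γ) (ε : Γ →* Spin n)
    (hε : ∀ γ, spinCover n (ε γ) = rotSO hΓ γ) :
    Nat.card (SpinClasses Γ) = Nat.card (Γ →* ℤˣ) := by
  rw [← Nat.card_congr (spinClassesEquiv h hΓ)]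
  symm
  let z : ℤˣ →* Spin n :=
    { toFun := fun u => if u = 1 then 1 else spinNegOne n
      map_one' := if_pos rfl
      map_mul' := by
        intro u v
        have := spinNegOne_mul_self n
        rcases Int.units_eq_one_or u with rfl | rfl <;> rcases Int.units_eq_one_or v with rfl | rfl <;>
          simp [this] }
  have hz1 : z (-1) = spinNegOne n := if_neg (c := (-1 : ℤˣ) = 1) (t := (1 : Spin n)) (by decide)
  have hzinj : Function.Injective z := by
    intro u v huv
    have := spinNegOne_ne_one n
    rcases Int.units_eq_one_or u with rfl | rfl <;> rcases Int.units_eq_one_or v with rfl | rfl <;>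
      simp_all [eq_comm]
  have hzc : ∀ u g, z u * g = g * z u := by
    intro u g
    rcases Int.units_eq_one_or u with rfl | rfl
    · rw [map_one, one_mul, mul_one]
    · rw [hz1, spinNegOne_comm]
  have hzcov : ∀ u, spinCover n (z u) = 1 := by
    intro u
    rcases Int.units_eq_one_or u with rfl | rfl
    · rw [map_one, map_one]
    · rw [hz1, spinCover_spinNegOne]
  refine Nat.card_congr (Equiv.ofBijective (fun χ => ⟨MonoidHom.mk' (fun γ => z (χ γ) * ε γ)
    fun γ δ => ?_, fun γ => ?_⟩) ⟨?_, ?_⟩)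
  · rw [map_mul, map_mul, map_mul, mul_assoc, mul_assoc, ← mul_assoc (z (χ δ)), hzc (χ δ),
      mul_assoc]
  · change spinCover n (z (χ γ) * ε γ) = _
    rw [map_mul, hzcov, one_mul, hε]
  · intro χ χ' hχ
    ext1 γ
    have := DFunLike.congr_fun (congrArg Subtype.val hχ) γ
    exact hzinj (mul_right_cancel this)
  · rintro ⟨ε', hε'⟩
    -- Surjectivity: a second lift differs from ε pointwise by ±1, and centrality makes the
    -- difference multiplicative.
    have key : ∀ γ, ∃ u, z u * ε γ = ε' γ := by
      intro γ
      have h1 : spinCover n (ε' γ) = spinCover n (ε γ) := by rw [hε, hε']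
      rcases spinCover_eq_iff.mp h1 with h2 | h2
      · exact ⟨1, by rw [map_one, one_mul, h2]⟩
      · exact ⟨-1, by rw [hz1, spinNegOne_comm, h2]⟩
    choose χ hχ using key
    refine ⟨MonoidHom.mk' χ fun γ δ => hzinj ?_, Subtype.ext (MonoidHom.ext hχ)⟩
    apply mul_right_cancel (b := ε (γ * δ))
    rw [hχ, map_mul, ← hχ, ← hχ, map_mul, map_mul, mul_assoc, mul_assoc, ← mul_assoc (ε γ),
      ← hzc (χ δ), mul_assoc]

end FlatSpin
end
noncomputable section
namespace FlatSpin
open CliffordAlgebra Topology Pointwise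

/-! ## First cohomology of a flat manifold -/

/-- A retraction of `ℝᵏ⁺¹` onto the standard simplex. -/
def simplexRetraction (k : ℕ) : C(Fin (k + 1) → ℝ, stdSimplex ℝ (Fin (k + 1))) where
  -- Take positive parts; if their sum is below 1, spread the deficit evenly, otherwise divide by
  -- the sum. The two maxima make this one continuous formula with nonzero denominator.
  toFun x := ⟨fun i => (max (x i) 0 + max (1 - ∑ j, max (x j) 0) 0 / (k + 1)) /
      max (∑ j, max (x j) 0) 1, fun i => by positivity, by
    rw [← Finset.sum_div, Finset.sum_add_distrib, Finset.sum_const, Finset.card_univ,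
      Fintype.card_fin, nsmul_eq_mul]
    push_cast
    rw [mul_div_cancel₀ _ (by positivity)]
    rcases le_total (∑ j, max (x j) 0) 1 with h | h
    · rw [max_eq_left (sub_nonneg.mpr h), max_eq_right h]; ring
    · rw [max_eq_right (sub_nonpos.mpr h), max_eq_left h, add_zero, div_self (by positivity)]⟩
  continuous_toFun := by
    refine Continuous.subtype_mk (continuous_pi fun i => ?_) _
    refine Continuous.div (by fun_prop) (by fun_prop) fun x => ?_
    positivity

theorem simplexRetraction_coe {k : ℕ} (x : stdSimplex ℝ (Fin (k + 1))) :
    simplexRetraction k x = x := by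
  apply Subtype.ext
  funext i
  change (max (x i) 0 + max (1 - ∑ j, max (x j) 0) 0 / (k + 1)) / max (∑ j, max (x j) 0) 1 = x i
  have h0 : ∀ j, max (x j) 0 = x j := fun j => max_eq_left (x.2.1 j)
  have h1 : ∑ j, x j = 1 := x.2.2
  simp only [h0, h1]
  simp

/-- Precomposing with the retraction replaces the simplex by ℝᵏ⁺¹, on which maps lift through
coverings. -/
theorem exists_lift_simplex {E X : Type} [TopologicalSpace E] [TopologicalSpace X]
    {p : E → X} (hp : IsCoveringMap p) (hsurj : Function.Surjective p) {k : ℕ}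
    (σ : SingularSimplex X k) :
    ∃ τ : C(stdSimplex ℝ (Fin (k + 1)), E), ∀ t, p (τ t) = σ t := by
  obtain ⟨e, he⟩ := hsurj (σ (simplexRetraction k 0))
  obtain ⟨F, ⟨-, hF⟩, -⟩ := hp.existsUnique_continuousMap_lifts (σ.comp (simplexRetraction k)) 0 e he
  refine ⟨F.comp ⟨Subtype.val, continuous_subtype_val⟩, fun t => ?_⟩
  have := congrFun hF t.1
  simp only [Function.comp_apply, ContinuousMap.comp_apply] at this
  rw [ContinuousMap.comp_apply]
  refine this.trans ?_
  congr 1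
  exact simplexRetraction_coe t

theorem faceInclusion_apply_succAbove (k : ℕ) (i : Fin (k + 2)) (t : stdSimplex ℝ (Fin (k + 1)))
    (j : Fin (k + 1)) : faceInclusion k i t (i.succAbove j) = t j := by
  change FunOnFinite.linearMap ℝ ℝ i.succAbove t (i.succAbove j) = t j
  rw [FunOnFinite.linearMap_apply_apply]
  rw [Finset.sum_eq_single j]
  · intro b hb hne
    exact absurd (Fin.succAbove_right_injective (Finset.mem_filter.mp hb).2) hne
  · intro h
    exact absurd (by simp) h

theorem faceInclusion_apply_self (k : ℕ) (i : Fin (k + 2)) (t : stdSimplex ℝ (Fin (k + 1))) :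
    faceInclusion k i t i = 0 := by
  change FunOnFinite.linearMap ℝ ℝ i.succAbove t i = 0
  rw [FunOnFinite.linearMap_apply_apply]
  simp [Fin.succAbove_ne]

/-- The vertices of the standard simplex. -/
abbrev simplexVertex {k : ℕ} (i : Fin (k + 1)) : stdSimplex ℝ (Fin (k + 1)) := stdSimplex.vertex i

theorem faceInclusion_vertex (k : ℕ) (i : Fin (k + 2)) (j : Fin (k + 1)) :
    faceInclusion k i (simplexVertex j) = simplexVertex (i.succAbove j) :=
  stdSimplex.map_vertex _ _

theorem coboundary_zero_apply {R X : Type} [CommRing R] [TopologicalSpace X]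
    (h : SingularSimplex X 0 → R) (σ : SingularSimplex X 1) :
    coboundary R X 0 h σ = h (ContinuousMap.const _ (σ (simplexVertex 1))) -
      h (ContinuousMap.const _ (σ (simplexVertex 0))) := by
  have hc : ∀ i : Fin 2, σ.comp (faceInclusion 0 i) =
      ContinuousMap.const _ (σ (simplexVertex (i.succAbove 0))) := by
    intro i
    ext t
    rw [ContinuousMap.comp_apply, ContinuousMap.const_apply, ← faceInclusion_vertex,
      Subsingleton.elim t (simplexVertex 0)]
  change ∑ i : Fin 2, (-1 : R) ^ (i : ℕ) * h (σ.comp (faceInclusion 0 i)) = _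
  rw [Fin.sum_univ_two, hc, hc]
  simp [sub_eq_add_neg]

theorem coboundary_one_apply {R X : Type} [CommRing R] [TopologicalSpace X]
    (f : SingularSimplex X 1 → R) (τ : SingularSimplex X 2) :
    coboundary R X 1 f τ = f (τ.comp (faceInclusion 1 0)) - f (τ.comp (faceInclusion 1 1)) +
      f (τ.comp (faceInclusion 1 2)) := by
  change ∑ i : Fin 3, (-1 : R) ^ (i : ℕ) * f (τ.comp (faceInclusion 1 i)) = _
  rw [Fin.sum_univ_three]
  simp
  ring

/-! ### Filling a path in a normed space to a triangle with apex at the origin -/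

section Fill

variable {E : Type} [NormedAddCommGroup E] [NormedSpace ℝ E]

/-- The segment from the origin to `x`, as a singular simplex. -/
def raySimplex (x : E) : SingularSimplex E 1 where
  toFun t := t 1 • x
  continuous_toFun :=
    ((continuous_apply 1).comp continuous_subtype_val).smul continuous_const

theorem exists_filling (σ : SingularSimplex E 1) : ∃ τ : SingularSimplex E 2,
    τ.comp (faceInclusion 1 0) = σ ∧
    τ.comp (faceInclusion 1 1) = raySimplex (σ (simplexVertex 1)) ∧
    τ.comp (faceInclusion 1 2) = raySimplex (σ (simplexVertex 0)) := by
  let H := stdSimplexHomeomorphUnitInterval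
  let s : ℝ → E := fun r => σ (H.symm (Set.projIcc 0 1 zero_le_one r))
  have hs : Continuous s := σ.continuous.comp (H.symm.continuous.comp continuous_projIcc)
  have hst : ∀ t : stdSimplex ℝ (Fin 2), s (t 1) = σ t := by
    intro t
    have h1 : Set.projIcc (0 : ℝ) 1 zero_le_one (t 1) = H t := by
      exact Set.projIcc_of_mem zero_le_one ⟨t.2.1 1, stdSimplex.le_one t 1⟩
    change σ (H.symm _) = σ t
    rw [h1, H.symm_apply_apply]
  have hs0 : s 0 = σ (simplexVertex 0) := by rw [← hst]; rfl
  have hs1 : s 1 = σ (simplexVertex 1) := by rw [← hst]; rfl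
  -- The cone over σ would divide by t₁ + t₂ at the apex. Instead the straight triangle is corrected
  -- by the deviation d of the path from its chord: since d vanishes at both ends the two rays are
  -- unaffected, and on t₀ = 0 the weights t₁ and t₂ of the correction add up to 1.
  let d : ℝ → E := fun r => s r - (1 - r) • s 0 - r • s 1
  have hd : Continuous d := by fun_prop
  have hd0 : d 0 = 0 := by simp [d]
  have hd1 : d 1 = 0 := by simp [d]
  have hc : ∀ i : Fin 3, Continuous fun t : stdSimplex ℝ (Fin 3) => t i := fun i =>
    (continuous_apply i).comp continuous_subtype_val
  let τ : SingularSimplex E 2 :=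
    ⟨fun t => t 1 • s 0 + t 2 • s 1 + t 2 • d (1 - t 1) + t 1 • d (t 2), by
      have h1 := hc 1
      have h2 := hc 2
      have h3 : Continuous fun t : stdSimplex ℝ (Fin 3) => d (1 - t 1) :=
        hd.comp (continuous_const.sub h1)
      have h4 : Continuous fun t : stdSimplex ℝ (Fin 3) => d (t 2) := hd.comp h2
      exact (((h1.smul continuous_const).add (h2.smul continuous_const)).add
        (h2.smul h3)).add (h1.smul h4)⟩
  have hτ : ∀ t, τ t = t 1 • s 0 + t 2 • s 1 + t 2 • d (1 - t 1) + t 1 • d (t 2) := fun _ => rfl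
  have hsum : ∀ t : stdSimplex ℝ (Fin 2), 1 - t 0 = t 1 := fun t => by
    rw [← stdSimplex.add_eq_one t]; ring
  refine ⟨τ, ?_, ?_, ?_⟩
  · ext t
    have h1 : faceInclusion 1 0 t 1 = t 0 := faceInclusion_apply_succAbove 1 0 t 0
    have h2 : faceInclusion 1 0 t 2 = t 1 := faceInclusion_apply_succAbove 1 0 t 1
    rw [ContinuousMap.comp_apply, hτ, h1, h2, hsum, add_assoc, ← add_smul, add_comm (t 1) (t 0),
      stdSimplex.add_eq_one t, one_smul, ← hst]
    have h3 : t 0 = 1 - t 1 := by rw [← stdSimplex.add_eq_one t]; ring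
    rw [h3]
    simp only [d]
    abel
  · ext t
    have h1 : faceInclusion 1 1 t 1 = 0 := faceInclusion_apply_self 1 1 t
    have h2 : faceInclusion 1 1 t 2 = t 1 := faceInclusion_apply_succAbove 1 1 t 1
    rw [ContinuousMap.comp_apply, hτ, h1, h2, sub_zero, hd1, hs1]
    simp [raySimplex]
  · ext t
    have h1 : faceInclusion 1 2 t 1 = t 1 := faceInclusion_apply_succAbove 1 2 t 1
    have h2 : faceInclusion 1 2 t 2 = 0 := faceInclusion_apply_self 1 2 t
    rw [ContinuousMap.comp_apply, hτ, h1, h2, hd0, hs0]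
    simp [raySimplex]

end Fill

/-! ### Periods of cocycles, and H¹ as the group of homomorphisms -/

section Cohomology

variable {n : ℕ} {Γ : Subgroup (Isom n)} {R : Type} [CommRing R]

/-- The projection of Euclidean space to its quotient by `Γ`, as a bundled continuous map. -/
def orbitMap (Γ : Subgroup (Isom n)) : C(EuclideanSpace ℝ (Fin n), FlatManifold Γ) :=
  ⟨orbitMk Γ, isQuotientMap_orbitMk.continuous⟩

/-- The value of a 1-cochain on the image of the segment from the origin to `x`. -/
def rayIntegral (f : SingularSimplex (FlatManifold Γ) 1 → R) (x : EuclideanSpace ℝ (Fin n)) : R :=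
  f ((orbitMap Γ).comp (raySimplex x))

/-- Evaluate the cocycle condition on the image of the filled triangle. The ray integral is thus a
primitive of the pulled back cocycle. -/
theorem cocycle_eq_rayIntegral_sub {f : SingularSimplex (FlatManifold Γ) 1 → R}
    (hf : coboundary R (FlatManifold Γ) 1 f = 0)
    (σ : SingularSimplex (EuclideanSpace ℝ (Fin n)) 1) :
    f ((orbitMap Γ).comp σ) =
      rayIntegral f (σ (simplexVertex 1)) - rayIntegral f (σ (simplexVertex 0)) := by
  obtain ⟨τ, h0, h1, h2⟩ := exists_filling σ
  have h := congrFun hf ((orbitMap Γ).comp τ)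
  rw [coboundary_one_apply, ContinuousMap.comp_assoc, ContinuousMap.comp_assoc,
    ContinuousMap.comp_assoc, h0, h1, h2, Pi.zero_apply] at h
  rw [rayIntegral, rayIntegral]
  linear_combination h

theorem raySimplex_vertex_one (x : EuclideanSpace ℝ (Fin n)) :
    raySimplex x (simplexVertex 1) = x := by
  change (1 : ℝ) • x = x
  rw [one_smul]

theorem raySimplex_vertex_zero (x : EuclideanSpace ℝ (Fin n)) :
    raySimplex x (simplexVertex 0) = 0 := by
  change (0 : ℝ) • x = 0
  rw [zero_smul]

/-- A segment and its translate by γ have the same image in the quotient, so the primitive changes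
by the same amount along both. -/
theorem rayIntegral_smul {f : SingularSimplex (FlatManifold Γ) 1 → R}
    (hf : coboundary R (FlatManifold Γ) 1 f = 0) {γ : Isom n} (hγ : γ ∈ Γ)
    (x : EuclideanSpace ℝ (Fin n)) :
    rayIntegral f (γ x) = rayIntegral f (γ 0) - rayIntegral f 0 + rayIntegral f x := by
  have h1 := cocycle_eq_rayIntegral_sub hf (raySimplex x)
  have h2 := cocycle_eq_rayIntegral_sub hf
    ((⟨γ, γ.continuous⟩ : C(EuclideanSpace ℝ (Fin n), _)).comp (raySimplex x))
  have h3 : (orbitMap Γ).comp ((⟨γ, γ.continuous⟩ : C(EuclideanSpace ℝ (Fin n), _)).comp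
      (raySimplex x)) = (orbitMap Γ).comp (raySimplex x) := by
    ext t
    exact orbitMk_smul hγ _
  rw [h3, h1] at h2
  simp only [ContinuousMap.comp_apply, ContinuousMap.coe_mk, raySimplex_vertex_one,
    raySimplex_vertex_zero] at h2
  linear_combination -h2

/-- The homomorphism of periods of a 1-cocycle. -/
def periodHom (R : Type) [CommRing R] (Γ : Subgroup (Isom n)) :
    LinearMap.ker (coboundary R (FlatManifold Γ) 1) →ₗ[R] (Additive Γ →+ R) where
  toFun f := AddMonoidHom.mk' (fun γ => rayIntegral f.1 (γ.toMul.1 0) - rayIntegral f.1 0)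
    (fun γ δ => by
      have h := rayIntegral_smul f.2 γ.toMul.2 (δ.toMul.1 0)
      have h1 : (γ + δ).toMul.1 0 = γ.toMul.1 (δ.toMul.1 0) := rfl
      rw [h1, h]
      ring)
  map_add' f g := by
    ext γ
    simp [rayIntegral]
    ring
  map_smul' c f := by
    ext γ
    simp [rayIntegral]
    ring

theorem periodHom_apply (f : LinearMap.ker (coboundary R (FlatManifold Γ) 1)) (γ : Additive Γ) :
    periodHom R Γ f γ = rayIntegral f.1 (γ.toMul.1 0) - rayIntegral f.1 0 := rfl

/-- Vanishing periods mean that the primitive is Γ-invariant and descends to a 0-cochain; conversely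
the primitive of a coboundary is invariant up to a constant. -/
theorem ker_periodHom (h : UniformlyFree Γ) : LinearMap.ker (periodHom R Γ) =
    (LinearMap.range (coboundary R (FlatManifold Γ) 0)).submoduleOf
      (LinearMap.ker (coboundary R (FlatManifold Γ) 1)) := by
  ext f
  change periodHom R Γ f = 0 ↔ f.1 ∈ LinearMap.range (coboundary R (FlatManifold Γ) 0)
  constructor
  · intro hf
    have hinv : ∀ x y, orbitSetoid Γ x y → rayIntegral f.1 x = rayIntegral f.1 y := by
      rintro x _ ⟨γ, hγ, rfl⟩
      have h1 := DFunLike.congr_fun hf (Additive.ofMul ⟨γ, hγ⟩)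
      rw [periodHom_apply] at h1
      rw [rayIntegral_smul f.2 hγ, show rayIntegral f.1 (γ 0) - rayIntegral f.1 0 = 0 from h1,
        zero_add]
    refine ⟨fun c => Quotient.lift (rayIntegral f.1) hinv (c default), ?_⟩
    funext σ
    obtain ⟨τ, hτ⟩ := exists_lift_simplex h.isCoveringMap_orbitMk orbitMk_surjective σ
    obtain rfl : (orbitMap Γ).comp τ = σ := ContinuousMap.ext hτ
    rw [coboundary_zero_apply, cocycle_eq_rayIntegral_sub f.2]
    rfl
  · rintro ⟨c, hc⟩
    refine AddMonoidHom.ext fun γ => ?_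
    have h1 : ∀ x, rayIntegral f.1 x = c (ContinuousMap.const _ (orbitMk Γ x)) -
        c (ContinuousMap.const _ (orbitMk Γ 0)) := by
      intro x
      rw [rayIntegral, ← hc, coboundary_zero_apply, ContinuousMap.comp_apply,
        ContinuousMap.comp_apply, raySimplex_vertex_one, raySimplex_vertex_zero]
      rfl
    rw [periodHom_apply, h1, h1, orbitMk_smul γ.toMul.2]
    simp

/-- Choose a point in each orbit; by freeness every x determines the element of Γ carrying the
chosen point to x. No continuity is needed, since singular cochains are arbitrary functions. -/
theorem exists_equivariant (h : UniformlyFree Γ) (χ : Additive Γ →+ R) :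
    ∃ g : EuclideanSpace ℝ (Fin n) → R,
      ∀ (γ : Γ) x, g (γ.1 x) = χ (Additive.ofMul γ) + g x := by
  have key : ∀ x, ∃ γ : Γ, γ.1 (Function.surjInv orbitMk_surjective (orbitMk Γ x)) = x := by
    intro x
    obtain ⟨γ, hγ, h1⟩ := orbitMk_eq_iff.mp (Function.surjInv_eq orbitMk_surjective (orbitMk Γ x))
    exact ⟨⟨γ, hγ⟩, h1⟩
  choose k hk using key
  refine ⟨fun x => χ (Additive.ofMul (k x)), fun γ x => ?_⟩
  have h1 : k (γ.1 x) = γ * k x := by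
    have h2 := hk (γ.1 x)
    rw [orbitMk_smul γ.2] at h2
    have h3 : ((γ * k x)⁻¹ * k (γ.1 x)).1
        (Function.surjInv orbitMk_surjective (orbitMk Γ x)) =
        Function.surjInv orbitMk_surjective (orbitMk Γ x) := by
      change (γ.1 * (k x).1).symm ((k (γ.1 x)).1 _) = _
      rw [h2, show γ.1 x = (γ.1 * (k x).1)
        (Function.surjInv orbitMk_surjective (orbitMk Γ x)) from congrArg γ.1 (hk x).symm]
      exact (γ.1 * (k x).1).symm_apply_apply _
    have h4 := h.eq_one ((γ * k x)⁻¹ * k (γ.1 x)).2 h3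
    exact (inv_mul_eq_one.mp (Subtype.ext h4)).symm
  simp only [h1, ofMul_mul, map_add]

/-- The cocycle is the difference of an equivariant function at the endpoints of a lifted path;
another lift differs by an element of Γ, which cancels in the difference. -/
theorem periodHom_surjective (h : UniformlyFree Γ) : Function.Surjective (periodHom R Γ) := by
  intro χ
  obtain ⟨g, hg⟩ := exists_equivariant h χ
  have hl : ∀ {k : ℕ} (σ : SingularSimplex (FlatManifold Γ) k), ∃ τ, (orbitMap Γ).comp τ = σ := by
    intro k σ
    obtain ⟨τ, hτ⟩ := exists_lift_simplex h.isCoveringMap_orbitMk orbitMk_surjective σ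
    exact ⟨τ, ContinuousMap.ext hτ⟩
  choose lift hlift using hl (k := 1)
  let f : SingularSimplex (FlatManifold Γ) 1 → R := fun σ =>
    g (lift σ (simplexVertex 1)) - g (lift σ (simplexVertex 0))
  have hf : ∀ τ : SingularSimplex (EuclideanSpace ℝ (Fin n)) 1,
      f ((orbitMap Γ).comp τ) = g (τ (simplexVertex 1)) - g (τ (simplexVertex 0)) := by
    intro τ
    set τ' := lift ((orbitMap Γ).comp τ) with hτ'
    have h1 : ∀ t, orbitMk Γ (τ t) = orbitMk Γ (τ' t) := fun t =>
      (DFunLike.congr_fun (hlift ((orbitMap Γ).comp τ)) t).symm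
    obtain ⟨γ, hγ, h2⟩ := orbitMk_eq_iff.mp (h1 (simplexVertex 0))
    have h3 : ∀ t, γ (τ t) = τ' t := congrFun
      (h.isCoveringMap_orbitMk.eq_of_comp_eq (γ.continuous.comp τ.continuous) τ'.continuous
        (by funext t; exact (orbitMk_smul hγ _).trans (h1 t)) (simplexVertex 0) h2)
    change g (τ' _) - g (τ' _) = _
    rw [← h3, ← h3, hg ⟨γ, hγ⟩, hg ⟨γ, hγ⟩]
    ring
  have hcoc : coboundary R (FlatManifold Γ) 1 f = 0 := by
    funext σ
    obtain ⟨τ, rfl⟩ := hl σ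
    rw [coboundary_one_apply, ContinuousMap.comp_assoc, ContinuousMap.comp_assoc,
      ContinuousMap.comp_assoc, hf, hf, hf]
    simp only [ContinuousMap.comp_apply, faceInclusion_vertex]
    change g (τ (simplexVertex 2)) - g (τ (simplexVertex 1)) -
      (g (τ (simplexVertex 2)) - g (τ (simplexVertex 0))) +
      (g (τ (simplexVertex 1)) - g (τ (simplexVertex 0))) = 0
    ring
  refine ⟨⟨f, hcoc⟩, ?_⟩
  refine AddMonoidHom.ext fun γ => ?_
  change f ((orbitMap Γ).comp _) - f ((orbitMap Γ).comp _) = _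
  rw [hf, hf]
  simp only [raySimplex_vertex_one, raySimplex_vertex_zero]
  rw [hg γ.toMul]
  simp

/-- The first cohomology of a flat manifold is the group of homomorphisms from its fundamental
group to the coefficients. -/
def singularH1Equiv (R : Type) [CommRing R] (h : UniformlyFree Γ) :
    SingularH1 R (FlatManifold Γ) ≃ₗ[R] (Additive Γ →+ R) :=
  (Submodule.quotEquivOfEq _ _ (ker_periodHom h).symm).trans
    ((periodHom R Γ).quotKerEquivOfSurjective (periodHom_surjective h))

end Cohomology

end FlatSpin
end
noncomputable section
namespace FlatSpin

/-! ## A presentation of the fundamental group -/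

/-- The sign `(-1) ^ k`. -/
def sg (k : ℤ) : ℤ := if Even k then 1 else -1

theorem sg_even {k : ℤ} (h : Even k) : sg k = 1 := if_pos h

theorem sg_odd {k : ℤ} (h : Odd k) : sg k = -1 := if_neg (Int.not_even_iff_odd.mpr h)

theorem sg_mul_self (k : ℤ) : sg k * sg k = 1 := by
  rcases Int.even_or_odd k with h | h
  · rw [sg_even h]; rfl
  · rw [sg_odd h]; rfl

theorem sg_mul_emod_two (k x : ℤ) : (sg k * x) % 2 = x % 2 := by
  rcases Int.even_or_odd k with h | h
  · rw [sg_even h, one_mul]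
  · rw [sg_odd h]; omega

/-- Signs do not change parity, so triples with even sum are closed under the twisted group law of
`HWRep`. -/
theorem even_twisted_add (i j k : ℤ) {a b c a' b' c' : ℤ} (h : Even (a + b + c))
    (h' : Even (a' + b' + c')) : Even (a + sg i * a' + (b + sg j * b') + (c + sg k * c')) := by
  have h1 := sg_mul_emod_two i a'
  have h2 := sg_mul_emod_two j b'
  have h3 := sg_mul_emod_two k c'
  rw [Int.even_iff] at *
  omega

theorem even_twisted_neg (i j k : ℤ) {a b c : ℤ} (h : Even (a + b + c)) :
    Even (-(sg i * a) + -(sg j * b) + -(sg k * c)) := by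
  have h1 := sg_mul_emod_two i a
  have h2 := sg_mul_emod_two j b
  have h3 := sg_mul_emod_two k c
  rw [Int.even_iff] at *
  omega

/-- A representation in the group `X` of the group with generators `h (a, b, c)`, for integers with
even sum, `A` and `B`, where the `h (a, b, c)` form a Hantzsche–Wendt group that `A` and `B`
normalize, and `B A B⁻¹ = A⁻¹`. -/
structure HWRep (X : Type*) [Group X] where
  h : ℤ → ℤ → ℤ → X
  A : X
  B : X
  h_mul : ∀ a b c a' b' c', Even (a + b + c) → Even (a' + b' + c') →
    h a b c * h a' b' c' = h (a + sg c * a') (b + sg a * b') (c + sg b * c')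
  A_h : ∀ a b c, Even (a + b + c) → A * h a b c = h c a b * A
  B_h : ∀ a b c, Even (a + b + c) → B * h a b c = h (a + c % 2) (c + b % 2) (b + a % 2) * B
  B_A : B * A = A⁻¹ * B

namespace HWRep

variable {X Y : Type*} [Group X] [Group Y] (D : HWRep X) (D' : HWRep Y)

/-- The normal form of an element. -/
def nf (a b c m n : ℤ) : X := D.h a b c * D.A ^ m * D.B ^ n

/-- The group generated by the representation. -/
def group : Subgroup X :=
  Subgroup.closure ({D.A, D.B} ∪ {x | ∃ a b c, Even (a + b + c) ∧ x = D.h a b c})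

theorem h_mem {a b c : ℤ} (he : Even (a + b + c)) : D.h a b c ∈ D.group :=
  Subgroup.subset_closure (Or.inr ⟨a, b, c, he, rfl⟩)

theorem A_mem : D.A ∈ D.group := Subgroup.subset_closure (Or.inl (Or.inl rfl))

theorem B_mem : D.B ∈ D.group := Subgroup.subset_closure (Or.inl (Or.inr rfl))

theorem nf_mem {a b c : ℤ} (he : Even (a + b + c)) (m n : ℤ) : D.nf a b c m n ∈ D.group :=
  D.group.mul_mem (D.group.mul_mem (D.h_mem he) (D.group.zpow_mem D.A_mem m))
    (D.group.zpow_mem D.B_mem n)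

theorem h_zero : D.h 0 0 0 = 1 := by
  have := D.h_mul 0 0 0 0 0 0 (by decide) (by decide)
  simpa using this

theorem h_inv {a b c : ℤ} (he : Even (a + b + c)) :
    (D.h a b c)⁻¹ = D.h (-(sg c * a)) (-(sg a * b)) (-(sg b * c)) := by
  have he' := even_twisted_neg c a b he
  rw [inv_eq_iff_mul_eq_one, D.h_mul _ _ _ _ _ _ he he', ← D.h_zero]
  have h1 := sg_mul_self a
  have h2 := sg_mul_self b
  have h3 := sg_mul_self c
  congr 1
  · linear_combination (-a) * h3
  · linear_combination (-b) * h1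
  · linear_combination (-c) * h2

theorem A_inv_h {a b c : ℤ} (he : Even (a + b + c)) : D.A⁻¹ * D.h a b c = D.h b c a * D.A⁻¹ := by
  rw [inv_mul_eq_iff_eq_mul, ← mul_assoc, D.A_h _ _ _ (by convert he using 1; ring),
    mul_inv_cancel_right]

theorem B_inv_h {a b c : ℤ} (he : Even (a + b + c)) :
    D.B⁻¹ * D.h a b c = D.h (a - c % 2) (c - b % 2) (b - a % 2) * D.B⁻¹ := by
  have h1 := D.B_h (a - c % 2) (c - b % 2) (b - a % 2) (by grind)
  rw [inv_mul_eq_iff_eq_mul, ← mul_assoc, h1, mul_inv_cancel_right]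
  congr 1 <;> grind

theorem B_A_zpow (m : ℤ) : D.B * D.A ^ m = D.A ^ (-m) * D.B := by
  have h : SemiconjBy D.B D.A D.A⁻¹ := D.B_A
  have := h.zpow_right m
  rwa [inv_zpow, ← zpow_neg] at this

theorem B_inv_A_zpow (m : ℤ) : D.B⁻¹ * D.A ^ m = D.A ^ (-m) * D.B⁻¹ := by
  rw [inv_mul_eq_iff_eq_mul, ← mul_assoc, B_A_zpow, neg_neg, mul_inv_cancel_right]

/-- The relations move a generator, or its inverse, multiplied on the left past h(a, b, c) and Aᵐ,
so normal forms are stable. -/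
theorem mem_group_iff {x : X} :
    x ∈ D.group ↔ ∃ a b c m n, Even (a + b + c) ∧ x = D.nf a b c m n := by
  constructor
  · intro hx
    induction hx using Subgroup.closure_induction_left with
    | one => exact ⟨0, 0, 0, 0, 0, by decide, by simp [nf, D.h_zero]⟩
    | mul_left x hx y _ ih =>
      obtain ⟨a, b, c, m, n, he, rfl⟩ := ih
      rcases hx with (rfl | rfl) | ⟨a', b', c', he', rfl⟩
      · refine ⟨c, a, b, 1 + m, n, by convert he using 1; ring, ?_⟩
        rw [nf, nf, ← mul_assoc, ← mul_assoc, D.A_h _ _ _ he, zpow_one_add, mul_assoc (D.h c a b)]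
      · refine ⟨a + c % 2, c + b % 2, b + a % 2, -m, 1 + n, ?_, ?_⟩
        rotate_left
        · rw [nf, nf, ← mul_assoc, ← mul_assoc, D.B_h _ _ _ he, mul_assoc (D.h _ _ _), B_A_zpow,
            zpow_one_add, mul_assoc, mul_assoc, mul_assoc]
        · grind
      · refine ⟨_, _, _, m, n, even_twisted_add c' a' b' he' he, ?_⟩
        rw [nf, nf, ← mul_assoc, ← mul_assoc, D.h_mul _ _ _ _ _ _ he' he]
    | inv_mul_cancel x hx y _ ih =>
      obtain ⟨a, b, c, m, n, he, rfl⟩ := ih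
      rcases hx with (rfl | rfl) | ⟨a', b', c', he', rfl⟩
      · refine ⟨b, c, a, -1 + m, n, by convert he using 1; ring, ?_⟩
        rw [nf, nf, ← mul_assoc, ← mul_assoc, D.A_inv_h he, zpow_add, zpow_neg_one,
          mul_assoc (D.h b c a)]
      · refine ⟨a - c % 2, c - b % 2, b - a % 2, -m, -1 + n, ?_, ?_⟩
        rotate_left
        · rw [nf, nf, ← mul_assoc, ← mul_assoc, D.B_inv_h he, mul_assoc (D.h _ _ _), B_inv_A_zpow,
            zpow_add, zpow_neg_one, mul_assoc, mul_assoc, mul_assoc]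
        · grind
      · have he2 : Even (-(sg c' * a') + -(sg a' * b') + -(sg b' * c')) :=
          even_twisted_neg _ _ _ he'
        refine ⟨_, _, _, m, n, even_twisted_add (-(sg b' * c')) (-(sg c' * a')) (-(sg a' * b'))
          he2 he, ?_⟩
        rw [nf, nf, ← mul_assoc, ← mul_assoc, D.h_inv he', D.h_mul _ _ _ _ _ _ he2 he]
  · rintro ⟨a, b, c, m, n, he, rfl⟩
    exact D.nf_mem he m n

/-- The product of two representations. -/
def prod : HWRep (X × Y) where
  h a b c := (D.h a b c, D'.h a b c)
  A := (D.A, D'.A)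
  B := (D.B, D'.B)
  h_mul a b c a' b' c' he he' := Prod.ext (D.h_mul a b c a' b' c' he he')
    (D'.h_mul a b c a' b' c' he he')
  A_h a b c he := Prod.ext (D.A_h a b c he) (D'.A_h a b c he)
  B_h a b c he := Prod.ext (D.B_h a b c he) (D'.B_h a b c he)
  B_A := Prod.ext D.B_A D'.B_A

theorem prod_nf (a b c m n : ℤ) :
    (D.prod D').nf a b c m n = (D.nf a b c m n, D'.nf a b c m n) := by
  simp [nf, prod, Prod.pow_mk]

/-- Distinct normal forms give distinct elements. -/
def Faithful : Prop := ∀ a b c m n, Even (a + b + c) → D.nf a b c m n = 1 →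
  a = 0 ∧ b = 0 ∧ c = 0 ∧ m = 0 ∧ n = 0

theorem nf_zero : D.nf 0 0 0 0 0 = 1 := by simp [nf, D.h_zero]

variable {D}

/-- The homomorphism from a faithful representation to any other one. -/
theorem Faithful.exists_hom (hD : D.Faithful) : ∃ f : D.group →* Y,
    ∀ (x : D.group) (a b c m n : ℤ), Even (a + b + c) → (x : X) = D.nf a b c m n →
      f x = D'.nf a b c m n := by
  -- The group generated by the paired generators in X × Y is the graph of the homomorphism: its
  -- projection to X is onto by normal forms, and injective since a normal form trivial in X has
  -- zero exponents and so is trivial in Y as well.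
  have hmem : ∀ p ∈ (D.prod D').group, p.1 ∈ D.group := by
    intro p hp
    obtain ⟨a, b, c, m, n, he, rfl⟩ := (D.prod D').mem_group_iff.mp hp
    rw [prod_nf]
    exact D.nf_mem he m n
  let q : (D.prod D').group →* D.group :=
    ((MonoidHom.fst X Y).comp (D.prod D').group.subtype).codRestrict D.group
      (fun p => hmem p.1 p.2)
  have hqv : ∀ p, (q p : X) = p.1.1 := fun _ => rfl
  have hq : Function.Bijective q := by
    constructor
    · rw [injective_iff_map_eq_one]
      rintro ⟨p, hp⟩ h1
      obtain ⟨a, b, c, m, n, he, rfl⟩ := (D.prod D').mem_group_iff.mp hp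
      have h2 : D.nf a b c m n = 1 := by
        have := congrArg Subtype.val h1
        exact (congrArg Prod.fst (prod_nf D D' a b c m n)).symm.trans this
      obtain ⟨rfl, rfl, rfl, rfl, rfl⟩ := hD a b c m n he h2
      exact Subtype.ext (nf_zero _)
    · rintro ⟨x, hx⟩
      obtain ⟨a, b, c, m, n, he, rfl⟩ := D.mem_group_iff.mp hx
      refine ⟨⟨_, (D.prod D').nf_mem he m n⟩, Subtype.ext ?_⟩
      exact congrArg Prod.fst (prod_nf D D' a b c m n)
  refine ⟨((MonoidHom.snd X Y).comp (D.prod D').group.subtype).comp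
    (MulEquiv.ofBijective q hq).symm.toMonoidHom, fun x a b c m n he hx => ?_⟩
  have h1 : (MulEquiv.ofBijective q hq).symm x = ⟨_, (D.prod D').nf_mem he m n⟩ := by
    rw [MulEquiv.symm_apply_eq]
    apply Subtype.ext
    rw [hx]
    exact (congrArg Prod.fst (prod_nf D D' a b c m n)).symm
  simp [h1, prod_nf]

end HWRep

end FlatSpin
end
noncomputable section
namespace FlatSpin

/-! ## The group in adapted coordinates -/

theorem sg_eq (k : ℤ) : sg k = 1 - 2 * (k % 2) := by
  rcases Int.even_or_odd k with h | h
  · rw [sg_even h, Int.even_iff.mp h]; rfl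
  · rw [sg_odd h, Int.odd_iff.mp h]; rfl

theorem sg_congr {k l : ℤ} (h : k % 2 = l % 2) : sg k = sg l := by
  rw [sg_eq, sg_eq, h]

theorem sg_add_mul (x k y : ℤ) : sg (x + sg k * y) = sg x * sg y := by
  have h1 := sg_mul_emod_two k y
  rw [sg_congr (show (x + sg k * y) % 2 = (x + y) % 2 by omega)]
  rcases Int.even_or_odd x with h | h <;> rcases Int.even_or_odd y with h' | h'
  · rw [sg_even h, sg_even h', sg_even (h.add h')]; rfl
  · rw [sg_even h, sg_odd h', sg_odd (h.add_odd h')]; rfl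
  · rw [sg_odd h, sg_even h', sg_odd (h.add_even h')]; rfl
  · rw [sg_odd h, sg_odd h', sg_even (h.add_odd h')]; rfl

theorem sg_mul_self_real (k : ℤ) : (sg k : ℝ) * sg k = 1 := by
  exact_mod_cast sg_mul_self k

/-- The element `h (a, b, c)` as a transformation of the last three coordinates. -/
def modelH (a b c : ℤ) : Equiv.Perm (Fin 5 → ℝ) where
  toFun w := ![w 0, w 1, sg c * w 2 + 2 * a, sg a * w 3 + 2 * b, sg b * w 4 + 2 * c]
  invFun w := ![w 0, w 1, sg c * (w 2 - 2 * a), sg a * (w 3 - 2 * b), sg b * (w 4 - 2 * c)]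
  left_inv w := by
    ext i
    fin_cases i <;> simp [← mul_assoc, sg_mul_self_real]
  right_inv w := by
    ext i
    fin_cases i <;> simp [← mul_assoc, sg_mul_self_real]

/-- The element `A`, permuting the last three coordinates cyclically. -/
def modelA : Equiv.Perm (Fin 5 → ℝ) where
  toFun w := ![w 0 + 1, w 1, w 4, w 2, w 3]
  invFun w := ![w 0 - 1, w 1, w 3, w 4, w 2]
  left_inv w := by
    ext i
    fin_cases i <;> simp
  right_inv w := by
    ext i
    fin_cases i <;> simp

/-- The element `B`, exchanging the last two coordinates. -/
def modelB : Equiv.Perm (Fin 5 → ℝ) where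
  toFun w := ![-w 0, w 1 + 1, w 2 + 1, w 4 + 1, w 3 + 1]
  invFun w := ![-w 0, w 1 - 1, w 2 - 1, w 4 - 1, w 3 - 1]
  left_inv w := by
    ext i
    fin_cases i <;> simp
  right_inv w := by
    ext i
    fin_cases i <;> simp

theorem modelH_apply (a b c : ℤ) (w : Fin 5 → ℝ) : modelH a b c w =
    ![w 0, w 1, sg c * w 2 + 2 * a, sg a * w 3 + 2 * b, sg b * w 4 + 2 * c] := rfl

theorem modelA_apply (w : Fin 5 → ℝ) : modelA w = ![w 0 + 1, w 1, w 4, w 2, w 3] := rfl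

theorem modelB_apply (w : Fin 5 → ℝ) :
    modelB w = ![-w 0, w 1 + 1, w 2 + 1, w 4 + 1, w 3 + 1] := rfl

/-- The group in adapted coordinates. -/
def model : HWRep (Equiv.Perm (Fin 5 → ℝ)) where
  h := modelH
  A := modelA
  B := modelB
  h_mul a b c a' b' c' _ _ := by
    ext w i
    rw [Equiv.Perm.mul_apply]
    simp only [modelH_apply, sg_add_mul]
    fin_cases i <;> simp <;> ring
  A_h a b c _ := by
    ext w i
    simp only [Equiv.Perm.mul_apply, modelH_apply, modelA_apply]
    fin_cases i <;> simp
  B_h a b c he := by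
    rw [Int.even_iff] at he
    ext w i
    simp only [Equiv.Perm.mul_apply, modelH_apply, modelB_apply]
    rw [sg_congr (show (b + a % 2) % 2 = c % 2 by omega),
      sg_congr (show (a + c % 2) % 2 = b % 2 by omega),
      sg_congr (show (c + b % 2) % 2 = a % 2 by omega), sg_eq, sg_eq, sg_eq]
    fin_cases i <;> simp <;> ring
  B_A := by
    rw [eq_inv_mul_iff_mul_eq]
    ext w i
    simp only [Equiv.Perm.mul_apply, modelA_apply, modelB_apply]
    fin_cases i <;> simp

theorem zpow_apply_eq_add {α R : Type*} [AddCommGroup R] (p : Equiv.Perm α) (f : α → R) (r : R)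
    (h : ∀ x, f (p x) = f x + r) (n : ℤ) (x : α) : f ((p ^ n) x) = f x + n • r := by
  induction n using Int.induction_on with
  | zero => simp
  | succ n ih => rw [add_comm, zpow_add, zpow_one, Equiv.Perm.mul_apply, h, ih, add_smul, one_smul]; abel
  | pred n ih =>
    have h1 := h ((p ^ (-(n : ℤ) - 1)) x)
    rw [← Equiv.Perm.mul_apply, ← zpow_one_add, add_sub_cancel, ih] at h1
    rw [sub_smul, one_smul, ← add_sub_assoc, h1, add_sub_cancel_right]

theorem model_nf_one (a b c m n : ℤ) (w : Fin 5 → ℝ) : model.nf a b c m n w 1 = w 1 + n := by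
  have h1 := zpow_apply_eq_add modelA (fun w : Fin 5 → ℝ => w 1) 0
    (fun w => by simp [modelA_apply]) m ((modelB ^ n) w)
  have h2 := zpow_apply_eq_add modelB (fun w : Fin 5 → ℝ => w 1) 1
    (fun w => by simp [modelB_apply]) n w
  simp only [smul_zero, add_zero] at h1
  calc _ = ((modelA ^ m) ((modelB ^ n) w)) 1 := rfl
    _ = _ := by rw [h1, h2, zsmul_one]

theorem model_nf_zero (a b c m : ℤ) (w : Fin 5 → ℝ) : model.nf a b c m 0 w 0 = w 0 + m := by
  have h1 := zpow_apply_eq_add modelA (fun w : Fin 5 → ℝ => w 0) 1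
    (fun w => by simp [modelA_apply]) m w
  calc _ = ((modelA ^ m) w) 0 := rfl
    _ = _ := by rw [h1, zsmul_one]

/-- The exponent n is read off from w₁ and, when n = 0, m from w₀. For m = n = 0 some coordinate is
shifted without reversal by a nonzero even integer. -/
theorem model_displacement {a b c m n : ℤ} (he : Even (a + b + c)) (hne : model.nf a b c m n ≠ 1)
    (w : Fin 5 → ℝ) : ∃ i, 1 ≤ |model.nf a b c m n w i - w i| := by
  have hcast : ∀ k : ℤ, k ≠ 0 → (1 : ℝ) ≤ |(k : ℝ)| := fun k hk => by
    exact_mod_cast Int.one_le_abs hk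
  by_cases hn : n = 0
  · subst hn
    by_cases hm : m = 0
    · subst hm
      have hh : model.nf a b c 0 0 = modelH a b c := by simp [HWRep.nf, model]
      rw [hh] at hne ⊢
      -- If all three fail, a ≠ 0 makes c odd, hence b odd, hence a odd, against the even sum; and a
      -- = 0 gives b = 0 and then c = 0.
      have key : (Even c ∧ a ≠ 0) ∨ (Even a ∧ b ≠ 0) ∨ (Even b ∧ c ≠ 0) := by
        by_contra hcon
        have h0 : a = 0 ∧ b = 0 ∧ c = 0 := by grind
        obtain ⟨rfl, rfl, rfl⟩ := h0
        exact hne model.h_zero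
      have h2 : ∀ k : ℤ, k ≠ 0 → (1 : ℝ) ≤ |2 * (k : ℝ)| := fun k hk => by
        have := hcast (2 * k) (by omega)
        push_cast at this
        exact this
      rcases key with ⟨h, h'⟩ | ⟨h, h'⟩ | ⟨h, h'⟩
      · exact ⟨2, by simpa [modelH_apply, sg_even h] using h2 _ h'⟩
      · exact ⟨3, by simpa [modelH_apply, sg_even h] using h2 _ h'⟩
      · exact ⟨4, by simpa [modelH_apply, sg_even h] using h2 _ h'⟩
    · exact ⟨0, by rw [model_nf_zero, add_sub_cancel_left]; exact hcast m hm⟩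
  · exact ⟨1, by rw [model_nf_one, add_sub_cancel_left]; exact hcast n hn⟩

theorem model_faithful : model.Faithful := by
  intro a b c m n he h1
  have h := fun i => congrFun (Equiv.congr_fun h1 0) i
  have hn : n = 0 := by
    have := h 1
    rw [model_nf_one] at this
    simpa using this
  subst hn
  have hm : m = 0 := by
    have := h 0
    rw [model_nf_zero] at this
    simpa using this
  subst hm
  have hh : model.nf a b c 0 0 = modelH a b c := by simp [HWRep.nf, model]
  rw [hh] at h
  have h2 := h 2
  have h3 := h 3
  have h4 := h 4
  simp [modelH_apply] at h2 h3 h4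
  exact ⟨h2, h3, h4, rfl, rfl⟩

theorem modelA_pow_three : modelA ^ (3 : ℤ) = Equiv.addRight ![3, 0, 0, 0, 0] := by
  ext w i
  rw [show (3 : ℤ) = 1 + 1 + 1 by rfl, zpow_add, zpow_add, zpow_one]
  simp only [Equiv.Perm.mul_apply, modelA_apply]
  fin_cases i <;> simp
  ring

theorem modelB_pow_two : modelB ^ (2 : ℤ) = Equiv.addRight ![0, 2, 2, 2, 2] := by
  ext w i
  rw [show (2 : ℤ) = 1 + 1 by rfl, zpow_add, zpow_one]
  simp only [Equiv.Perm.mul_apply, modelB_apply]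
  fin_cases i <;> simp <;> ring

theorem modelH_two_mul (a b c : ℤ) :
    modelH (2 * a) (2 * b) (2 * c) = Equiv.addRight ![0, 0, 4 * (a : ℝ), 4 * (b : ℝ), 4 * (c : ℝ)] := by
  ext w i
  rw [modelH_apply, sg_even (even_two_mul a), sg_even (even_two_mul b), sg_even (even_two_mul c)]
  fin_cases i <;> simp <;> ring

/-- Every orbit of the group meets a box. -/
theorem model_cocompact (w : Fin 5 → ℝ) : ∃ p ∈ model.group, ∀ i, p w i ∈ Set.Icc (0 : ℝ) 4 := by
  have hfloor : ∀ (x d : ℝ), 0 < d → d ≤ 4 → ∃ m : ℤ, x + m * d ∈ Set.Icc (0 : ℝ) 4 := by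
    intro x d hd hd4
    have h1 := Int.floor_le (x / d)
    have h2 := Int.lt_floor_add_one (x / d)
    rw [le_div_iff₀ hd] at h1
    rw [div_lt_iff₀ hd] at h2
    refine ⟨-⌊x / d⌋, ?_⟩
    push_cast
    constructor <;> linarith
  -- A³, B² and h(2a, 2b, 2c) are translations of length 3 in w₀, 2 in w₁ and multiples of 4 in the
  -- rest. B² also moves the last three coordinates, so these are corrected last.
  obtain ⟨m, hm⟩ := hfloor (w 0) 3 (by norm_num) (by norm_num)
  obtain ⟨n, hn⟩ := hfloor (w 1) 2 (by norm_num) (by norm_num)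
  obtain ⟨w', hw'⟩ : ∃ w', ((modelA ^ (3 : ℤ)) ^ m) (((modelB ^ (2 : ℤ)) ^ n) w) = w' := ⟨_, rfl⟩
  have hA : ∀ i w, ((modelA ^ (3 : ℤ)) ^ m) w i = w i + m • (![3, 0, 0, 0, 0] : Fin 5 → ℝ) i :=
    fun i => zpow_apply_eq_add _ (fun w : Fin 5 → ℝ => w i) _ (fun w => by rw [modelA_pow_three]; rfl) m
  have hB : ∀ i w, ((modelB ^ (2 : ℤ)) ^ n) w i = w i + n • (![0, 2, 2, 2, 2] : Fin 5 → ℝ) i :=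
    fun i => zpow_apply_eq_add _ (fun w : Fin 5 → ℝ => w i) _ (fun w => by rw [modelB_pow_two]; rfl) n
  have hw0 : w' 0 = w 0 + m * 3 := by rw [← hw', hA, hB]; simp
  have hw1 : w' 1 = w 1 + n * 2 := by rw [← hw', hA, hB]; simp
  rw [← hw0] at hm
  rw [← hw1] at hn
  obtain ⟨a, ha⟩ := hfloor (w' 2) 4 (by norm_num) (by norm_num)
  obtain ⟨b, hb⟩ := hfloor (w' 3) 4 (by norm_num) (by norm_num)
  obtain ⟨c, hc⟩ := hfloor (w' 4) 4 (by norm_num) (by norm_num)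
  refine ⟨modelH (2 * a) (2 * b) (2 * c) *
    ((modelA ^ (3 : ℤ)) ^ m * (modelB ^ (2 : ℤ)) ^ n), ?_, ?_⟩
  · refine model.group.mul_mem (model.h_mem ?_) (model.group.mul_mem ?_ ?_)
    · rw [Int.even_iff]; omega
    · exact model.group.zpow_mem (model.group.zpow_mem model.A_mem _) _
    · exact model.group.zpow_mem (model.group.zpow_mem model.B_mem _) _
  · rw [Equiv.Perm.mul_apply, Equiv.Perm.mul_apply, hw', modelH_two_mul]
    intro i
    fin_cases i
    · simpa using hm
    · simpa using hn
    · simpa [mul_comm] using ha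
    · simpa [mul_comm] using hb
    · simpa [mul_comm] using hc

end FlatSpin
end
noncomputable section
namespace FlatSpin
open Matrix

/-! ## Change of coordinates -/

/-- The linear part of the adapted coordinates. -/
def adaptedLinear : (Fin 5 → ℝ) ≃ₗ[ℝ] (Fin 5 → ℝ) where
  toFun x := ![3 * x 0, 2 * (x 4 - x 3), 2 * (x 3 + x 4 - 2 * x 2), 2 * (x 3 + x 4 - 2 * x 1),
    2 * (x 3 + x 4)]
  map_add' x y := by
    ext i
    fin_cases i <;> simp <;> ring
  map_smul' c x := by
    ext i
    fin_cases i <;> simp <;> ring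
  invFun w := ![w 0 / 3, (w 4 - w 3) / 4, (w 4 - w 2) / 4, (w 4 - w 1) / 4, (w 4 + w 1) / 4]
  left_inv x := by
    ext i
    fin_cases i <;> simp <;> ring
  right_inv w := by
    ext i
    fin_cases i <;> simp <;> ring

/-- The adapted coordinates. -/
def adapted : (Fin 5 → ℝ) ≃ᵃ[ℝ] (Fin 5 → ℝ) :=
  -- The shift of origin is chosen so that the given generators act exactly as words in `modelA`,
  -- `modelB` and `modelH`.
  adaptedLinear.toAffineEquiv.trans (AffineEquiv.constVAdd ℝ (Fin 5 → ℝ) ![-1, 0, 1, 1, 1])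

theorem adapted_symm_apply (w : Fin 5 → ℝ) : adapted.symm w =
    ![(w 0 + 1) / 3, (w 4 - w 3) / 4, (w 4 - w 2) / 4, (w 4 - 1 - w 1) / 4,
      (w 4 - 1 + w 1) / 4] := by
  change adaptedLinear.symm (-![-1, 0, 1, 1, 1] + w) = _
  simp only [adaptedLinear, LinearEquiv.coe_symm_mk]
  ext i
  fin_cases i <;> simp <;> ring

/-- The vector `(x, 1)`. -/
def homogeneous (x : Fin 5 → ℝ) : Fin 6 → ℝ := ![x 0, x 1, x 2, x 3, x 4, 1]

theorem homogeneous_castSucc (x : Fin 5 → ℝ) (i : Fin 5) : homogeneous x i.castSucc = x i := by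
  fin_cases i <;> rfl

theorem affineApply_eq (M : Matrix (Fin 6) (Fin 6) ℝ) (x : Fin 5 → ℝ) (i : Fin 5) :
    affineApply M x i = (M *ᵥ homogeneous x) i.castSucc := by
  have h : (M *ᵥ homogeneous x) i.castSucc = ∑ j, M i.castSucc j * homogeneous x j := rfl
  rw [h, Fin.sum_univ_castSucc, affineApply]
  simp only [homogeneous_castSucc]
  simp [homogeneous, Fin.last]

/-- The matrix `M` acts in adapted coordinates as the transformation `p`. -/
def ActsAs (M : Matrix (Fin 6) (Fin 6) ℝ) (p : Equiv.Perm (Fin 5 → ℝ)) : Prop :=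
  ∀ w, M *ᵥ homogeneous (adapted.symm w) = homogeneous (adapted.symm (p w))

theorem ActsAs.affineApply {M : Matrix (Fin 6) (Fin 6) ℝ} {p : Equiv.Perm (Fin 5 → ℝ)}
    (h : ActsAs M p) (w : Fin 5 → ℝ) :
    affineApply M (adapted.symm w) = adapted.symm (p w) := by
  ext i
  rw [affineApply_eq, h w, homogeneous_castSucc]

/-- The matrix maps the affine hyperplane of vectors (x, 1) onto itself, and this hyperplane spans
ℝ⁶. -/
theorem ActsAs.exists_gl {M : Matrix (Fin 6) (Fin 6) ℝ} {p : Equiv.Perm (Fin 5 → ℝ)}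
    (h : ActsAs M p) : ∃ g : GL (Fin 6) ℝ, (g : Matrix (Fin 6) (Fin 6) ℝ) = M := by
  have hs : ∀ x, ∃ y, M *ᵥ y = homogeneous x := fun x =>
    ⟨_, (h (p.symm (adapted x))).trans (by simp)⟩
  have hsurj : Function.Surjective M.mulVec := by
    intro y
    obtain ⟨y₁, h₁⟩ := hs 0
    obtain ⟨y₂, h₂⟩ := hs (fun i => y i.castSucc)
    -- Writes y = (y', t) as (t - 1)(0, 1) + (y', 1).
    refine ⟨(y (Fin.last 5) - 1) • y₁ + y₂, ?_⟩
    rw [mulVec_add, mulVec_smul, h₁, h₂]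
    ext i
    fin_cases i <;> simp [homogeneous, Fin.last]
  have hu := mulVec_surjective_iff_isUnit.mp hsurj
  exact ⟨hu.unit, rfl⟩

/-- The pairs of a matrix and the transformation by which it acts. -/
def actsAsGroup : Subgroup (GL (Fin 6) ℝ × Equiv.Perm (Fin 5 → ℝ)) where
  carrier := {q | ActsAs (q.1 : Matrix (Fin 6) (Fin 6) ℝ) q.2}
  mul_mem' {q r} hq hr w := by
    change ((q.1 * r.1 : GL (Fin 6) ℝ) : Matrix (Fin 6) (Fin 6) ℝ) *ᵥ _ = _
    rw [Units.val_mul, ← mulVec_mulVec, hr w, hq]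
    rfl
  one_mem' w := by
    change ((1 : GL (Fin 6) ℝ) : Matrix (Fin 6) (Fin 6) ℝ) *ᵥ _ = _
    rw [Units.val_one, one_mulVec]
    rfl
  inv_mem' {q} hq w := by
    have h := hq (q.2.symm w)
    rw [Equiv.apply_symm_apply] at h
    change ((q.1⁻¹ : GL (Fin 6) ℝ) : Matrix (Fin 6) (Fin 6) ℝ) *ᵥ _ = _
    rw [← h, mulVec_mulVec, ← Units.val_mul, inv_mul_cancel, Units.val_one, one_mulVec]
    rfl

/-- The transformations by which the elements of `C` act. -/
def actionImage (C : Subgroup (GL (Fin 6) ℝ)) : Subgroup (Equiv.Perm (Fin 5 → ℝ)) :=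
  (actsAsGroup ⊓ C.comap (MonoidHom.fst _ _)).map (MonoidHom.snd _ _)

theorem mem_actionImage {C : Subgroup (GL (Fin 6) ℝ)} {p : Equiv.Perm (Fin 5 → ℝ)} :
    p ∈ actionImage C ↔ ∃ g ∈ C, ActsAs (g : Matrix (Fin 6) (Fin 6) ℝ) p := by
  constructor
  · rintro ⟨⟨g, p⟩, ⟨h1, h2⟩, rfl⟩
    exact ⟨g, h2, h1⟩
  · rintro ⟨g, hg, hp⟩
    exact ⟨⟨g, p⟩, ⟨hp, hg⟩, rfl⟩

/-- The pairs (matrix, transformation) with the transformation in P form a subgroup, so its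
projection contains the closure as soon as it contains the generators. -/
theorem exists_actsAs_of_mem_closure {S : Set (GL (Fin 6) ℝ)}
    {P : Subgroup (Equiv.Perm (Fin 5 → ℝ))}
    (h : ∀ g ∈ S, ∃ p ∈ P, ActsAs (g : Matrix (Fin 6) (Fin 6) ℝ) p) {g : GL (Fin 6) ℝ}
    (hg : g ∈ Subgroup.closure S) : ∃ p ∈ P, ActsAs (g : Matrix (Fin 6) (Fin 6) ℝ) p := by
  have hle : Subgroup.closure S ≤
      (actsAsGroup ⊓ P.comap (MonoidHom.snd _ _)).map (MonoidHom.fst _ _) := by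
    rw [Subgroup.closure_le]
    intro g hg
    obtain ⟨p, hp, hgp⟩ := h g hg
    exact ⟨⟨g, p⟩, ⟨hgp, hp⟩, rfl⟩
  obtain ⟨⟨g, p⟩, ⟨h1, h2⟩, rfl⟩ := hle hg
  exact ⟨p, h2, h1⟩

/-- The isometries, read in coordinates given by `ψ`. -/
def readIn {n : ℕ} (ψ : (Fin n → ℝ) ≃ᵃ[ℝ] EuclideanSpace ℝ (Fin n)) :
    Isom n →* Equiv.Perm (Fin n → ℝ) where
  toFun γ := (ψ.toEquiv.trans γ.toEquiv).trans ψ.toEquiv.symm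
  map_one' := by
    ext1 w
    exact ψ.symm_apply_apply w
  map_mul' γ δ := by
    ext1 w
    change ψ.symm (γ (δ (ψ w))) = ψ.symm (γ (ψ (ψ.symm (δ (ψ w)))))
    rw [ψ.apply_symm_apply]

theorem apply_readIn {n : ℕ} (ψ : (Fin n → ℝ) ≃ᵃ[ℝ] EuclideanSpace ℝ (Fin n)) (γ : Isom n)
    (w : Fin n → ℝ) : ψ (readIn ψ γ w) = γ (ψ w) := ψ.apply_symm_apply _

theorem readIn_eq_iff {n : ℕ} {ψ : (Fin n → ℝ) ≃ᵃ[ℝ] EuclideanSpace ℝ (Fin n)} {γ : Isom n}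
    {p : Equiv.Perm (Fin n → ℝ)} : readIn ψ γ = p ↔ ∀ w, γ (ψ w) = ψ (p w) := by
  constructor
  · rintro rfl w
    exact (apply_readIn ψ γ w).symm
  · intro h
    ext1 w
    apply ψ.injective
    rw [apply_readIn, h]

theorem readIn_injective {n : ℕ} (ψ : (Fin n → ℝ) ≃ᵃ[ℝ] EuclideanSpace ℝ (Fin n)) :
    Function.Injective (readIn ψ) := by
  intro γ δ h
  ext1 x
  obtain ⟨w, rfl⟩ := ψ.surjective x
  rw [← apply_readIn, h, apply_readIn]

/-- Translates both statements on Euclidean forms into equations between groups of transformations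
of ℝ⁵, where everything is computed; the given φ enters only through `readIn`. -/
theorem isEuclideanForm_iff {C : Subgroup (GL (Fin 6) ℝ)} {P : Subgroup (Equiv.Perm (Fin 5 → ℝ))}
    (h1 : ∀ g ∈ C, ∃ p ∈ P, ActsAs (g : Matrix (Fin 6) (Fin 6) ℝ) p)
    (h2 : P ≤ actionImage C) (φ : (Fin 5 → ℝ) ≃ᵃ[ℝ] EuclideanSpace ℝ (Fin 5))
    (Γ : Subgroup (Isom 5)) :
    IsEuclideanForm C φ Γ ↔ Γ.map (readIn (adapted.symm.trans φ)) = P := by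
  have key : ∀ (γ : Isom 5) (g : GL (Fin 6) ℝ) (p : Equiv.Perm (Fin 5 → ℝ)),
      ActsAs (g : Matrix (Fin 6) (Fin 6) ℝ) p →
      ((∀ x, γ (φ x) = φ (affineApply (g : Matrix _ _ ℝ) x)) ↔
        readIn (adapted.symm.trans φ) γ = p) := by
    intro γ g p hp
    rw [readIn_eq_iff]
    constructor
    · intro h w
      rw [AffineEquiv.trans_apply, h, hp.affineApply]
      rfl
    · intro h x
      obtain ⟨w, rfl⟩ := adapted.symm.surjective x
      rw [hp.affineApply]
      exact h w
  constructor
  · rintro ⟨h3, h4⟩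
    ext p
    constructor
    · rintro ⟨γ, hγ, rfl⟩
      obtain ⟨g, hg, h⟩ := h4 γ hγ
      obtain ⟨p, hp, hgp⟩ := h1 g hg
      rw [(key γ g p hgp).mp h]
      exact hp
    · intro hp
      obtain ⟨g, hg, hgp⟩ := mem_actionImage.mp (h2 hp)
      obtain ⟨γ, hγ, h⟩ := h3 g hg
      exact ⟨γ, hγ, (key γ g p hgp).mp h⟩
  · rintro rfl
    constructor
    · intro g hg
      obtain ⟨p, ⟨γ, hγ, rfl⟩, hgp⟩ := h1 g hg
      exact ⟨γ, hγ, (key γ g _ hgp).mpr rfl⟩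
    · intro γ hγ
      obtain ⟨g, hg, hgp⟩ := mem_actionImage.mp (h2 ⟨γ, hγ, rfl⟩)
      exact ⟨g, hg, (key γ g _ hgp).mpr rfl⟩

theorem modelA_inv_apply (w : Fin 5 → ℝ) : modelA⁻¹ w = ![w 0 - 1, w 1, w 3, w 4, w 2] := rfl

theorem modelB_inv_apply (w : Fin 5 → ℝ) :
    modelB⁻¹ w = ![-w 0, w 1 - 1, w 2 - 1, w 4 - 1, w 3 - 1] := rfl

theorem genMatrix₁_actsAs : ActsAs genMatrix₁ modelA⁻¹ := by
  intro w
  rw [adapted_symm_apply, adapted_symm_apply, modelA_inv_apply]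
  ext i
  fin_cases i <;>
    simp [mulVec, dotProduct, Fin.sum_univ_six, homogeneous, genMatrix₁] <;> ring

theorem sg_zero : sg 0 = 1 := rfl

theorem sg_one : sg 1 = -1 := rfl

theorem sg_two : sg 2 = 1 := rfl

theorem sg_neg_one : sg (-1) = -1 := rfl

theorem genMatrix₂_actsAs : ActsAs genMatrix₂ (modelH 1 0 (-1) * (modelA⁻¹ * modelA⁻¹) * modelB) := by
  intro w
  simp only [adapted_symm_apply, Equiv.Perm.mul_apply, modelA_inv_apply, modelB_apply, modelH_apply,
    sg_zero, sg_one, sg_neg_one]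
  ext i
  fin_cases i <;>
    simp [mulVec, dotProduct, Fin.sum_univ_six, homogeneous, genMatrix₂] <;> ring

theorem sylowMatrixA_actsAs : ActsAs sylowMatrixA (modelH 1 2 1) := by
  intro w
  simp only [adapted_symm_apply, modelH_apply, sg_two, sg_one]
  ext i
  fin_cases i <;>
    simp [mulVec, dotProduct, Fin.sum_univ_six, homogeneous, sylowMatrixA] <;> ring

theorem sylowMatrixB_actsAs : ActsAs sylowMatrixB (modelH 0 1 1 * modelB⁻¹) := by
  intro w
  simp only [adapted_symm_apply, Equiv.Perm.mul_apply, modelB_inv_apply, modelH_apply, sg_zero,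
    sg_one]
  ext i
  fin_cases i <;>
    simp [mulVec, dotProduct, Fin.sum_univ_six, homogeneous, sylowMatrixB] <;> ring

theorem transMatrix_mulVec (i : Fin 5) (x : Fin 5 → ℝ) :
    transMatrix i *ᵥ homogeneous x = homogeneous x + Pi.single i.castSucc 1 := by
  rw [transMatrix, add_mulVec, one_mulVec]
  congr 1
  rw [single_mulVec]
  simp [homogeneous, Fin.last, Pi.single]

theorem transMatrix_zero_actsAs : ActsAs (transMatrix 0) (modelA ^ (3 : ℤ)) := by
  intro w
  rw [adapted_symm_apply, adapted_symm_apply, transMatrix_mulVec, modelA_pow_three]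
  ext i
  fin_cases i <;> simp [homogeneous]
  ring

theorem transMatrix_one_actsAs : ActsAs (transMatrix 1) (modelH (2 * 0) (2 * -1) (2 * 0)) := by
  intro w
  rw [adapted_symm_apply, adapted_symm_apply, transMatrix_mulVec, modelH_two_mul]
  ext i
  fin_cases i <;> simp [homogeneous]
  ring

theorem transMatrix_two_actsAs : ActsAs (transMatrix 2) (modelH (2 * -1) (2 * 0) (2 * 0)) := by
  intro w
  rw [adapted_symm_apply, adapted_symm_apply, transMatrix_mulVec, modelH_two_mul]
  ext i
  fin_cases i <;> simp [homogeneous]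
  ring

theorem transMatrix_three_actsAs :
    ActsAs (transMatrix 3) (modelH (2 * 1) (2 * 1) (2 * 1) * (modelB ^ (2 : ℤ))⁻¹) := by
  intro w
  rw [adapted_symm_apply, adapted_symm_apply, transMatrix_mulVec, modelH_two_mul,
    zpow_two, _root_.mul_inv_rev]
  simp only [Equiv.Perm.mul_apply, Equiv.coe_addRight, modelB_inv_apply]
  ext i
  fin_cases i <;> simp [homogeneous] <;> ring

theorem transMatrix_four_actsAs : ActsAs (transMatrix 4) (modelB ^ (2 : ℤ)) := by
  intro w
  rw [adapted_symm_apply, adapted_symm_apply, transMatrix_mulVec, modelB_pow_two]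
  ext i
  fin_cases i <;> simp [homogeneous] <;> ring

/-- Elements with even entries are translations, and multiplying by them changes the triple freely
within its parity class. -/
theorem modelH_mem_of_parity {H : Subgroup (Equiv.Perm (Fin 5 → ℝ))}
    (h2 : ∀ a b c, modelH (2 * a) (2 * b) (2 * c) ∈ H) {a b c a' b' c' : ℤ}
    (h : modelH a b c ∈ H) (he : Even (a + b + c)) (ha : a' % 2 = a % 2) (hb : b' % 2 = b % 2)
    (hc : c' % 2 = c % 2) : modelH a' b' c' ∈ H := by
  have h3 := model.h_mul (2 * ((a' - a) / 2)) (2 * ((b' - b) / 2)) (2 * ((c' - c) / 2)) a b c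
    (by rw [Int.even_iff]; omega) he
  rw [sg_even (even_two_mul _), sg_even (even_two_mul _), sg_even (even_two_mul _), one_mul,
    one_mul, one_mul, show 2 * ((a' - a) / 2) + a = a' by omega,
    show 2 * ((b' - b) / 2) + b = b' by omega, show 2 * ((c' - c) / 2) + c = c' by omega] at h3
  have h4 : modelH a' b' c' = _ := h3.symm
  rw [h4]
  exact H.mul_mem (h2 _ _ _) h

/-- An even sum leaves four parity classes, a Klein four-group generated by two of them. -/
theorem modelH_mem_of_parities {H : Subgroup (Equiv.Perm (Fin 5 → ℝ))}
    (h2 : ∀ a b c, modelH (2 * a) (2 * b) (2 * c) ∈ H) (h₁ : modelH 1 0 1 ∈ H)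
    (h₂ : modelH 0 1 1 ∈ H) {a b c : ℤ} (he : Even (a + b + c)) : modelH a b c ∈ H := by
  have h₃ : modelH 1 (-1) 2 ∈ H := by
    have := model.h_mul 1 0 1 0 1 1 (by decide) (by decide)
    have h4 : modelH 1 (-1) 2 = _ := this.symm
    rw [h4]
    exact H.mul_mem h₁ h₂
  rw [Int.even_iff] at he
  rcases Int.emod_two_eq_zero_or_one a with ha | ha <;>
    rcases Int.emod_two_eq_zero_or_one b with hb | hb
  · exact modelH_mem_of_parity h2 (h2 0 0 0) (by decide) (by omega) (by omega) (by omega)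
  · exact modelH_mem_of_parity h2 h₂ (by decide) (by omega) (by omega) (by omega)
  · exact modelH_mem_of_parity h2 h₁ (by decide) (by omega) (by omega) (by omega)
  · exact modelH_mem_of_parity h2 h₃ (by decide) (by omega) (by omega) (by omega)

theorem modelH_two_mul_zpow (a b c n : ℤ) :
    modelH (2 * a) (2 * b) (2 * c) ^ n = modelH (2 * (n * a)) (2 * (n * b)) (2 * (n * c)) := by
  ext w i
  have h := zpow_apply_eq_add (modelH (2 * a) (2 * b) (2 * c)) (fun w : Fin 5 → ℝ => w i)
    ((![0, 0, 4 * (a : ℝ), 4 * (b : ℝ), 4 * (c : ℝ)] : Fin 5 → ℝ) i)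
    (fun w => by rw [modelH_two_mul]; rfl) n w
  rw [h, modelH_two_mul]
  fin_cases i <;> simp <;> ring

/-- The exponents express (a, b, c) in the basis (0, -1, 0), (-1, 0, 0), (1, 1, 1), which is what
the lattice translations provide. -/
theorem modelH_two_mul_mem {H : Subgroup (Equiv.Perm (Fin 5 → ℝ))}
    (h₁ : modelH (2 * 0) (2 * -1) (2 * 0) ∈ H) (h₂ : modelH (2 * -1) (2 * 0) (2 * 0) ∈ H)
    (h₃ : modelH (2 * 1) (2 * 1) (2 * 1) ∈ H) (a b c : ℤ) :
    modelH (2 * a) (2 * b) (2 * c) ∈ H := by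
  have h : modelH (2 * a) (2 * b) (2 * c) = modelH (2 * 0) (2 * -1) (2 * 0) ^ (c - b) *
      modelH (2 * -1) (2 * 0) (2 * 0) ^ (c - a) * modelH (2 * 1) (2 * 1) (2 * 1) ^ c := by
    rw [modelH_two_mul_zpow, modelH_two_mul_zpow, modelH_two_mul_zpow]
    simp only [modelH_two_mul]
    ext w i
    simp only [Equiv.Perm.mul_apply, Equiv.coe_addRight, Pi.add_apply]
    fin_cases i <;> simp <;> ring
  rw [h]
  exact H.mul_mem (H.mul_mem (H.zpow_mem h₁ _) (H.zpow_mem h₂ _)) (H.zpow_mem h₃ _)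

theorem mem_actionImage_of_generator {S : Set (GL (Fin 6) ℝ)} {M : Matrix (Fin 6) (Fin 6) ℝ}
    {p : Equiv.Perm (Fin 5 → ℝ)} (hM : ActsAs M p)
    (hS : ∀ g : GL (Fin 6) ℝ, (g : Matrix (Fin 6) (Fin 6) ℝ) = M → g ∈ S) :
    p ∈ actionImage (Subgroup.closure S) := by
  obtain ⟨g, rfl⟩ := hM.exists_gl
  exact mem_actionImage.mpr ⟨g, Subgroup.subset_closure (hS g rfl), hM⟩

/-- The transformations corresponding to the translations by the standard basis vectors. -/
def modelTrans : Fin 5 → Equiv.Perm (Fin 5 → ℝ) :=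
  ![modelA ^ (3 : ℤ), modelH (2 * 0) (2 * -1) (2 * 0), modelH (2 * -1) (2 * 0) (2 * 0),
    modelH (2 * 1) (2 * 1) (2 * 1) * (modelB ^ (2 : ℤ))⁻¹, modelB ^ (2 : ℤ)]

theorem transMatrix_actsAs (i : Fin 5) : ActsAs (transMatrix i) (modelTrans i) := by
  fin_cases i
  · exact transMatrix_zero_actsAs
  · exact transMatrix_one_actsAs
  · exact transMatrix_two_actsAs
  · exact transMatrix_three_actsAs
  · exact transMatrix_four_actsAs

theorem modelTrans_mem {H : Subgroup (Equiv.Perm (Fin 5 → ℝ))}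
    (hA : modelA ^ (3 : ℤ) ∈ H) (hB : modelB ∈ H)
    (h : ∀ a b c, Even (a + b + c) → modelH a b c ∈ H) (i : Fin 5) : modelTrans i ∈ H := by
  fin_cases i
  · exact hA
  · exact h _ _ _ (by decide)
  · exact h _ _ _ (by decide)
  · exact H.mul_mem (h _ _ _ (by decide)) (H.inv_mem (H.zpow_mem hB _))
  · exact H.zpow_mem hB _

theorem modelH_two_mul_mem_of_modelTrans {H : Subgroup (Equiv.Perm (Fin 5 → ℝ))}
    (h : ∀ i, modelTrans i ∈ H) (a b c : ℤ) : modelH (2 * a) (2 * b) (2 * c) ∈ H := by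
  refine modelH_two_mul_mem (h 1) (h 2) ?_ a b c
  have h3 := H.mul_mem (h 3) (h 4)
  simpa only [modelTrans, Matrix.cons_val, inv_mul_cancel_right] using h3

theorem exists_actsAs_of_mem_caratGroup {g : GL (Fin 6) ℝ} (hg : g ∈ caratGroup) :
    ∃ p ∈ model.group, ActsAs (g : Matrix (Fin 6) (Fin 6) ℝ) p := by
  refine exists_actsAs_of_mem_closure ?_ hg
  have hA : modelA ∈ model.group := model.A_mem
  have hB : modelB ∈ model.group := model.B_mem
  have hH : ∀ a b c, Even (a + b + c) → modelH a b c ∈ model.group := fun a b c he => model.h_mem he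
  rintro g (h | h | ⟨i, h⟩) <;> rw [h]
  · exact ⟨_, inv_mem hA, genMatrix₁_actsAs⟩
  · exact ⟨_, mul_mem (mul_mem (hH _ _ _ (by decide)) (mul_mem (inv_mem hA) (inv_mem hA))) hB,
      genMatrix₂_actsAs⟩
  · exact ⟨_, modelTrans_mem (zpow_mem hA _) hB hH i, transMatrix_actsAs i⟩

theorem model_group_le_actionImage : model.group ≤ actionImage caratGroup := by
  have hT : ∀ i, modelTrans i ∈ actionImage caratGroup := fun i =>
    mem_actionImage_of_generator (transMatrix_actsAs i) fun g hg => Or.inr (Or.inr ⟨i, hg⟩)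
  have h2 := modelH_two_mul_mem_of_modelTrans hT
  have hA : modelA ∈ actionImage caratGroup := by
    rw [← inv_mem_iff]
    exact mem_actionImage_of_generator genMatrix₁_actsAs fun g hg => Or.inl hg
  have hB2 : modelB ^ (2 : ℤ) ∈ actionImage caratGroup := hT 4
  have hHB : modelH 1 0 (-1) * modelB ∈ actionImage caratGroup := by
    have h := mem_actionImage_of_generator (S := {g | (g : Matrix (Fin 6) (Fin 6) ℝ) = genMatrix₁ ∨
      (g : Matrix (Fin 6) (Fin 6) ℝ) = genMatrix₂ ∨
      ∃ i, (g : Matrix (Fin 6) (Fin 6) ℝ) = transMatrix i}) genMatrix₂_actsAs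
      fun g hg => Or.inr (Or.inl hg)
    -- Since B inverts A, multiplying h A⁻² B on the right by A⁻² leaves hB with h = h(1, 0, -1).
    have h3 := mul_mem h (inv_mem (mul_mem hA hA))
    have h4 : SemiconjBy modelB modelA modelA⁻¹ := model.B_A
    have h5 : modelH 1 0 (-1) * (modelA⁻¹ * modelA⁻¹) * modelB * (modelA * modelA)⁻¹ =
        modelH 1 0 (-1) * modelB := by
      have := (h4.mul_right h4).inv_right.eq
      rw [mul_assoc, this]
      group
    rwa [h5] at h3
  -- Isolates the Hantzsche–Wendt part: (hB)² B⁻² = h(1, 0, -1) h(2, -1, 1), and B² is a lattice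
  -- translation. Conjugation by A then yields the other parity classes, and finally B itself.
  have h₃ : modelH (-1) 1 0 ∈ actionImage caratGroup := by
    have h4 : modelB * modelH 1 0 (-1) = modelH 2 (-1) 1 * modelB :=
      model.B_h 1 0 (-1) (by decide)
    have h5 : modelH 1 0 (-1) * modelH 2 (-1) 1 = modelH (-1) 1 0 :=
      model.h_mul 1 0 (-1) 2 (-1) 1 (by decide) (by decide)
    have h6 := mul_mem (mul_mem hHB hHB) (inv_mem hB2)
    have h7 : modelH 1 0 (-1) * modelB * (modelH 1 0 (-1) * modelB) * (modelB ^ (2 : ℤ))⁻¹ =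
        modelH (-1) 1 0 := by
      rw [← h5, mul_assoc (modelH 1 0 (-1)), ← mul_assoc modelB, h4]
      group
    rw [h7] at h6
    exact modelH_mem_of_parity h2 h6 (by decide) (by decide) (by decide) (by decide)
  have h₁ : modelH 0 (-1) 1 ∈ actionImage caratGroup := by
    have h4 : modelA * modelH (-1) 1 0 = modelH 0 (-1) 1 * modelA := model.A_h _ _ _ (by decide)
    rw [eq_mul_inv_of_mul_eq h4.symm]
    exact mul_mem (mul_mem hA h₃) (inv_mem hA)
  have h₂ : modelH 1 0 (-1) ∈ actionImage caratGroup := by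
    have h4 : modelA * modelH 0 (-1) 1 = modelH 1 0 (-1) * modelA := model.A_h _ _ _ (by decide)
    rw [eq_mul_inv_of_mul_eq h4.symm]
    exact mul_mem (mul_mem hA h₁) (inv_mem hA)
  have hB : modelB ∈ actionImage caratGroup := by
    have := mul_mem (inv_mem h₂) hHB
    rwa [inv_mul_cancel_left] at this
  rw [HWRep.group, Subgroup.closure_le]
  rintro p ((rfl | rfl) | ⟨a, b, c, he, rfl⟩)
  · exact hA
  · exact hB
  · refine modelH_mem_of_parities h2 ?_ ?_ he
    · exact modelH_mem_of_parity h2 h₂ (by decide) (by decide) (by decide) (by decide)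
    · exact modelH_mem_of_parity h2 h₁ (by decide) (by decide) (by decide) (by decide)

theorem exists_actsAs_of_mem_caratSylowGroup {P : Subgroup (Equiv.Perm (Fin 5 → ℝ))}
    (hA : modelA ^ (3 : ℤ) ∈ P) (hB : modelB ∈ P)
    (hH : ∀ a b c, Even (a + b + c) → modelH a b c ∈ P) {g : GL (Fin 6) ℝ}
    (hg : g ∈ caratSylowGroup) : ∃ p ∈ P, ActsAs (g : Matrix (Fin 6) (Fin 6) ℝ) p := by
  refine exists_actsAs_of_mem_closure ?_ hg
  rintro g (h | h | ⟨i, h⟩) <;> rw [h]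
  · exact ⟨_, hH _ _ _ (by decide), sylowMatrixA_actsAs⟩
  · exact ⟨_, mul_mem (hH _ _ _ (by decide)) (inv_mem hB), sylowMatrixB_actsAs⟩
  · exact ⟨_, modelTrans_mem hA hB hH i, transMatrix_actsAs i⟩

theorem modelA_pow_three_mem_actionImage : modelA ^ (3 : ℤ) ∈ actionImage caratSylowGroup :=
  mem_actionImage_of_generator (transMatrix_actsAs 0) fun _ hg => Or.inr (Or.inr ⟨0, hg⟩)

theorem modelH_modelB_mem_actionImage : (∀ a b c, Even (a + b + c) →
    modelH a b c ∈ actionImage caratSylowGroup) ∧ modelB ∈ actionImage caratSylowGroup := by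
  have hT : ∀ i, modelTrans i ∈ actionImage caratSylowGroup := fun i =>
    mem_actionImage_of_generator (transMatrix_actsAs i) fun g hg => Or.inr (Or.inr ⟨i, hg⟩)
  have h2 := modelH_two_mul_mem_of_modelTrans hT
  have h₁ : modelH 1 2 1 ∈ actionImage caratSylowGroup :=
    mem_actionImage_of_generator sylowMatrixA_actsAs fun g hg => Or.inl hg
  have hHB : modelH 0 1 1 * modelB⁻¹ ∈ actionImage caratSylowGroup :=
    mem_actionImage_of_generator sylowMatrixB_actsAs fun g hg => Or.inr (Or.inl hg)
  -- Conjugating h(1, 2, 1) by h(0, 1, 1) B⁻¹ gives h(0, 1, 1), which separates the two factors of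
  -- the second generator.
  have h₂ : modelH 0 1 1 ∈ actionImage caratSylowGroup := by
    have h3 : modelB⁻¹ * modelH 1 2 1 = modelH 0 1 1 * modelB⁻¹ := model.B_inv_h (by decide)
    have h4 := mul_mem (mul_mem hHB h₁) (inv_mem hHB)
    rwa [mul_assoc (modelH 0 1 1), h3, mul_inv_cancel_right] at h4
  refine ⟨fun a b c he => modelH_mem_of_parities h2 ?_ h₂ he, ?_⟩
  · exact modelH_mem_of_parity h2 h₁ (by decide) (by decide) (by decide) (by decide)
  · have := mul_mem (inv_mem hHB) h₂
    rwa [_root_.mul_inv_rev, inv_inv, inv_mul_cancel_right] at this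

end FlatSpin
end
noncomputable section
namespace FlatSpin

/-! ## Representations by units of a ring with anticommuting square roots of `-1` -/

section Units

variable {R : Type*} [Ring R]

/-- The unit `(-1) ^ n`. -/
def signUnit (R : Type*) [Ring R] (n : ℤ) : Rˣ := (-1) ^ n

theorem signUnit_add (m n : ℤ) : signUnit R (m + n) = signUnit R m * signUnit R n := zpow_add _ _ _

theorem signUnit_even {n : ℤ} (h : Even n) : signUnit R n = 1 := by
  obtain ⟨m, rfl⟩ := h
  rw [signUnit, zpow_add, ← Commute.mul_zpow (Commute.refl _), neg_one_mul, neg_neg, one_zpow]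

theorem signUnit_odd {n : ℤ} (h : Odd n) : signUnit R n = -1 := by
  obtain ⟨m, rfl⟩ := h
  rw [signUnit_add, signUnit_even (even_two_mul m), one_mul, signUnit, zpow_one]

theorem signUnit_congr {m n : ℤ} (h : m % 2 = n % 2) : signUnit R m = signUnit R n := by
  rcases Int.even_or_odd n with hn | hn
  · rw [signUnit_even hn, signUnit_even (by rw [Int.even_iff] at *; omega)]
  · rw [signUnit_odd hn, signUnit_odd (by rw [Int.odd_iff] at *; omega)]

theorem signUnit_eq_signUnit {m n : ℤ} (h : Even m ↔ Even n) : signUnit R m = signUnit R n := by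
  apply signUnit_congr
  simp only [Int.even_iff] at h
  omega

theorem signUnit_eq (n : ℤ) : signUnit R n = 1 ∨ signUnit R n = -1 := by
  rcases Int.even_or_odd n with hn | hn
  · exact Or.inl (signUnit_even hn)
  · exact Or.inr (signUnit_odd hn)

theorem neg_zpow_eq (x : Rˣ) (n : ℤ) : (-x) ^ n = signUnit R n * x ^ n := by
  rw [← neg_one_mul, Commute.mul_zpow (Commute.neg_one_left x), signUnit]

theorem zpow_mul_zpow_of_anticommute {x y : Rˣ} (h : x * y = -(y * x)) (m n : ℤ) :
    x ^ m * y ^ n = signUnit R (m * n) * (y ^ n * x ^ m) := by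
  have h1 : SemiconjBy x y (-y) := by
    rw [SemiconjBy, h, neg_mul]
  have h2 := h1.zpow_right n
  have h3 : SemiconjBy (y ^ n) x (signUnit R n * x) := by
    rw [neg_zpow_eq] at h2
    rw [SemiconjBy]
    have := h2.eq
    rcases signUnit_eq (R := R) n with hn | hn <;> rw [hn] at this ⊢
    · simpa using this.symm
    · simpa [neg_eq_iff_eq_neg] using (congrArg Neg.neg this).symm
  have h4 := (h3.zpow_right m).eq
  have h5 : (signUnit R n * x) ^ m = signUnit R (m * n) * x ^ m := by
    rcases Int.even_or_odd n with hn | hn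
    · rw [signUnit_even hn, one_mul, signUnit_even (hn.mul_left m), one_mul]
    · rw [signUnit_odd hn, neg_one_mul, neg_zpow_eq, signUnit_congr]
      rw [Int.odd_iff] at hn
      rw [Int.mul_emod, hn]; omega
  rw [h5] at h4
  rw [h4]
  rcases signUnit_eq (R := R) (m * n) with hn | hn <;> simp [hn]

theorem zpow_two_mul_add {x : Rˣ} (h : x * x = -1) (m n : ℤ) :
    x ^ (2 * m + n) = signUnit R m * x ^ n := by
  rw [zpow_add, zpow_mul, zpow_two, h, signUnit]

/-- Because x⁻¹ = -x, reversing the exponent m costs the sign (-1)ᵐ. The reversals in the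
Hantzsche–Wendt law thus become signs, to be balanced against those from anticommuting. -/
theorem zpow_sg_mul {x : Rˣ} (h : x * x = -1) (k m : ℤ) :
    x ^ (sg k * m) = signUnit R (k * m) * x ^ m := by
  rcases Int.even_or_odd k with hk | hk
  · rw [sg_even hk, one_mul, signUnit_even (hk.mul_right m), one_mul]
  · rw [sg_odd hk, show -1 * m = 2 * (-m) + m by ring, zpow_two_mul_add h]
    congr 1
    apply signUnit_congr
    rw [Int.odd_iff] at hk
    rw [Int.mul_emod, hk]; omega

theorem signUnit_left_comm (n : ℤ) (x y : Rˣ) :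
    x * (signUnit R n * y) = signUnit R n * (x * y) := by
  rcases signUnit_eq (R := R) n with h | h <;> simp [h]

theorem signUnit_mul_triple (l m n : ℤ) (x y z : Rˣ) :
    (signUnit R l * x) * (signUnit R m * y) * (signUnit R n * z) =
      signUnit R (l + m + n) * (x * y * z) := by
  rw [signUnit_left_comm, signUnit_left_comm, signUnit_add, signUnit_add,
    mul_assoc (signUnit R l), mul_assoc (signUnit R l)]
  have h1 : ∀ u : Rˣ, signUnit R n * (signUnit R m * u) = signUnit R m * (signUnit R n * u) :=
    fun u => signUnit_left_comm m _ u
  have h2 : ∀ u : Rˣ, signUnit R n * (signUnit R l * u) = signUnit R l * (signUnit R n * u) :=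
    fun u => signUnit_left_comm l _ u
  have h3 : ∀ u : Rˣ, signUnit R m * (signUnit R l * u) = signUnit R l * (signUnit R m * u) :=
    fun u => signUnit_left_comm l _ u
  simp only [mul_assoc, h1, h2, h3]

/-- Three anticommuting square roots of `-1`. -/
structure IsQuaternionic (i j k : Rˣ) : Prop where
  hi : i * i = -1
  hj : j * j = -1
  hk : k * k = -1
  hij : i * j = -(j * i)
  hjk : j * k = -(k * j)
  hki : k * i = -(i * k)

namespace IsQuaternionic

variable {i j k A B : Rˣ}

theorem mul_zpow_mul (Q : IsQuaternionic i j k) (a b c a' b' c' : ℤ) :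
    (i ^ a * j ^ b * k ^ c) * (i ^ a' * j ^ b' * k ^ c') =
      signUnit R (c * a' + b * a' + c * b') * (i ^ (a + a') * j ^ (b + b') * k ^ (c + c')) := by
  have hji : j * i = -(i * j) := by rw [Q.hij, neg_neg]
  have hkj : k * j = -(j * k) := by rw [Q.hjk, neg_neg]
  have h1 := zpow_mul_zpow_of_anticommute Q.hki c a'
  have h2 := zpow_mul_zpow_of_anticommute hji b a'
  have h3 := zpow_mul_zpow_of_anticommute hkj c b'
  have e : (i ^ a * j ^ b * k ^ c) * (i ^ a' * j ^ b' * k ^ c') =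
      i ^ a * (j ^ b * (k ^ c * i ^ a')) * (j ^ b' * k ^ c') := by simp only [mul_assoc]
  have e1 : i ^ a * (j ^ b * (i ^ a' * k ^ c)) * (j ^ b' * k ^ c') =
      i ^ a * (j ^ b * i ^ a') * ((k ^ c * j ^ b') * k ^ c') := by simp only [mul_assoc]
  have e2 : i ^ a * (i ^ a' * j ^ b) * ((j ^ b' * k ^ c) * k ^ c') =
      (i ^ (a + a') * j ^ (b + b') * k ^ (c + c')) := by simp only [mul_assoc, zpow_add]
  rw [← e2, e, h1, signUnit_left_comm, signUnit_left_comm, mul_assoc (signUnit R (c * a')), e1,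
    h2, h3, signUnit_left_comm (b * a'), mul_assoc (signUnit R (b * a')),
    mul_assoc (signUnit R (c * b')), signUnit_left_comm (c * b'), signUnit_add, signUnit_add,
    mul_assoc (signUnit R (c * a')), mul_assoc (signUnit R (c * a')), mul_assoc (signUnit R (b * a'))]

theorem zpow_mul_zpow_mul_zpow (Q : IsQuaternionic i j k) (a b c : ℤ) :
    j ^ a * k ^ b * i ^ c = signUnit R (a * c + b * c) * (i ^ c * j ^ a * k ^ b) := by
  have h := Q.mul_zpow_mul 0 a b c 0 0
  simp only [zpow_zero, one_mul, mul_one, zero_add, add_zero, mul_zero] at h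
  rw [h, add_comm (a * c)]

/-- The element `h (a, b, c)` given by three anticommuting square roots of `-1`. -/
theorem h_mul (Q : IsQuaternionic i j k) (a b c a' b' c' : ℤ) (he : Even (a + b + c)) (he' : Even (a' + b' + c')) :
    (i ^ a * j ^ (-b) * k ^ c) * (i ^ a' * j ^ (-b') * k ^ c') =
      i ^ (a + sg c * a') * j ^ (-(b + sg a * b')) * k ^ (c + sg b * c') := by
  rw [Q.mul_zpow_mul, show -(b + sg a * b') = -b + sg a * -b' by ring, zpow_add i, zpow_add i,
    zpow_add j, zpow_add j, zpow_add k, zpow_add k, zpow_sg_mul Q.hi, zpow_sg_mul Q.hj,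
    zpow_sg_mul Q.hk]
  rw [signUnit_left_comm _ (i ^ a), signUnit_left_comm _ (j ^ (-b)), signUnit_left_comm _ (k ^ c),
    signUnit_mul_triple]
  congr 1
  apply signUnit_eq_signUnit
  -- The sign from reordering and the sign from reversed exponents differ by a combination of the
  -- two even sums and a multiple of 2.
  rw [← Int.even_sub, show c * a' + -b * a' + c * -b' - (c * a' + a * -b' + b * c') =
    (a + b + c) * b' - b * (a' + b' + c') - 2 * (c * b') by ring]
  exact ((he.mul_right b').sub (he'.mul_left b)).sub (even_two_mul _)

/-- Reordering costs (-1)^(c(a+b)) = (-1)ᶜ, as a + b ≡ c. This is compensated by the changes jᵃ to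
j⁻ᵃ and k⁻ᵇ to kᵇ, which cost (-1)^(a+b); hence the exponent -b on j in the middle. -/
theorem h_cycle (Q : IsQuaternionic i j k) (hi : SemiconjBy A i j) (hj : SemiconjBy A j k)
    (hk : SemiconjBy A k i) (a b c : ℤ) (he : Even (a + b + c)) :
    A * (i ^ a * j ^ (-b) * k ^ c) = (i ^ c * j ^ (-a) * k ^ b) * A := by
  have h1 := ((hi.zpow_right a).mul_right (hj.zpow_right (-b))).mul_right (hk.zpow_right c)
  have hj' : j ^ a = signUnit R a * j ^ (-a) := by
    rw [← zpow_two_mul_add Q.hj, show 2 * a + -a = a by ring]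
  have hk' : k ^ (-b) = signUnit R b * k ^ b := by
    rw [show -b = 2 * (-b) + b by ring, zpow_two_mul_add Q.hk, signUnit_eq_signUnit even_neg]
  have hi' : i ^ c = signUnit R 0 * i ^ c := by rw [signUnit_even Even.zero, one_mul]
  rw [h1.eq, Q.zpow_mul_zpow_mul_zpow, hj', hk', hi', signUnit_mul_triple, ← hi', ← mul_assoc,
    ← signUnit_add, signUnit_even, one_mul]
  have h0 : Even (0 : ℤ) := Even.zero
  simp only [Int.even_add, even_neg, Int.even_mul] at *
  tauto

theorem h_swap (Q : IsQuaternionic i j k) (hi : SemiconjBy B i j) (hj : SemiconjBy B j i)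
    (hk : SemiconjBy B k k) (a b c : ℤ) (he : Even (a + b + c)) :
    B * (i ^ a * j ^ (-b) * k ^ c) =
      (i ^ (a + c % 2) * j ^ (-(c + b % 2)) * k ^ (b + a % 2)) * B := by
  have h1 := ((hi.zpow_right a).mul_right (hj.zpow_right (-b))).mul_right (hk.zpow_right c)
  have hji : j * i = -(i * j) := by rw [Q.hij, neg_neg]
  rw [Int.even_iff] at he
  -- The exponents before and after agree modulo 2; their half-differences give signs, which cancel
  -- together with the sign (-1)^(ab) from exchanging i and j.
  obtain ⟨x, hx⟩ : ∃ x, -b = 2 * x + (a + c % 2) := ⟨(-b - (a + c % 2)) / 2, by omega⟩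
  obtain ⟨y, hy⟩ : ∃ y, a = 2 * y + -(c + b % 2) := ⟨(a + (c + b % 2)) / 2, by omega⟩
  obtain ⟨z, hz⟩ : ∃ z, c = 2 * z + (b + a % 2) := ⟨(c - (b + a % 2)) / 2, by omega⟩
  have hi' : i ^ (-b) = signUnit R x * i ^ (a + c % 2) := by rw [hx, zpow_two_mul_add Q.hi]
  have hj' : j ^ a = signUnit R y * j ^ (-(c + b % 2)) := by
    rw [← zpow_two_mul_add Q.hj, ← hy]
  have hk' : k ^ c = signUnit R z * k ^ (b + a % 2) := by
    rw [← zpow_two_mul_add Q.hk, ← hz]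
  rw [h1.eq, zpow_mul_zpow_of_anticommute hji, hi', hj', hk', mul_assoc (signUnit R _),
    signUnit_mul_triple, ← mul_assoc (signUnit R _) (signUnit R _), ← signUnit_add, signUnit_even,
    one_mul]
  have hab := Int.mul_emod a b 2
  rw [Int.even_iff, mul_neg]
  rcases Int.emod_two_eq_zero_or_one a with ha | ha <;>
  rcases Int.emod_two_eq_zero_or_one b with hb | hb <;>
  simp only [ha, hb] at hab <;> omega

/-- The representation given by three anticommuting square roots of `-1`. -/
def hwRep (Q : IsQuaternionic i j k) (hAi : SemiconjBy A i j) (hAj : SemiconjBy A j k)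
    (hAk : SemiconjBy A k i) (hBi : SemiconjBy B i j) (hBj : SemiconjBy B j i)
    (hBk : SemiconjBy B k k) (hBA : SemiconjBy B A A⁻¹) : HWRep Rˣ where
  h a b c := i ^ a * j ^ (-b) * k ^ c
  A := A
  B := B
  h_mul := Q.h_mul
  A_h := Q.h_cycle hAi hAj hAk
  B_h := Q.h_swap hBi hBj hBk
  B_A := hBA

end IsQuaternionic

end Units

end FlatSpin
end
noncomputable section
namespace FlatSpin

/-! ## Euclidean forms of the group -/

section Forms

variable {ψ : (Fin 5 → ℝ) ≃ᵃ[ℝ] EuclideanSpace ℝ (Fin 5)} {Γ : Subgroup (Isom 5)}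

theorem rotPart_linear {γ : Isom 5} {p : Equiv.Perm (Fin 5 → ℝ)} (h : readIn ψ γ = p)
    (w w' : Fin 5 → ℝ) : rotPart 5 γ (ψ.linear (w' - w)) = ψ.linear (p w' - p w) := by
  rw [readIn_eq_iff] at h
  have h1 := ψ.toAffineMap.linearMap_vsub w' w
  have h2 := ψ.toAffineMap.linearMap_vsub (p w') (p w)
  have h3 := γ.toAffineEquiv.toAffineMap.linearMap_vsub (ψ w') (ψ w)
  simp only [vsub_eq_sub] at h1 h2 h3
  calc _ = rotPart 5 γ (ψ w' - ψ w) := congrArg _ h1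
    _ = γ (ψ w') - γ (ψ w) := h3
    _ = ψ (p w') - ψ (p w) := by rw [h, h]
    _ = _ := h2.symm

/-- The displacement bound in coordinates survives an arbitrary affine change of coordinates, up to
the operator norm of the inverse linear part. -/
theorem uniformlyFree_of_readIn_mem (h : ∀ γ ∈ Γ, readIn ψ γ ∈ model.group) : UniformlyFree Γ := by
  obtain ⟨K, hK, hL⟩ : ∃ K > 0, ∀ v, ‖ψ.linear.symm v‖ ≤ K * ‖v‖ := by
    let L := ψ.linear.symm.toLinearMap.toContinuousLinearMap
    refine ⟨‖L‖ + 1, by positivity, fun v => ?_⟩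
    calc ‖L v‖ ≤ ‖L‖ * ‖v‖ := L.le_opNorm v
      _ ≤ _ := by gcongr; linarith
  refine ⟨1 / K, by positivity, fun γ hγ hne x => ?_⟩
  obtain ⟨w, rfl⟩ := ψ.surjective x
  obtain ⟨a, b, c, m, n, he, hp⟩ := model.mem_group_iff.mp (h γ hγ)
  have hne' : model.nf a b c m n ≠ 1 := fun h1 =>
    hne (readIn_injective ψ (by rw [hp, h1, map_one]))
  obtain ⟨i, hi⟩ := model_displacement he hne' w
  have h1 : ψ.linear (readIn ψ γ w - w) = γ (ψ w) - ψ w := by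
    have := ψ.toAffineMap.linearMap_vsub (readIn ψ γ w) w
    rw [← apply_readIn]
    exact this
  have h2 := hL (γ (ψ w) - ψ w)
  rw [← h1, LinearEquiv.symm_apply_apply, h1, hp] at h2
  have h3 : |model.nf a b c m n w i - w i| ≤ ‖model.nf a b c m n w - w‖ :=
    norm_le_pi_norm (model.nf a b c m n w - w) i
  rw [div_le_iff₀' hK, dist_eq_norm]
  linarith

theorem compactSpace_flatManifold (h : model.group ≤ Γ.map (readIn ψ)) :
    CompactSpace (FlatManifold Γ) := by
  have hbox : IsCompact (Set.univ.pi fun _ : Fin 5 => Set.Icc (0 : ℝ) 4) :=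
    isCompact_univ_pi fun _ => isCompact_Icc
  have hψ : Continuous ψ := ψ.toAffineMap.continuous_of_finiteDimensional
  have himg := hbox.image (isQuotientMap_orbitMk (Γ := Γ).continuous.comp hψ)
  refine isCompact_univ_iff.mp (himg.of_isClosed_subset isClosed_univ fun x _ => ?_)
  obtain ⟨y, rfl⟩ := orbitMk_surjective x
  obtain ⟨w, rfl⟩ := ψ.surjective y
  obtain ⟨p, hp, hw⟩ := model_cocompact w
  obtain ⟨γ, hγ, rfl⟩ := h hp
  refine ⟨readIn ψ γ w, fun i _ => hw i, ?_⟩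
  rw [Function.comp_apply, apply_readIn]
  exact (orbitMk_eq_iff.mpr ⟨γ, hγ, rfl⟩).symm

/-- A transformation of `ℝⁿ` that preserves Euclidean distances comes from an isometry. -/
theorem mem_range_readIn {n : ℕ} {φ : (Fin n → ℝ) ≃ᵃ[ℝ] EuclideanSpace ℝ (Fin n)}
    {p : Equiv.Perm (Fin n → ℝ)} (h : ∀ w w', dist (φ (p w)) (φ (p w')) = dist (φ w) (φ w')) :
    p ∈ (readIn φ).range := by
  let e : EuclideanSpace ℝ (Fin n) ≃ᵢ EuclideanSpace ℝ (Fin n) :=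
    { toEquiv := (φ.toEquiv.symm.trans p).trans φ.toEquiv
      isometry_toFun := Isometry.of_dist_eq fun x y => by
        obtain ⟨w, rfl⟩ := φ.surjective x
        obtain ⟨w', rfl⟩ := φ.surjective y
        have := h w w'
        simpa using this }
  refine ⟨e.toRealAffineIsometryEquiv, readIn_eq_iff.mpr fun w => ?_⟩
  simp [e]

/-- The standard affine isomorphism onto Euclidean space. -/
def standard (n : ℕ) : (Fin n → ℝ) ≃ᵃ[ℝ] EuclideanSpace ℝ (Fin n) :=
  (WithLp.linearEquiv 2 ℝ (Fin n → ℝ)).symm.toAffineEquiv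

theorem standard_dist (w w' : Fin 5 → ℝ) : dist (standard 5 w) (standard 5 w') =
    √((w 0 - w' 0) ^ 2 + (w 1 - w' 1) ^ 2 + (w 2 - w' 2) ^ 2 + (w 3 - w' 3) ^ 2 +
      (w 4 - w' 4) ^ 2) := by
  rw [EuclideanSpace.dist_eq, Fin.sum_univ_five]
  simp only [Real.dist_eq, sq_abs]
  rfl

theorem sg_sq_real (k : ℤ) : (sg k : ℝ) ^ 2 = 1 := by rw [sq, sg_mul_self_real]

/-- In adapted coordinates the generators are already isometries of the standard metric: signed
permutations followed by translations. -/
theorem exists_standard_form : ∃ Γ : Subgroup (Isom 5),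
    Γ.map (readIn (standard 5)) = model.group := by
  have hle : model.group ≤ (readIn (standard 5)).range := by
    rw [HWRep.group, Subgroup.closure_le]
    rintro p ((rfl | rfl) | ⟨a, b, c, -, rfl⟩)
    · refine mem_range_readIn fun w w' => ?_
      rw [standard_dist, standard_dist]
      simp only [model, modelA_apply]
      congr 1
      simp
      ring
    · refine mem_range_readIn fun w w' => ?_
      rw [standard_dist, standard_dist]
      simp only [model, modelB_apply]
      congr 1
      simp
      ring
    · refine mem_range_readIn fun w w' => ?_
      rw [standard_dist, standard_dist]
      simp only [model, modelH_apply]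
      congr 1
      simp [← mul_sub, mul_pow, sg_sq_real]
  exact ⟨model.group.comap (readIn (standard 5)), by
    rw [Subgroup.map_comap_eq, inf_eq_right.mpr hle]⟩

/-! ### The frame adapted to the group -/

/-- The images of the adapted coordinate vectors. -/
def frameVec (ψ : (Fin 5 → ℝ) ≃ᵃ[ℝ] EuclideanSpace ℝ (Fin 5)) (i : Fin 5) :
    EuclideanSpace ℝ (Fin 5) := ψ.linear (Pi.single i 1)

theorem frameVec_ne_zero (i : Fin 5) : frameVec ψ i ≠ 0 := by
  rw [frameVec, Ne, LinearEquiv.map_eq_zero_iff]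
  simp

theorem rotPart_frameVec {γ : Isom 5} {p : Equiv.Perm (Fin 5 → ℝ)} (h : readIn ψ γ = p)
    (i : Fin 5) : rotPart 5 γ (frameVec ψ i) = ψ.linear (p (Pi.single i 1) - p 0) := by
  rw [← rotPart_linear h, sub_zero, frameVec]

theorem rotPart_frameVec_eq {γ : Isom 5} {p : Equiv.Perm (Fin 5 → ℝ)} (h : readIn ψ γ = p)
    (i j : Fin 5) (c : ℝ) (hc : ∀ l, p (Pi.single i 1) l - p 0 l = c * (Pi.single j 1 : Fin 5 → ℝ) l) :
    rotPart 5 γ (frameVec ψ i) = c • frameVec ψ j := by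
  rw [rotPart_frameVec h, frameVec, ← map_smul]
  congr 1
  ext l
  exact hc l

theorem rotPart_A {γ : Isom 5} (h : readIn ψ γ = modelA) (i : Fin 5) :
    rotPart 5 γ (frameVec ψ i) = frameVec ψ ((![0, 1, 3, 4, 2] : Fin 5 → Fin 5) i) := by
  have h1 := rotPart_frameVec_eq h i ((![0, 1, 3, 4, 2] : Fin 5 → Fin 5) i) 1 fun l => by
    fin_cases i <;> fin_cases l <;> simp [modelA_apply]
  rwa [one_smul] at h1

theorem rotPart_B {γ : Isom 5} (h : readIn ψ γ = modelB) (i : Fin 5) :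
    rotPart 5 γ (frameVec ψ i) = (![-1, 1, 1, 1, 1] : Fin 5 → ℝ) i •
      frameVec ψ ((![0, 1, 2, 4, 3] : Fin 5 → Fin 5) i) := by
  refine rotPart_frameVec_eq h i _ _ fun l => ?_
  fin_cases i <;> fin_cases l <;> simp [modelB_apply]

theorem rotPart_H {γ : Isom 5} {a b c : ℤ} (h : readIn ψ γ = modelH a b c) (i : Fin 5) :
    rotPart 5 γ (frameVec ψ i) =
      (![1, 1, (sg c : ℝ), (sg a : ℝ), (sg b : ℝ)] : Fin 5 → ℝ) i • frameVec ψ i := by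
  refine rotPart_frameVec_eq h i i _ fun l => ?_
  fin_cases i <;> fin_cases l <;> simp [modelH_apply]

/-- An isometry acting on two vectors by opposite signs forces them to be orthogonal. -/
theorem inner_frameVec_eq_zero {γ : Isom 5} {i j : Fin 5} {a b : ℝ}
    (hi : rotPart 5 γ (frameVec ψ i) = a • frameVec ψ i)
    (hj : rotPart 5 γ (frameVec ψ j) = b • frameVec ψ j) (hab : a * b = -1) :
    inner ℝ (frameVec ψ i) (frameVec ψ j) = 0 := by
  have h := (rotPart 5 γ).inner_map_map (frameVec ψ i) (frameVec ψ j)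
  rw [hi, hj, real_inner_smul_left, real_inner_smul_right, ← mul_assoc, hab] at h
  linarith

theorem inner_frameVec (h : model.group ≤ (readIn ψ).range) {i j : Fin 5} (hij : i ≠ j) :
    inner ℝ (frameVec ψ i) (frameVec ψ j) = 0 := by
  obtain ⟨β, hβ⟩ := h model.B_mem
  have hB := rotPart_B hβ
  have hH : ∀ a b c, Even (a + b + c) →
      ∃ γ, ∀ i, rotPart 5 γ (frameVec ψ i) =
        (![1, 1, (sg c : ℝ), (sg a : ℝ), (sg b : ℝ)] : Fin 5 → ℝ) i • frameVec ψ i := by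
    intro a b c he
    obtain ⟨γ, hγ⟩ := h (model.h_mem he)
    exact ⟨γ, rotPart_H hγ⟩
  -- On the directions 2, 3, 4 the signs are (+, -, -) for γ₁ and (-, +, -) for γ₂; both fix 0 and
  -- 1. B separates 0 from 1 and from 2, and these three elements separate every pair.
  obtain ⟨γ₁, h₁⟩ := hH 1 1 0 (by decide)
  obtain ⟨γ₂, h₂⟩ := hH 0 1 1 (by decide)
  simp only [sg_zero, sg_one] at h₁ h₂
  have key : ∀ i j : Fin 5, i < j → inner ℝ (frameVec ψ i) (frameVec ψ j) = 0 := by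
    intro i j hij
    fin_cases i <;> fin_cases j <;> try exact absurd hij (by decide)
    · exact inner_frameVec_eq_zero (hB _) (hB _) (by simp)
    · exact inner_frameVec_eq_zero (hB _) (hB _) (by simp)
    · exact inner_frameVec_eq_zero (h₁ _) (h₁ _) (by simp)
    · exact inner_frameVec_eq_zero (h₁ _) (h₁ _) (by simp)
    · exact inner_frameVec_eq_zero (h₂ _) (h₂ _) (by simp)
    · exact inner_frameVec_eq_zero (h₁ _) (h₁ _) (by simp)
    · exact inner_frameVec_eq_zero (h₁ _) (h₁ _) (by simp)
    · exact inner_frameVec_eq_zero (h₁ _) (h₁ _) (by simp)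
    · exact inner_frameVec_eq_zero (h₁ _) (h₁ _) (by simp)
    · exact inner_frameVec_eq_zero (h₂ _) (h₂ _) (by simp)
  rcases lt_or_gt_of_ne hij with hlt | hlt
  · exact key i j hlt
  · rw [real_inner_comm]
    exact key j i hlt

/-- Directions 2, 3, 4 get equal lengths because A permutes them. The lengths of directions 0 and 1
are unconstrained, which is harmless. -/
theorem norm_frameVec (h : model.group ≤ (readIn ψ).range) (i : Fin 5) :
    ‖frameVec ψ ((![0, 1, 3, 4, 2] : Fin 5 → Fin 5) i)‖ = ‖frameVec ψ i‖ := by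
  obtain ⟨α, hα⟩ := h model.A_mem
  rw [← rotPart_A hα, LinearIsometryEquiv.norm_map]

/-- The orthonormal frame adapted to the group. -/
def unitFrame (ψ : (Fin 5 → ℝ) ≃ᵃ[ℝ] EuclideanSpace ℝ (Fin 5)) (i : Fin 5) : Fin 5 → ℝ :=
  WithLp.ofLp (‖frameVec ψ i‖⁻¹ • frameVec ψ i)

theorem unitFrame_dot (h : model.group ≤ (readIn ψ).range) (i j : Fin 5) :
    unitFrame ψ i ⬝ᵥ unitFrame ψ j = if i = j then 1 else 0 := by
  have h1 : unitFrame ψ i ⬝ᵥ unitFrame ψ j =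
      inner ℝ (‖frameVec ψ j‖⁻¹ • frameVec ψ j) (‖frameVec ψ i‖⁻¹ • frameVec ψ i) := by
    rw [EuclideanSpace.inner_eq_star_dotProduct]
    rfl
  rw [h1, real_inner_smul_left, real_inner_smul_right]
  split_ifs with hij
  · subst hij
    have := norm_ne_zero_iff.mpr (frameVec_ne_zero (ψ := ψ) i)
    rw [real_inner_self_eq_norm_sq]
    field_simp
  · rw [inner_frameVec h (Ne.symm hij), mul_zero, mul_zero]

theorem rotMatrix_unitFrame_A (h : model.group ≤ (readIn ψ).range) {γ : Isom 5}
    (hγ : readIn ψ γ = modelA) (i : Fin 5) :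
    (rotMatrix γ).mulVec (unitFrame ψ i) = unitFrame ψ ((![0, 1, 3, 4, 2] : Fin 5 → Fin 5) i) := by
  rw [unitFrame, rotMatrix_mulVec, map_smul, rotPart_A hγ, unitFrame, norm_frameVec h]

theorem rotMatrix_unitFrame_B {γ : Isom 5}
    (hγ : readIn ψ γ = modelB) (i : Fin 5) :
    (rotMatrix γ).mulVec (unitFrame ψ i) = (![-1, 1, 1, 1, 1] : Fin 5 → ℝ) i •
      unitFrame ψ ((![0, 1, 2, 4, 3] : Fin 5 → Fin 5) i) := by
  have hn : ‖frameVec ψ ((![0, 1, 2, 4, 3] : Fin 5 → Fin 5) i)‖ = ‖frameVec ψ i‖ := by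
    rw [← (rotPart 5 γ).norm_map (frameVec ψ i), rotPart_B hγ, norm_smul]
    fin_cases i <;> simp
  rw [unitFrame, rotMatrix_mulVec, map_smul, rotPart_B hγ, unitFrame, hn, smul_comm]
  rfl

theorem rotMatrix_unitFrame_H {γ : Isom 5} {a b c : ℤ} (hγ : readIn ψ γ = modelH a b c)
    (i : Fin 5) : (rotMatrix γ).mulVec (unitFrame ψ i) =
      (![1, 1, (sg c : ℝ), (sg a : ℝ), (sg b : ℝ)] : Fin 5 → ℝ) i • unitFrame ψ i := by
  rw [unitFrame, rotMatrix_mulVec, map_smul, rotPart_H hγ, smul_comm]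
  rfl

theorem unitFrame_ext {F : Type*} [AddCommGroup F] [Module ℝ F] {f g : (Fin 5 → ℝ) →ₗ[ℝ] F}
    (h : ∀ i, f (unitFrame ψ i) = g (unitFrame ψ i)) : f = g := by
  let e : (Fin 5 → ℝ) ≃ₗ[ℝ] (Fin 5 → ℝ) := ψ.linear.trans (WithLp.linearEquiv 2 ℝ (Fin 5 → ℝ))
  have h1 : f ∘ₗ e.toLinearMap = g ∘ₗ e.toLinearMap := by
    refine LinearMap.pi_ext' fun i => LinearMap.ext_ring ?_
    have h2 : e (Pi.single i 1) = ‖frameVec ψ i‖ • unitFrame ψ i := by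
      have := norm_ne_zero_iff.mpr (frameVec_ne_zero (ψ := ψ) i)
      rw [unitFrame, ← WithLp.ofLp_smul, smul_inv_smul₀ this]
      rfl
    simp only [LinearMap.comp_apply, LinearMap.single_apply, LinearEquiv.coe_coe, h2, map_smul, h]
  refine LinearMap.ext fun v => ?_
  obtain ⟨w, rfl⟩ := e.surjective v
  exact LinearMap.congr_fun h1 w

end Forms

end FlatSpin
end
noncomputable section
namespace FlatSpin
open CliffordAlgebra

/-! ## The lift of the rotational parts to the spin group -/

/-- A unit vector, as a unit of the Clifford algebra. -/
def vecUnit {n : ℕ} (u : Fin n → ℝ) (hu : u ⬝ᵥ u = 1) : (CliffordAlgebra (negForm n))ˣ where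
  val := ι (negForm n) u
  inv := -ι (negForm n) u
  val_inv := by rw [mul_neg, ι_mul_self_of_unit hu, neg_neg]
  inv_val := by rw [neg_mul, ι_mul_self_of_unit hu, neg_neg]

theorem vecUnit_mul_self {n : ℕ} {u : Fin n → ℝ} (hu : u ⬝ᵥ u = 1) :
    vecUnit u hu * vecUnit u hu = -1 := Units.ext (ι_mul_self_of_unit hu)

theorem vecUnit_inv {n : ℕ} {u : Fin n → ℝ} (hu : u ⬝ᵥ u = 1) :
    (vecUnit u hu)⁻¹ = -vecUnit u hu := Units.ext rfl

/-- Here w is the reflection of v in the hyperplane u^⊥, so u v = -w u; every commutation between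
frame vectors and lifts reduces to this. -/
theorem vecUnit_mul_vecUnit {n : ℕ} {u v w : Fin n → ℝ} (hu : u ⬝ᵥ u = 1) (hv : v ⬝ᵥ v = 1)
    (hw : w ⬝ᵥ w = 1) (h : v - (2 * (u ⬝ᵥ v)) • u = w) :
    vecUnit u hu * vecUnit v hv = -(vecUnit w hw * vecUnit u hu) := by
  apply Units.ext
  change ι (negForm n) u * ι (negForm n) v = -(ι (negForm n) w * ι (negForm n) u)
  rw [← h, ← reflMatrix_mulVec, ι_reflMatrix hu, mul_assoc _ _ (ι (negForm n) u),
    ι_mul_self_of_unit hu, mul_neg, mul_one, neg_neg]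

theorem vecUnit_anticommute {n : ℕ} {u v : Fin n → ℝ} (hu : u ⬝ᵥ u = 1) (hv : v ⬝ᵥ v = 1)
    (h : u ⬝ᵥ v = 0) : vecUnit u hu * vecUnit v hv = -(vecUnit v hv * vecUnit u hu) :=
  vecUnit_mul_vecUnit hu hv hv (by rw [h, mul_zero, zero_smul, sub_zero])

/-- The unit vector in the direction of `x - y`, for orthonormal `x` and `y`. -/
def diffVec {n : ℕ} (x y : Fin n → ℝ) : Fin n → ℝ := (√2)⁻¹ • (x - y)

theorem sqrt_two_inv_mul_self : (√2)⁻¹ * (√2)⁻¹ = (2 : ℝ)⁻¹ := by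
  rw [← mul_inv, Real.mul_self_sqrt (by norm_num)]

theorem diffVec_dot_self {n : ℕ} {x y : Fin n → ℝ} (hx : x ⬝ᵥ x = 1) (hy : y ⬝ᵥ y = 1)
    (hxy : x ⬝ᵥ y = 0) : diffVec x y ⬝ᵥ diffVec x y = 1 := by
  have hyx : y ⬝ᵥ x = 0 := by rw [dotProduct_comm, hxy]
  simp only [diffVec, dotProduct_smul, smul_dotProduct, sub_dotProduct, dotProduct_sub, hx, hy, hxy,
    hyx, smul_eq_mul]
  linear_combination 2 * sqrt_two_inv_mul_self

theorem diffVec_reflect {n : ℕ} {x y z : Fin n → ℝ} :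
    z - (2 * (diffVec x y ⬝ᵥ z)) • diffVec x y = z - (x ⬝ᵥ z - y ⬝ᵥ z) • (x - y) := by
  simp only [diffVec, smul_dotProduct, sub_dotProduct, smul_smul, smul_eq_mul]
  congr 2
  linear_combination (2 * (x ⬝ᵥ z - y ⬝ᵥ z)) * sqrt_two_inv_mul_self

theorem coe_signUnit_mul_vecUnit {n : ℕ} {u : Fin n → ℝ} (hu : u ⬝ᵥ u = 1) (k : ℤ) :
    ((signUnit (CliffordAlgebra (negForm n)) k * vecUnit u hu :
      (CliffordAlgebra (negForm n))ˣ) : CliffordAlgebra (negForm n)) =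
      ι (negForm n) ((sg k : ℝ) • u) := by
  rcases Int.even_or_odd k with h | h
  · rw [signUnit_even h, sg_even h, one_mul, Int.cast_one, one_smul]
    rfl
  · rw [signUnit_odd h, sg_odd h, neg_one_mul, Int.cast_neg, Int.cast_one, neg_smul, one_smul,
      map_neg]
    rfl

/-- The elements of the spin group among the units of the Clifford algebra. -/
def spinUnits (n : ℕ) : Subgroup (CliffordAlgebra (negForm n))ˣ where
  carrier := {x | (x : CliffordAlgebra (negForm n)) ∈ spinGroup (negForm n)}
  mul_mem' hx hy := (spinGroup (negForm n)).mul_mem hx hy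
  one_mem' := (spinGroup (negForm n)).one_mem
  inv_mem' {x} hx := by
    replace hx : (x : CliffordAlgebra (negForm n)) ∈ spinGroup (negForm n) := hx
    have h : ((x⁻¹ : (CliffordAlgebra (negForm n))ˣ) : CliffordAlgebra (negForm n)) =
        star (x : CliffordAlgebra (negForm n)) := by
      rw [← Units.mul_right_inj x, Units.mul_inv, spinGroup.mul_star_self_of_mem hx]
    change ((x⁻¹ : (CliffordAlgebra (negForm n))ˣ) : CliffordAlgebra (negForm n)) ∈
      spinGroup (negForm n)
    rw [h]
    exact spinGroup.star_mem hx

theorem vecUnit_mul_vecUnit_mem {n : ℕ} {u v : Fin n → ℝ} (hu : u ⬝ᵥ u = 1) (hv : v ⬝ᵥ v = 1) :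
    vecUnit u hu * vecUnit v hv ∈ spinUnits n := ι_mul_ι_mem_spinGroup hu hv

/-- The pairs of an element of the spin group and an isometry with the same rotational part. -/
def spinPairGroup (n : ℕ) : Subgroup ((CliffordAlgebra (negForm n))ˣ × Isom n) where
  carrier := {q | q.1 ∈ spinUnits n ∧ ∀ v, (q.1 : CliffordAlgebra (negForm n)) * ι (negForm n) v =
    ι (negForm n) ((rotMatrix q.2).mulVec v) * q.1}
  mul_mem' {q r} hq hr := by
    refine ⟨mul_mem hq.1 hr.1, fun v => ?_⟩
    change ((q.1 * r.1 : (CliffordAlgebra (negForm n))ˣ) : CliffordAlgebra (negForm n)) * _ =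
      ι (negForm n) ((rotMatrix (q.2 * r.2)).mulVec v) *
        ((q.1 * r.1 : (CliffordAlgebra (negForm n))ˣ) : CliffordAlgebra (negForm n))
    rw [Units.val_mul, mul_assoc, hr.2, ← mul_assoc, hq.2, rotMatrix_mul, Matrix.mulVec_mulVec,
      mul_assoc]
  one_mem' := by
    refine ⟨one_mem _, fun v => ?_⟩
    change ((1 : (CliffordAlgebra (negForm n))ˣ) : CliffordAlgebra (negForm n)) * _ =
      ι (negForm n) ((rotMatrix 1).mulVec v) *
        ((1 : (CliffordAlgebra (negForm n))ˣ) : CliffordAlgebra (negForm n))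
    rw [rotMatrix_one, Matrix.one_mulVec, Units.val_one, one_mul, mul_one]
  inv_mem' {q} hq := by
    refine ⟨inv_mem hq.1, fun v => ?_⟩
    change ((q.1⁻¹ : (CliffordAlgebra (negForm n))ˣ) : CliffordAlgebra (negForm n)) * _ =
      ι (negForm n) ((rotMatrix q.2⁻¹).mulVec v) *
        ((q.1⁻¹ : (CliffordAlgebra (negForm n))ˣ) : CliffordAlgebra (negForm n))
    have h := hq.2 ((rotMatrix q.2⁻¹).mulVec v)
    rw [Matrix.mulVec_mulVec, ← rotMatrix_mul, mul_inv_cancel, rotMatrix_one, Matrix.one_mulVec] at h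
    rw [Units.inv_mul_eq_iff_eq_mul, ← mul_assoc, h, mul_assoc, Units.mul_inv, mul_one]

theorem spinCover_of_mem_spinPairGroup {n : ℕ} {x : (CliffordAlgebra (negForm n))ˣ} {γ : Isom n}
    (h : (x, γ) ∈ spinPairGroup n) :
    (spinCover n ⟨x, h.1⟩ : Matrix (Fin n) (Fin n) ℝ) = rotMatrix γ := by
  rw [spinCover_apply]
  apply Matrix.toLin'.injective
  rw [Matrix.toLin'_toMatrix']
  refine LinearMap.ext fun w => iota_inj n ?_
  rw [iota_spinRot, Matrix.toLin'_apply]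
  change (x : CliffordAlgebra (negForm n)) * _ * star (x : CliffordAlgebra (negForm n)) = _
  rw [h.2, mul_assoc, spinGroup.mul_star_self_of_mem h.1, mul_one]

section Forms

variable {ψ : (Fin 5 → ℝ) ≃ᵃ[ℝ] EuclideanSpace ℝ (Fin 5)}

theorem unitFrame_self (h : model.group ≤ (readIn ψ).range) (i : Fin 5) :
    unitFrame ψ i ⬝ᵥ unitFrame ψ i = 1 := by rw [unitFrame_dot h, if_pos rfl]

theorem unitFrame_orth (h : model.group ≤ (readIn ψ).range) {i j : Fin 5} (hij : i ≠ j) :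
    unitFrame ψ i ⬝ᵥ unitFrame ψ j = 0 := by rw [unitFrame_dot h, if_neg hij]

/-- The vectors of the adapted frame, in the Clifford algebra. -/
def frameUnit (h : model.group ≤ (readIn ψ).range) (i : Fin 5) : (CliffordAlgebra (negForm 5))ˣ :=
  vecUnit (unitFrame ψ i) (unitFrame_self h i)

/-- The normalized difference of two vectors of the frame, in the Clifford algebra. -/
def diffUnit (h : model.group ≤ (readIn ψ).range) {i j : Fin 5} (hij : i ≠ j) :
    (CliffordAlgebra (negForm 5))ˣ :=
  vecUnit (diffVec (unitFrame ψ i) (unitFrame ψ j))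
    (diffVec_dot_self (unitFrame_self h i) (unitFrame_self h j) (unitFrame_orth h hij))

theorem frameUnit_mul_frameUnit (h : model.group ≤ (readIn ψ).range) {i j : Fin 5} (hij : i ≠ j) :
    frameUnit h i * frameUnit h j = -(frameUnit h j * frameUnit h i) :=
  vecUnit_anticommute _ _ (unitFrame_orth h hij)

theorem diffUnit_mul_left (h : model.group ≤ (readIn ψ).range) {i j : Fin 5} (hij : i ≠ j) :
    diffUnit h hij * frameUnit h i = -(frameUnit h j * diffUnit h hij) := by
  refine vecUnit_mul_vecUnit _ _ _ ?_
  rw [diffVec_reflect, unitFrame_self h, unitFrame_orth h hij.symm]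
  module

theorem diffUnit_mul_right (h : model.group ≤ (readIn ψ).range) {i j : Fin 5} (hij : i ≠ j) :
    diffUnit h hij * frameUnit h j = -(frameUnit h i * diffUnit h hij) := by
  refine vecUnit_mul_vecUnit _ _ _ ?_
  rw [diffVec_reflect, unitFrame_self h, unitFrame_orth h hij]
  module

theorem diffUnit_mul_of_ne (h : model.group ≤ (readIn ψ).range) {i j l : Fin 5} (hij : i ≠ j)
    (hi : i ≠ l) (hj : j ≠ l) :
    diffUnit h hij * frameUnit h l = -(frameUnit h l * diffUnit h hij) := by
  refine vecUnit_mul_vecUnit _ _ _ ?_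
  rw [diffVec_reflect, unitFrame_orth h hi, unitFrame_orth h hj]
  module

/-- The lift of the rotational part of `A`. -/
def liftA (h : model.group ≤ (readIn ψ).range) : (CliffordAlgebra (negForm 5))ˣ :=
  diffUnit h (show (3 : Fin 5) ≠ 4 by decide) * diffUnit h (show (2 : Fin 5) ≠ 4 by decide)

/-- The lift of the rotational part of `B`. -/
def liftB (h : model.group ≤ (readIn ψ).range) : (CliffordAlgebra (negForm 5))ˣ :=
  frameUnit h 0 * diffUnit h (show (3 : Fin 5) ≠ 4 by decide)

theorem semiconjBy_mul_of_neg {R : Type*} [Ring R] {x y u v w : Rˣ} (h1 : y * u = -(v * y))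
    (h2 : x * v = -(w * x)) : SemiconjBy (x * y) u w := by
  rw [SemiconjBy, mul_assoc, h1, mul_neg, ← mul_assoc, h2, neg_mul, neg_neg, mul_assoc]

/-- The 3-cycle of frame vectors is the exchange of 2 and 4 followed by that of 3 and 4; the two
reflection signs cancel. -/
theorem liftA_frameUnit (h : model.group ≤ (readIn ψ).range) (i : Fin 5) :
    SemiconjBy (liftA h) (frameUnit h i) (frameUnit h ((![0, 1, 3, 4, 2] : Fin 5 → Fin 5) i)) := by
  fin_cases i
  · exact semiconjBy_mul_of_neg (diffUnit_mul_of_ne h _ (by decide) (by decide))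
      (diffUnit_mul_of_ne h _ (by decide) (by decide))
  · exact semiconjBy_mul_of_neg (diffUnit_mul_of_ne h _ (by decide) (by decide))
      (diffUnit_mul_of_ne h _ (by decide) (by decide))
  · exact semiconjBy_mul_of_neg (diffUnit_mul_left h _) (diffUnit_mul_right h _)
  · exact semiconjBy_mul_of_neg (diffUnit_mul_of_ne h _ (by decide) (by decide))
      (diffUnit_mul_left h _)
  · exact semiconjBy_mul_of_neg (diffUnit_mul_right h _)
      (diffUnit_mul_of_ne h _ (by decide) (by decide))

theorem liftB_frameUnit_zero (h : model.group ≤ (readIn ψ).range) :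
    SemiconjBy (liftB h) (frameUnit h 0) (-frameUnit h 0) := by
  have h1 := diffUnit_mul_of_ne h (show (3 : Fin 5) ≠ 4 by decide) (show (3 : Fin 5) ≠ 0 by decide)
    (show (4 : Fin 5) ≠ 0 by decide)
  rw [SemiconjBy, liftB, mul_assoc, h1, mul_neg, neg_mul]

theorem liftB_frameUnit (h : model.group ≤ (readIn ψ).range) {i : Fin 5} (hi : i ≠ 0) :
    SemiconjBy (liftB h) (frameUnit h i) (frameUnit h ((![0, 1, 2, 4, 3] : Fin 5 → Fin 5) i)) := by
  fin_cases i
  · exact absurd rfl hi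
  · exact semiconjBy_mul_of_neg (diffUnit_mul_of_ne h _ (by decide) (by decide))
      (frameUnit_mul_frameUnit h (by decide))
  · exact semiconjBy_mul_of_neg (diffUnit_mul_of_ne h _ (by decide) (by decide))
      (frameUnit_mul_frameUnit h (by decide))
  · exact semiconjBy_mul_of_neg (diffUnit_mul_left h _) (frameUnit_mul_frameUnit h (by decide))
  · exact semiconjBy_mul_of_neg (diffUnit_mul_right h _) (frameUnit_mul_frameUnit h (by decide))

theorem frameUnit_mul_self (h : model.group ≤ (readIn ψ).range) (i : Fin 5) :
    frameUnit h i * frameUnit h i = -1 := vecUnit_mul_self _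

theorem isQuaternionic_frameUnit (h : model.group ≤ (readIn ψ).range) :
    IsQuaternionic (frameUnit h 3) (frameUnit h 4) (frameUnit h 2) where
  hi := frameUnit_mul_self h 3
  hj := frameUnit_mul_self h 4
  hk := frameUnit_mul_self h 2
  hij := frameUnit_mul_frameUnit h (by decide)
  hjk := frameUnit_mul_frameUnit h (by decide)
  hki := frameUnit_mul_frameUnit h (by decide)

/-- With y, z the differences for (3, 4), (2, 4), both B A and A⁻¹ B reduce to z e₀. The relation
holds in Spin(5) itself, not just up to sign. -/
theorem liftB_mul_liftA (h : model.group ≤ (readIn ψ).range) :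
    SemiconjBy (liftB h) (liftA h) (liftA h)⁻¹ := by
  have hE : ∀ {i j : Fin 5} (hij : i ≠ j) (_ : i ≠ 0) (_ : j ≠ 0),
      diffUnit h hij * frameUnit h 0 = -(frameUnit h 0 * diffUnit h hij) :=
    fun hij hi hj => diffUnit_mul_of_ne h hij hi hj
  have h1 := hE (show (3 : Fin 5) ≠ 4 by decide) (by decide) (by decide)
  have h2 := hE (show (2 : Fin 5) ≠ 4 by decide) (by decide) (by decide)
  have h3 : diffUnit h (show (3 : Fin 5) ≠ 4 by decide) *
      diffUnit h (show (3 : Fin 5) ≠ 4 by decide) = -1 := vecUnit_mul_self _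
  have h4 : ∀ {i j : Fin 5} (hij : i ≠ j), (diffUnit h hij)⁻¹ = -diffUnit h hij :=
    fun hij => vecUnit_inv _
  rw [SemiconjBy, liftA, liftB, mul_inv_rev, h4, h4, neg_mul_neg]
  calc _ = frameUnit h 0 * (diffUnit h (show (3 : Fin 5) ≠ 4 by decide) *
        diffUnit h (show (3 : Fin 5) ≠ 4 by decide)) *
        diffUnit h (show (2 : Fin 5) ≠ 4 by decide) := by simp only [mul_assoc]
    _ = diffUnit h (show (2 : Fin 5) ≠ 4 by decide) * frameUnit h 0 := by
      rw [h3, h2]; simp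
    _ = diffUnit h (show (2 : Fin 5) ≠ 4 by decide) * -(frameUnit h 0 *
        (diffUnit h (show (3 : Fin 5) ≠ 4 by decide) *
          diffUnit h (show (3 : Fin 5) ≠ 4 by decide))) := by
      rw [h3]; simp
    _ = diffUnit h (show (2 : Fin 5) ≠ 4 by decide) *
        (-(frameUnit h 0 * diffUnit h (show (3 : Fin 5) ≠ 4 by decide)) *
          diffUnit h (show (3 : Fin 5) ≠ 4 by decide)) := by
      rw [← mul_assoc, neg_mul]
    _ = _ := by rw [← h1]; simp only [mul_assoc]

/-- The representation of the group by units of the Clifford algebra. -/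
def spinRep (h : model.group ≤ (readIn ψ).range) : HWRep (CliffordAlgebra (negForm 5))ˣ :=
  (isQuaternionic_frameUnit h).hwRep (liftA_frameUnit h 3) (liftA_frameUnit h 4)
    (liftA_frameUnit h 2) (liftB_frameUnit h (i := 3) (by decide))
    (liftB_frameUnit h (i := 4) (by decide)) (liftB_frameUnit h (i := 2) (by decide))
    (liftB_mul_liftA h)

theorem mem_spinPairGroup {x : (CliffordAlgebra (negForm 5))ˣ} {γ : Isom 5} (hx : x ∈ spinUnits 5)
    (hv : ∀ i, (x : CliffordAlgebra (negForm 5)) * ι (negForm 5) (unitFrame ψ i) =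
      ι (negForm 5) ((rotMatrix γ).mulVec (unitFrame ψ i)) * x) : (x, γ) ∈ spinPairGroup 5 := by
  refine ⟨hx, fun v => ?_⟩
  have h : LinearMap.mulLeft ℝ (x : CliffordAlgebra (negForm 5)) ∘ₗ ι (negForm 5) =
      LinearMap.mulRight ℝ (x : CliffordAlgebra (negForm 5)) ∘ₗ ι (negForm 5) ∘ₗ
        (rotMatrix γ).mulVecLin :=
    unitFrame_ext (ψ := ψ) hv
  exact LinearMap.congr_fun h v

theorem liftA_mem (h : model.group ≤ (readIn ψ).range) {γ : Isom 5} (hγ : readIn ψ γ = modelA) :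
    (liftA h, γ) ∈ spinPairGroup 5 := by
  refine mem_spinPairGroup (ψ := ψ) (vecUnit_mul_vecUnit_mem _ _) fun i => ?_
  rw [rotMatrix_unitFrame_A h hγ]
  exact congrArg Units.val (liftA_frameUnit h i).eq

theorem liftB_mem (h : model.group ≤ (readIn ψ).range) {γ : Isom 5} (hγ : readIn ψ γ = modelB) :
    (liftB h, γ) ∈ spinPairGroup 5 := by
  refine mem_spinPairGroup (ψ := ψ) (vecUnit_mul_vecUnit_mem _ _) fun i => ?_
  rw [rotMatrix_unitFrame_B hγ]
  by_cases hi : i = 0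
  · subst hi
    have := congrArg Units.val (liftB_frameUnit_zero h).eq
    simp only [Matrix.cons_val_zero, neg_smul, one_smul, map_neg]
    exact this
  · have h1 : (![-1, 1, 1, 1, 1] : Fin 5 → ℝ) i = 1 := by
      fin_cases i <;> simp at hi ⊢
    rw [h1, one_smul]
    exact congrArg Units.val (liftB_frameUnit h hi).eq

theorem frameUnit_zpow_semiconj (h : model.group ≤ (readIn ψ).range) (i l : Fin 5) (a m : ℤ) :
    SemiconjBy (frameUnit h i ^ a) (signUnit (CliffordAlgebra (negForm 5)) m * frameUnit h l)
      (signUnit (CliffordAlgebra (negForm 5)) ((if i = l then 0 else a) + m) * frameUnit h l) := by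
  rw [SemiconjBy, signUnit_left_comm]
  split_ifs with hil
  · subst hil
    rw [zero_add, mul_assoc, ((Commute.refl (frameUnit h i)).zpow_left a).eq]
  · have := zpow_mul_zpow_of_anticommute (frameUnit_mul_frameUnit h hil) a 1
    rw [zpow_one, mul_one] at this
    rw [this, signUnit_left_comm, signUnit_add, mul_assoc, mul_assoc, signUnit_left_comm]

theorem spinRep_h_frameUnit (h : model.group ≤ (readIn ψ).range) {a b c : ℤ}
    (he : Even (a + b + c)) (i : Fin 5) :
    SemiconjBy ((spinRep h).h a b c) (frameUnit h i)
      (signUnit (CliffordAlgebra (negForm 5)) ((![0, 0, c, a, b] : Fin 5 → ℤ) i) *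
        frameUnit h i) := by
  have h0 : frameUnit h i = signUnit (CliffordAlgebra (negForm 5)) 0 * frameUnit h i := by
    rw [signUnit_even Even.zero, one_mul]
  have h1 := ((frameUnit_zpow_semiconj h 3 i a _).mul_left
    (frameUnit_zpow_semiconj h 4 i (-b) _)).mul_left (frameUnit_zpow_semiconj h 2 i c 0)
  rw [← h0] at h1
  -- A frame vector anticommutes with the powers of the other two, so the sign has exponent the sum
  -- of their exponents; since a + b + c is even, this is congruent to its own exponent, and the
  -- exponent is even for e₀ and e₁.
  rw [signUnit_congr (n := (if 3 = i then 0 else a) + ((if 4 = i then 0 else -b) +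
    ((if 2 = i then 0 else c) + 0)))]
  · exact h1
  · rw [Int.even_iff] at he
    fin_cases i <;> simp <;> omega

/-- Modulo squares, which are signs, an even sum leaves either no vector or exactly two, so the
product is 1 or a product of two unit vectors, up to sign. -/
theorem spinRep_h_mem_spinUnits (h : model.group ≤ (readIn ψ).range) {a b c : ℤ}
    (he : Even (a + b + c)) : (spinRep h).h a b c ∈ spinUnits 5 := by
  have hmul : ∀ i j, frameUnit h i * frameUnit h j ∈ spinUnits 5 := fun i j =>
    vecUnit_mul_vecUnit_mem _ _
  have hsign : ∀ n, signUnit (CliffordAlgebra (negForm 5)) n ∈ spinUnits 5 := fun n => by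
    rw [signUnit, ← frameUnit_mul_self h 0]
    exact zpow_mem (hmul 0 0) n
  have key : ∀ (i : Fin 5) (n : ℤ), ∃ m, frameUnit h i ^ n =
      signUnit (CliffordAlgebra (negForm 5)) m * frameUnit h i ^ (n % 2) := fun i n =>
    ⟨n / 2, by rw [← zpow_two_mul_add (frameUnit_mul_self h i), Int.mul_ediv_add_emod]⟩
  obtain ⟨l, hl⟩ := key 3 a
  obtain ⟨m, hm⟩ := key 4 (-b)
  obtain ⟨n, hn⟩ := key 2 c
  change frameUnit h 3 ^ a * frameUnit h 4 ^ (-b) * frameUnit h 2 ^ c ∈ _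
  rw [hl, hm, hn, signUnit_mul_triple]
  refine mul_mem (hsign _) ?_
  rw [Int.even_iff] at he
  rw [show -b % 2 = b % 2 by omega]
  rcases Int.emod_two_eq_zero_or_one a with ha | ha <;>
  rcases Int.emod_two_eq_zero_or_one b with hb | hb
  · rw [ha, hb, show c % 2 = 0 by omega]
    simp
  · rw [ha, hb, show c % 2 = 1 by omega]
    simpa using hmul 4 2
  · rw [ha, hb, show c % 2 = 1 by omega]
    simpa using hmul 3 2
  · rw [ha, hb, show c % 2 = 0 by omega]
    simpa using hmul 3 4

theorem spinRep_h_mem (h : model.group ≤ (readIn ψ).range) {a b c : ℤ}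
    (he : Even (a + b + c)) {γ : Isom 5} (hγ : readIn ψ γ = modelH a b c) :
    ((spinRep h).h a b c, γ) ∈ spinPairGroup 5 := by
  refine mem_spinPairGroup (ψ := ψ) (spinRep_h_mem_spinUnits h he) fun i => ?_
  have h1 := congrArg Units.val (spinRep_h_frameUnit h he i).eq
  rw [Units.val_mul, Units.val_mul, frameUnit, coe_signUnit_mul_vecUnit] at h1
  rw [rotMatrix_unitFrame_H hγ, show (![1, 1, (sg c : ℝ), (sg a : ℝ), (sg b : ℝ)] : Fin 5 → ℝ) i =
    sg ((![0, 0, c, a, b] : Fin 5 → ℤ) i) by fin_cases i <;> simp [sg_zero]]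
  exact h1

theorem spinRep_nf_mem (h : model.group ≤ (readIn ψ).range) {a b c m n : ℤ}
    (he : Even (a + b + c)) {γ : Isom 5} (hγ : readIn ψ γ = model.nf a b c m n) :
    ((spinRep h).nf a b c m n, γ) ∈ spinPairGroup 5 := by
  obtain ⟨α, hα⟩ := h model.A_mem
  obtain ⟨β, hβ⟩ := h model.B_mem
  obtain ⟨η, hη⟩ := h (model.h_mem he)
  have h1 : γ = η * α ^ m * β ^ n := readIn_injective ψ <| by
    rw [hγ, map_mul, map_mul, map_zpow, map_zpow, hα, hβ, hη, HWRep.nf]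
  rw [h1]
  exact mul_mem (mul_mem (spinRep_h_mem h he hη) (zpow_mem (liftA_mem h hα) m))
    (zpow_mem (liftB_mem h hβ) n)

variable {Γ : Subgroup (Isom 5)}

/-- Each rotational part is in the image of Spin(5), so its determinant is 1. -/
theorem isOrientable_of_readIn (hΓ : Γ.map (readIn ψ) = model.group) : IsOrientable Γ := by
  intro γ hγ
  have hmem : readIn ψ γ ∈ model.group := hΓ ▸ Subgroup.mem_map_of_mem _ hγ
  obtain ⟨a, b, c, m, n, he, hp⟩ := model.mem_group_iff.mp hmem
  have h1 := spinCover_of_mem_spinPairGroup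
    (spinRep_nf_mem (hΓ ▸ Subgroup.map_le_range _ _) he hp)
  rw [← h1]
  exact (Matrix.mem_specialOrthogonalGroup_iff.mp (spinCover 5 _).2).2

/-- The identification of a group of isometries with a group of transformations. -/
def modelEquiv {P : Subgroup (Equiv.Perm (Fin 5 → ℝ))} (hΓ : Γ.map (readIn ψ) = P) : Γ ≃* P :=
  (Γ.equivMapOfInjective (readIn ψ) (readIn_injective ψ)).trans (MulEquiv.subgroupCongr hΓ)

/-- The homomorphism extending `spinRep` has values in the spin group and covers the rotational
part, because both hold on every normal form. -/
theorem exists_spin_lift (hΓ : Γ.map (readIn ψ) = model.group) (ho : IsOrientable Γ) :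
    ∃ ε : Γ →* Spin 5, ∀ γ, spinCover 5 (ε γ) = rotSO ho γ := by
  have h : model.group ≤ (readIn ψ).range := hΓ ▸ Subgroup.map_le_range _ _
  obtain ⟨f, hf⟩ := model_faithful.exists_hom (D' := spinRep h)
  have hmem : ∀ γ : Γ, (f (modelEquiv hΓ γ), (γ : Isom 5)) ∈ spinPairGroup 5 := by
    intro γ
    obtain ⟨a, b, c, m, n, he, hp⟩ := model.mem_group_iff.mp (modelEquiv hΓ γ).2
    rw [hf _ a b c m n he hp]
    exact spinRep_nf_mem h he hp
  refine ⟨⟨⟨fun γ => ⟨f (modelEquiv hΓ γ), (hmem γ).1⟩, ?_⟩, ?_⟩, fun γ => ?_⟩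
  · apply Subtype.ext
    simp
  · intro γ δ
    apply Subtype.ext
    simp
  · apply Subtype.ext
    exact spinCover_of_mem_spinPairGroup (hmem γ)

end Forms

end FlatSpin
end
noncomputable section
namespace FlatSpin

/-! ## The homomorphism to the symmetric group -/

/-- The image in `S₄` of the elements `h (a, b, c)`, which depends on the parities only. -/
def klein (a b : ℤ) : Equiv.Perm (Fin 4) :=
  if a % 2 = 0 then (if b % 2 = 0 then 1 else Equiv.swap 0 3 * Equiv.swap 1 2)
  else (if b % 2 = 0 then Equiv.swap 1 3 * Equiv.swap 0 2 else Equiv.swap 2 3 * Equiv.swap 0 1)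

/-- The cyclic permutation of `0, 1, 2`. -/
def threeCycle : Equiv.Perm (Fin 4) := Equiv.swap 0 1 * Equiv.swap 1 2

theorem klein_mul (a b a' b' : ℤ) : klein a b * klein a' b' = klein (a + a') (b + b') := by
  rw [klein, klein, klein, Int.add_emod a a', Int.add_emod b b']
  rcases Int.emod_two_eq_zero_or_one a with ha | ha <;>
  rcases Int.emod_two_eq_zero_or_one b with hb | hb <;>
  rcases Int.emod_two_eq_zero_or_one a' with ha' | ha' <;>
  rcases Int.emod_two_eq_zero_or_one b' with hb' | hb' <;>
  rw [ha, hb, ha', hb'] <;> decide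

theorem klein_congr {a b a' b' : ℤ} (ha : a % 2 = a' % 2) (hb : b % 2 = b' % 2) :
    klein a b = klein a' b' := by rw [klein, klein, ha, hb]

theorem threeCycle_mul_klein (a b c : ℤ) (he : Even (a + b + c)) :
    threeCycle * klein a b = klein c a * threeCycle := by
  rw [Int.even_iff] at he
  rw [klein_congr (show c % 2 = (a + b) % 2 by omega) (rfl : a % 2 = a % 2)]
  simp only [klein, Int.add_emod a b]
  rcases Int.emod_two_eq_zero_or_one a with ha | ha <;>
  rcases Int.emod_two_eq_zero_or_one b with hb | hb <;>
  rw [ha, hb] <;> decide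

theorem swap_mul_klein (a b c : ℤ) (he : Even (a + b + c)) :
    Equiv.swap 0 1 * klein a b = klein (a + c % 2) (c + b % 2) * Equiv.swap 0 1 := by
  rw [Int.even_iff] at he
  rw [klein_congr (show (a + c % 2) % 2 = b % 2 by omega) (show (c + b % 2) % 2 = a % 2 by omega)]
  simp only [klein]
  rcases Int.emod_two_eq_zero_or_one a with ha | ha <;>
  rcases Int.emod_two_eq_zero_or_one b with hb | hb <;>
  rw [ha, hb] <;> decide

/-- The representation of the group by permutations. -/
def s4Rep : HWRep (Equiv.Perm (Fin 4)) where
  h a b _ := klein a b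
  A := threeCycle
  B := Equiv.swap 0 1
  h_mul a b c a' b' c' _ _ := by
    have h1 := sg_mul_emod_two c a'
    have h2 := sg_mul_emod_two a b'
    rw [klein_mul]
    exact klein_congr (by omega) (by omega)
  A_h := threeCycle_mul_klein
  B_h := swap_mul_klein
  B_A := by decide

theorem zpow_emod_of_pow_eq_one {G : Type*} [Group G] {x : G} {k : ℤ} (h : x ^ k = 1) (m : ℤ) :
    x ^ m = x ^ (m % k) := by
  conv_lhs => rw [← Int.mul_ediv_add_emod m k, zpow_add, zpow_mul, h, one_zpow, one_mul]

theorem threeCycle_pow : threeCycle ^ (3 : ℤ) = 1 := by decide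

theorem swap_pow : (Equiv.swap 0 1 : Equiv.Perm (Fin 4)) ^ (2 : ℤ) = 1 := by decide

theorem s4Rep_nf (a b c m n : ℤ) : s4Rep.nf a b c m n =
    klein (a % 2) (b % 2) * threeCycle ^ (m % 3) * Equiv.swap 0 1 ^ (n % 2) := by
  rw [HWRep.nf, ← zpow_emod_of_pow_eq_one threeCycle_pow, ← zpow_emod_of_pow_eq_one swap_pow]
  rw [klein_congr (Int.emod_emod_of_dvd a (dvd_refl 2)) (Int.emod_emod_of_dvd b (dvd_refl 2))]
  rfl

theorem Int.emod_three_cases (m : ℤ) : m % 3 = 0 ∨ m % 3 = 1 ∨ m % 3 = 2 := by omega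

/-- Only residues of the exponents matter, so this is a finite check. The condition is the one for a
trivial rotational part. -/
theorem s4Rep_nf_eq_one_iff (a b c m n : ℤ) : s4Rep.nf a b c m n = 1 ↔
    a % 2 = 0 ∧ b % 2 = 0 ∧ m % 3 = 0 ∧ n % 2 = 0 := by
  rw [s4Rep_nf]
  rcases Int.emod_two_eq_zero_or_one a with ha | ha <;>
  rcases Int.emod_two_eq_zero_or_one b with hb | hb <;>
  rcases Int.emod_three_cases m with hm | hm | hm <;>
  rcases Int.emod_two_eq_zero_or_one n with hn | hn <;>
  rw [ha, hb, hm, hn] <;> decide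

theorem exists_s4Rep_nf (s : Equiv.Perm (Fin 4)) : ∃ a b c m n, Even (a + b + c) ∧
    s4Rep.nf a b c m n = s := by
  have key : ∀ s : Equiv.Perm (Fin 4), ∃ (a b : Fin 2) (m : Fin 3) (n : Fin 2),
      klein (a : ℕ) (b : ℕ) * threeCycle ^ (m : ℕ) * Equiv.swap 0 1 ^ (n : ℕ) = s := by decide
  obtain ⟨a, b, m, n, h⟩ := key s
  refine ⟨a, b, a + b, m, n, ⟨a + b, rfl⟩, ?_⟩
  rw [← h]
  rfl

theorem exists_s4Hom : ∃ f : model.group →* Equiv.Perm (Fin 4),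
    ∀ (x : model.group) (a b c m n : ℤ), Even (a + b + c) →
      (x : Equiv.Perm (Fin 5 → ℝ)) = model.nf a b c m n → f x = s4Rep.nf a b c m n :=
  model_faithful.exists_hom s4Rep

/-- The homomorphism to `S₄`. -/
def s4Hom : model.group →* Equiv.Perm (Fin 4) := exists_s4Hom.choose

theorem s4Hom_eq {x : model.group} {a b c m n : ℤ} (he : Even (a + b + c))
    (hx : (x : Equiv.Perm (Fin 5 → ℝ)) = model.nf a b c m n) : s4Hom x = s4Rep.nf a b c m n :=
  exists_s4Hom.choose_spec x a b c m n he hx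

theorem s4Hom_surjective : Function.Surjective s4Hom := by
  intro s
  obtain ⟨a, b, c, m, n, he, rfl⟩ := exists_s4Rep_nf s
  exact ⟨⟨_, model.nf_mem he m n⟩, s4Hom_eq he rfl⟩

/-! ### The Sylow subgroup -/

/-- A Sylow 2-subgroup of `S₄`, the stabilizer of the partition `01|23`. -/
def s4Sylow : Subgroup (Equiv.Perm (Fin 4)) :=
  Subgroup.centralizer {Equiv.swap 0 1 * Equiv.swap 2 3}

theorem mem_s4Sylow {s : Equiv.Perm (Fin 4)} : s ∈ s4Sylow ↔
    s * (Equiv.swap 0 1 * Equiv.swap 2 3) = (Equiv.swap 0 1 * Equiv.swap 2 3) * s :=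
  Subgroup.mem_centralizer_singleton_iff

instance : DecidablePred (· ∈ s4Sylow) := fun _ => decidable_of_iff' _ mem_s4Sylow

/-- The symmetries of a square, as permutations of four points. -/
def squareSymm : DihedralGroup 4 → Equiv.Perm (Fin 4)
  | .r i => (Equiv.swap 0 2 * Equiv.swap 2 1 * Equiv.swap 1 3) ^ i.val
  | .sr i => Equiv.swap 0 1 * (Equiv.swap 0 2 * Equiv.swap 2 1 * Equiv.swap 1 3) ^ i.val

theorem squareSymm_mem (d : DihedralGroup 4) : squareSymm d ∈ s4Sylow := by
  revert d
  decide

theorem squareSymm_mul (d e : DihedralGroup 4) :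
    squareSymm (d * e) = squareSymm d * squareSymm e := by
  revert d e
  decide

theorem card_s4Sylow : Nat.card s4Sylow = 8 := by
  rw [Nat.card_eq_fintype_card]
  decide

theorem squareSymm_injective : Function.Injective squareSymm := by decide

theorem nonempty_s4Sylow_equiv : Nonempty (s4Sylow ≃* DihedralGroup 4) := by
  let f : DihedralGroup 4 →* s4Sylow := MonoidHom.mk'
    (fun d => ⟨squareSymm d, squareSymm_mem d⟩) fun d e => Subtype.ext (squareSymm_mul d e)
  have hf : Function.Injective f := fun d e h => squareSymm_injective (congrArg Subtype.val h)
  have hb : Function.Bijective f := (Nat.bijective_iff_injective_and_card f).mpr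
    ⟨hf, by rw [card_s4Sylow, DihedralGroup.nat_card]⟩
  exact ⟨(MulEquiv.ofBijective f hb).symm⟩

/-- The sign by which an element of the Sylow subgroup acts on the blocks `01` and `23`. -/
def blockSign (s : Equiv.Perm (Fin 4)) : ℤˣ := if (s 0 : ℕ) < 2 then 1 else -1

theorem blockSign_mul {s t : Equiv.Perm (Fin 4)} (hs : s ∈ s4Sylow) (ht : t ∈ s4Sylow) :
    blockSign (s * t) = blockSign s * blockSign t := by
  revert s t
  decide

end FlatSpin
end
noncomputable section
namespace FlatSpin

/-! ## Characters of order two -/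

/-- The elements on which two characters agree. -/
def agreeOn {G M : Type*} [Group G] [CommGroup M] {P : Subgroup G} (χ χ' : P →* M) : Subgroup G :=
  (χ.eqLocus χ').map P.subtype

section Agree

variable {G M : Type*} [Group G] [CommGroup M] {P : Subgroup G} {χ χ' : P →* M}

theorem mem_agreeOn {x : G} : x ∈ agreeOn χ χ' ↔ ∃ h : x ∈ P, χ ⟨x, h⟩ = χ' ⟨x, h⟩ := by
  constructor
  · rintro ⟨y, hy, rfl⟩
    exact ⟨y.2, hy⟩
  · rintro ⟨h, hx⟩
    exact ⟨⟨x, h⟩, hx, rfl⟩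

theorem mul_self_mem_agreeOn (hM : ∀ x : M, x * x = 1) {x : G} (hx : x ∈ P) :
    x * x ∈ agreeOn χ χ' := by
  refine mem_agreeOn.mpr ⟨mul_mem hx hx, ?_⟩
  have h : (⟨x * x, mul_mem hx hx⟩ : P) = ⟨x, hx⟩ * ⟨x, hx⟩ := rfl
  rw [h, map_mul, map_mul, hM, hM]

theorem commutator_mem_agreeOn {x y : G} (hx : x ∈ P) (hy : y ∈ P) :
    x * y * x⁻¹ * y⁻¹ ∈ agreeOn χ χ' := by
  have hmem : x * y * x⁻¹ * y⁻¹ ∈ P :=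
    mul_mem (mul_mem (mul_mem hx hy) (inv_mem hx)) (inv_mem hy)
  refine mem_agreeOn.mpr ⟨hmem, ?_⟩
  have h : (⟨_, hmem⟩ : P) = ⟨x, hx⟩ * ⟨y, hy⟩ * ⟨x, hx⟩⁻¹ * ⟨y, hy⟩⁻¹ := rfl
  have key : ∀ f : P →* M, f ⟨_, hmem⟩ = 1 := fun f => by
    rw [h]
    simp only [map_mul, map_inv]
    rw [mul_comm (f ⟨x, hx⟩), mul_inv_cancel_right, mul_inv_cancel]
  rw [key, key]

theorem eq_of_le_agreeOn (h : P ≤ agreeOn χ χ') : χ = χ' := by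
  ext x
  exact (mem_agreeOn.mp (h x.2)).2

end Agree

/-- The squares of h(1, 1, 0), h(0, 1, 1), h(1, 0, 1) are h(2, 0, 0), h(0, 2, 0), h(0, 0, 2). In a
group of exponent two all characters therefore agree on the even translations. -/
theorem modelH_even_mem_of_squares {H : Subgroup (Equiv.Perm (Fin 5 → ℝ))}
    (h : ∀ a b c, Even (a + b + c) → modelH a b c * modelH a b c ∈ H) (a b c : ℤ) :
    modelH (2 * a) (2 * b) (2 * c) ∈ H := by
  have e : ∀ a b c, Even (a + b + c) → modelH (a + sg c * a) (b + sg a * b) (c + sg b * c) ∈ H := by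
    intro a b c he
    have h1 : modelH a b c * modelH a b c = _ := model.h_mul a b c a b c he he
    have h2 := h a b c he
    rwa [h1] at h2
  have h₁ : modelH 2 0 0 ∈ H := e 1 1 0 (by decide)
  have h₂ : modelH 0 2 0 ∈ H := e 0 1 1 (by decide)
  have h₃ : modelH 0 0 2 ∈ H := e 1 0 1 (by decide)
  have k₁ := model.h_mul 2 0 0 0 2 0 (by decide) (by decide)
  have k₂ := model.h_mul 2 2 0 0 0 2 (by decide) (by decide)
  have k₃ := inv_mem h₁
  have k₄ := inv_mem h₂
  have e₁ : (modelH 2 0 0)⁻¹ = _ := model.h_inv (a := 2) (b := 0) (c := 0) (by decide)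
  have e₂ : (modelH 0 2 0)⁻¹ = _ := model.h_inv (a := 0) (b := 2) (c := 0) (by decide)
  rw [e₁] at k₃
  rw [e₂] at k₄
  refine modelH_two_mul_mem k₄ k₃ ?_ a b c
  have h4 := mul_mem (mul_mem h₁ h₂) h₃
  have k₅ : modelH 2 0 0 * modelH 0 2 0 = modelH 2 2 0 := k₁
  have k₆ : modelH 2 2 0 * modelH 0 0 2 = modelH 2 2 2 := k₂
  rwa [k₅, k₆] at h4

theorem model_group_le {H : Subgroup (Equiv.Perm (Fin 5 → ℝ))} (hA : modelA ∈ H) (hB : modelB ∈ H)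
    (hH : ∀ a b c, Even (a + b + c) → modelH a b c ∈ H) : model.group ≤ H := by
  rw [HWRep.group, Subgroup.closure_le]
  rintro p ((rfl | rfl) | ⟨a, b, c, he, rfl⟩)
  exacts [hA, hB, hH a b c he]

theorem modelA_mem : modelA ∈ model.group := model.A_mem

theorem modelB_mem : modelB ∈ model.group := model.B_mem

theorem modelH_mem {a b c : ℤ} (he : Even (a + b + c)) : modelH a b c ∈ model.group :=
  model.h_mem he

/-- Modulo squares and commutators, h(1, 1, 0) equals its conjugate h(0, 1, 1) under A, so their
product h(-1, 2, 1) is killed; conjugating by A⁻¹ kills a second parity class, and with it all h. -/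
theorem model_characters_injective {M : Type*} [CommGroup M] (hM : ∀ x : M, x * x = 1)
    {χ χ' : model.group →* M} (hA : χ ⟨modelA, modelA_mem⟩ = χ' ⟨modelA, modelA_mem⟩)
    (hB : χ ⟨modelB, modelB_mem⟩ = χ' ⟨modelB, modelB_mem⟩) : χ = χ' := by
  have hA' : modelA ∈ agreeOn χ χ' := mem_agreeOn.mpr ⟨modelA_mem, hA⟩
  have hB' : modelB ∈ agreeOn χ χ' := mem_agreeOn.mpr ⟨modelB_mem, hB⟩
  have h2 := modelH_even_mem_of_squares (H := agreeOn χ χ')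
    fun a b c he => mul_self_mem_agreeOn hM (modelH_mem he)
  refine eq_of_le_agreeOn (model_group_le hA' hB' fun a b c he => ?_)
  have h4 : modelA * modelH 1 1 0 = modelH 0 1 1 * modelA := model.A_h _ _ _ (by decide)
  have h5 : modelH 0 1 1 * modelH 1 1 0 = modelH (-1) 2 1 :=
    model.h_mul 0 1 1 1 1 0 (by decide) (by decide)
  have h₁ : modelH (-1) 2 1 ∈ agreeOn χ χ' := by
    have k1 := mul_mem (commutator_mem_agreeOn (χ := χ) (χ' := χ') modelA_mem
      (modelH_mem (a := 1) (b := 1) (c := 0) (by decide)))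
      (mul_self_mem_agreeOn hM (modelH_mem (a := 1) (b := 1) (c := 0) (by decide)))
    rw [h4, mul_inv_cancel_right, ← mul_assoc, inv_mul_cancel_right, h5] at k1
    exact k1
  have h6 : modelA⁻¹ * modelH (-1) 2 1 = modelH 2 1 (-1) * modelA⁻¹ := model.A_inv_h (by decide)
  have h₂ : modelH 2 1 (-1) ∈ agreeOn χ χ' := by
    rw [eq_mul_inv_of_mul_eq h6.symm, inv_inv]
    exact mul_mem (mul_mem (inv_mem hA') h₁) hA'
  exact modelH_mem_of_parities h2
    (modelH_mem_of_parity h2 h₁ (by decide) (by decide) (by decide) (by decide))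
    (modelH_mem_of_parity h2 h₂ (by decide) (by decide) (by decide) (by decide)) he

/-- The representation in a group of exponent two with prescribed values at `A` and `B`. -/
def characterRep {M : Type*} [CommGroup M] (hM : ∀ x : M, x * x = 1) (x y : M) : HWRep M where
  h _ _ _ := 1
  A := x
  B := y
  h_mul _ _ _ _ _ _ _ _ := mul_one 1
  A_h _ _ _ _ := by rw [mul_one, one_mul]
  B_h _ _ _ _ := by rw [mul_one, one_mul]
  B_A := by rw [inv_eq_of_mul_eq_one_left (hM x), mul_comm]

theorem exists_model_character {M : Type*} [CommGroup M] (hM : ∀ x : M, x * x = 1) (x y : M) :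
    ∃ χ : model.group →* M, χ ⟨modelA, modelA_mem⟩ = x ∧ χ ⟨modelB, modelB_mem⟩ = y ∧
      ∀ (a b c : ℤ) (he : Even (a + b + c)), χ ⟨modelH a b c, modelH_mem he⟩ = 1 := by
  obtain ⟨χ, hχ⟩ := model_faithful.exists_hom (characterRep hM x y)
  refine ⟨χ, ?_, ?_, fun a b c he => ?_⟩
  · rw [hχ _ 0 0 0 1 0 (by decide) (by simp [HWRep.nf, HWRep.h_zero]; rfl)]
    simp [HWRep.nf, HWRep.h_zero]
    rfl
  · rw [hχ _ 0 0 0 0 1 (by decide) (by simp [HWRep.nf, HWRep.h_zero]; rfl)]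
    simp [HWRep.nf, HWRep.h_zero]
    rfl
  · rw [hχ _ a b c 0 0 he (by simp [HWRep.nf]; rfl)]
    simp [HWRep.nf]
    rfl

theorem bijective_model_characters {M : Type*} [CommGroup M] (hM : ∀ x : M, x * x = 1) :
    Function.Bijective (fun χ : model.group →* M =>
      (χ ⟨modelA, modelA_mem⟩, χ ⟨modelB, modelB_mem⟩)) := by
  constructor
  · intro χ χ' h
    exact model_characters_injective hM (congrArg Prod.fst h) (congrArg Prod.snd h)
  · rintro ⟨x, y⟩
    obtain ⟨χ, rfl, rfl, -⟩ := exists_model_character hM x y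
    exact ⟨χ, rfl⟩

/-! ### The subgroup over the Sylow subgroup -/

/-- The preimage of the Sylow subgroup of `S₄`. -/
def sylowModel : Subgroup (Equiv.Perm (Fin 5 → ℝ)) :=
  (s4Sylow.comap s4Hom).map model.group.subtype

theorem mem_sylowModel {p : Equiv.Perm (Fin 5 → ℝ)} :
    p ∈ sylowModel ↔ ∃ h : p ∈ model.group, s4Hom ⟨p, h⟩ ∈ s4Sylow := by
  constructor
  · rintro ⟨y, hy, rfl⟩
    exact ⟨y.2, hy⟩
  · rintro ⟨h, hx⟩
    exact ⟨⟨p, h⟩, hx, rfl⟩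

theorem s4Hom_A_pow_three (h : modelA ^ (3 : ℤ) ∈ model.group) :
    s4Hom ⟨modelA ^ (3 : ℤ), h⟩ = 1 := by
  rw [s4Hom_eq (a := 0) (b := 0) (c := 0) (m := 3) (n := 0) (by decide)
    (by rw [HWRep.nf, HWRep.h_zero, one_mul, zpow_zero, mul_one]; rfl), s4Rep_nf_eq_one_iff]
  decide

theorem s4Hom_B (h : modelB ∈ model.group) : s4Hom ⟨modelB, h⟩ = Equiv.swap 0 1 := by
  rw [s4Hom_eq (a := 0) (b := 0) (c := 0) (m := 0) (n := 1) (by decide)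
    (by simp [HWRep.nf, HWRep.h_zero]; rfl), s4Rep_nf]
  decide

theorem s4Hom_H {a b c : ℤ} (he : Even (a + b + c)) (h : modelH a b c ∈ model.group) :
    s4Hom ⟨modelH a b c, h⟩ = klein a b := by
  rw [s4Hom_eq (a := a) (b := b) (c := c) (m := 0) (n := 0) he (by simp [HWRep.nf]; rfl)]
  simp [HWRep.nf, s4Rep]

theorem modelA_pow_three_mem_sylowModel : modelA ^ (3 : ℤ) ∈ sylowModel :=
  mem_sylowModel.mpr ⟨zpow_mem modelA_mem 3, by rw [s4Hom_A_pow_three]; exact one_mem _⟩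

theorem modelB_mem_sylowModel : modelB ∈ sylowModel :=
  mem_sylowModel.mpr ⟨modelB_mem, by rw [s4Hom_B]; decide⟩

theorem klein_mem_s4Sylow (a b : ℤ) : klein a b ∈ s4Sylow := by
  rw [klein]
  split_ifs <;> decide

theorem modelH_mem_sylowModel {a b c : ℤ} (he : Even (a + b + c)) : modelH a b c ∈ sylowModel :=
  mem_sylowModel.mpr ⟨modelH_mem he, by rw [s4Hom_H he]; exact klein_mem_s4Sylow a b⟩

theorem sylowModel_le {H : Subgroup (Equiv.Perm (Fin 5 → ℝ))} (hA : modelA ^ (3 : ℤ) ∈ H)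
    (hB : modelB ∈ H) (hH : ∀ a b c, Even (a + b + c) → modelH a b c ∈ H) : sylowModel ≤ H := by
  intro p hp
  obtain ⟨h, hs⟩ := mem_sylowModel.mp hp
  obtain ⟨a, b, c, m, n, he, rfl⟩ := model.mem_group_iff.mp h
  -- The factors coming from h and B lie in the Sylow subgroup, so the power of the 3-cycle must lie
  -- there too, which forces 3 ∣ m.
  rw [s4Hom_eq he rfl, s4Rep_nf, ← klein_congr (Int.emod_emod_of_dvd a (dvd_refl 2)).symm
    (Int.emod_emod_of_dvd b (dvd_refl 2)).symm,
    Subgroup.mul_mem_cancel_right, Subgroup.mul_mem_cancel_left _ (klein_mem_s4Sylow a b)] at hs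
  · have hm : m % 3 = 0 := by
      rcases Int.emod_three_cases m with hm | hm | hm
      · exact hm
      · rw [hm] at hs
        exact absurd hs (by decide)
      · rw [hm] at hs
        exact absurd hs (by decide)
    have h1 : model.A ^ m = (modelA ^ (3 : ℤ)) ^ (m / 3) := by
      rw [← zpow_mul, show 3 * (m / 3) = m by omega]
      rfl
    rw [HWRep.nf, h1]
    exact mul_mem (mul_mem (hH a b c he) (zpow_mem hA _)) (zpow_mem hB n)
  · exact zpow_mem (by decide) _

/-- Conjugation by B identifies h(0, 1, 1) with h(1, 2, 1), so one value determines a character on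
all h. Without A the argument that kills this value is no longer available. -/
theorem sylowModel_characters_injective {M : Type*} [CommGroup M] (hM : ∀ x : M, x * x = 1)
    {χ χ' : sylowModel →* M}
    (hA : χ ⟨_, modelA_pow_three_mem_sylowModel⟩ = χ' ⟨_, modelA_pow_three_mem_sylowModel⟩)
    (hB : χ ⟨_, modelB_mem_sylowModel⟩ = χ' ⟨_, modelB_mem_sylowModel⟩)
    (hH : χ ⟨modelH 0 1 1, modelH_mem_sylowModel (by decide)⟩ =
      χ' ⟨modelH 0 1 1, modelH_mem_sylowModel (by decide)⟩) : χ = χ' := by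
  have hB' : modelB ∈ agreeOn χ χ' := mem_agreeOn.mpr ⟨_, hB⟩
  have h₁ : modelH 0 1 1 ∈ agreeOn χ χ' := mem_agreeOn.mpr ⟨_, hH⟩
  have h2 := modelH_even_mem_of_squares (H := agreeOn χ χ')
    fun a b c he => mul_self_mem_agreeOn hM (modelH_mem_sylowModel he)
  refine eq_of_le_agreeOn (sylowModel_le (mem_agreeOn.mpr ⟨_, hA⟩) hB' fun a b c he => ?_)
  have h3 : modelB⁻¹ * modelH 1 2 1 = modelH 0 1 1 * modelB⁻¹ := model.B_inv_h (by decide)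
  have h₂ : modelH 1 2 1 ∈ agreeOn χ χ' := by
    rw [inv_mul_eq_iff_eq_mul] at h3
    rw [h3]
    exact mul_mem hB' (mul_mem h₁ (inv_mem hB'))
  exact modelH_mem_of_parities h2
    (modelH_mem_of_parity h2 h₂ (by decide) (by decide) (by decide) (by decide)) h₁ he

/-- The character of the subgroup given by the action on the blocks `01` and `23`. -/
def blockCharacter : sylowModel →* ℤˣ where
  toFun p := blockSign (s4Hom ⟨p, (mem_sylowModel.mp p.2).1⟩)
  map_one' := by
    change blockSign (s4Hom 1) = 1
    rw [map_one]
    decide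
  map_mul' p q := by
    rw [← blockSign_mul (mem_sylowModel.mp p.2).2 (mem_sylowModel.mp q.2).2, ← map_mul]
    rfl

theorem sylowModel_le_model_group : sylowModel ≤ model.group := fun _ hp => (mem_sylowModel.mp hp).1

/-- Values at A³ and B come from restricting characters of the whole group, since x³ = x for signs.
The value at h(0, 1, 1) is changed by `blockCharacter`, which is trivial on A³ and B. -/
theorem bijective_sylowModel_characters :
    Function.Bijective (fun χ : sylowModel →* ℤˣ =>
      (χ ⟨_, modelA_pow_three_mem_sylowModel⟩, χ ⟨_, modelB_mem_sylowModel⟩,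
        χ ⟨modelH 0 1 1, modelH_mem_sylowModel (by decide)⟩)) := by
  constructor
  · intro χ χ' h
    simp only [Prod.mk.injEq] at h
    exact sylowModel_characters_injective Int.units_mul_self h.1 h.2.1 h.2.2
  · rintro ⟨x, y, z⟩
    obtain ⟨χ, h1, h2, h3⟩ := exists_model_character Int.units_mul_self x y
    have hA : χ ⟨modelA ^ (3 : ℤ), zpow_mem modelA_mem 3⟩ = x := by
      have : (⟨modelA ^ (3 : ℤ), zpow_mem modelA_mem 3⟩ : model.group) =
        ⟨modelA, modelA_mem⟩ ^ (3 : ℤ) := rfl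
      rw [this, map_zpow, h1]
      rcases Int.units_eq_one_or x with rfl | rfl <;> decide
    let χ₀ : sylowModel →* ℤˣ := χ.comp (Subgroup.inclusion sylowModel_le_model_group)
    have b1 : blockCharacter ⟨_, modelA_pow_three_mem_sylowModel⟩ = 1 := by
      change blockSign (s4Hom ⟨_, _⟩) = 1
      rw [s4Hom_A_pow_three]
      decide
    have b2 : blockCharacter ⟨_, modelB_mem_sylowModel⟩ = 1 := by
      change blockSign (s4Hom ⟨_, _⟩) = 1
      rw [s4Hom_B]
      decide
    have b3 : blockCharacter ⟨modelH 0 1 1, modelH_mem_sylowModel (by decide)⟩ = -1 := by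
      change blockSign (s4Hom ⟨_, _⟩) = -1
      rw [s4Hom_H (by decide)]
      decide
    have c1 : χ₀ ⟨_, modelA_pow_three_mem_sylowModel⟩ = x := hA
    have c2 : χ₀ ⟨_, modelB_mem_sylowModel⟩ = y := h2
    have c3 : χ₀ ⟨modelH 0 1 1, modelH_mem_sylowModel (by decide)⟩ = 1 := h3 0 1 1 (by decide)
    rcases Int.units_eq_one_or z with rfl | rfl
    · exact ⟨χ₀, by simp only [c1, c2, c3]⟩
    · exact ⟨χ₀ * blockCharacter, by
        simp only [MonoidHom.mul_apply, c1, c2, c3, b1, b2, b3, mul_one, one_mul]⟩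

end FlatSpin
end
noncomputable section
namespace FlatSpin
open Pointwise

/-! ## The holonomy group -/

theorem exists_mulEquiv_of_ker_eq {G H K : Type*} [Group G] [Group H] [Group K] {f : G →* H}
    {g : G →* K} (hf : Function.Surjective f) (hg : Function.Surjective g) (h : f.ker = g.ker) :
    ∃ e : H ≃* K, ∀ x, e (f x) = g x := by
  refine ⟨(QuotientGroup.quotientKerEquivOfSurjective f hf).symm.trans
    ((QuotientGroup.quotientMulEquivOfEq h).trans
      (QuotientGroup.quotientKerEquivOfSurjective g hg)), fun x => ?_⟩
  have h1 : (QuotientGroup.quotientKerEquivOfSurjective f hf).symm (f x) = (x : G ⧸ f.ker) := by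
    rw [MulEquiv.symm_apply_eq]
    rfl
  rw [MulEquiv.trans_apply, h1]
  rfl

section Forms

variable {ψ : (Fin 5 → ℝ) ≃ᵃ[ℝ] EuclideanSpace ℝ (Fin 5)} {Γ : Subgroup (Isom 5)}

theorem rotPart_eq_one_of_translation {γ : Isom 5} {v : Fin 5 → ℝ}
    (h : readIn ψ γ = Equiv.addRight v) : rotPart 5 γ = 1 := by
  ext1 x
  obtain ⟨w, rfl⟩ := ψ.linear.surjective x
  have h1 := rotPart_linear h 0 w
  rw [sub_zero] at h1
  rw [h1]
  simp

theorem frameVec_ne_neg (i : Fin 5) : frameVec ψ i ≠ -frameVec ψ i := fun h =>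
  frameVec_ne_zero (ψ := ψ) i <| by
    have h2 : (2 : ℝ) • frameVec ψ i = 0 := by
      rw [two_smul]
      exact add_eq_zero_iff_eq_neg.mpr h
    exact (smul_eq_zero.mp h2).resolve_left two_ne_zero

theorem frameVec_ne_smul (h : model.group ≤ (readIn ψ).range) {i j : Fin 5} (hij : i ≠ j) (c : ℝ) :
    frameVec ψ i ≠ c • frameVec ψ j := fun h1 => by
  have h2 := inner_frameVec h hij
  have h3 : inner ℝ (frameVec ψ i) (frameVec ψ i) = 0 := by
    nth_rewrite 2 [h1]
    rw [real_inner_smul_right, h2, mul_zero]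
  exact frameVec_ne_zero i (inner_self_eq_zero.mp h3)

/-- The frame detects each exponent: direction 0 is reversed when n is odd, direction 2 leaves its
line unless 3 ∣ m, and directions 3 and 4 carry the signs of a and b. Conversely A³, B² and h with
even entries are translations. -/
theorem rotPart_eq_one_iff (h : model.group ≤ (readIn ψ).range) {γ : Isom 5} {a b c m n : ℤ}
    (he : Even (a + b + c)) (hγ : readIn ψ γ = model.nf a b c m n) :
    rotPart 5 γ = 1 ↔ a % 2 = 0 ∧ b % 2 = 0 ∧ m % 3 = 0 ∧ n % 2 = 0 := by
  obtain ⟨α, hα⟩ := h model.A_mem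
  obtain ⟨β, hβ⟩ := h model.B_mem
  obtain ⟨η, hη⟩ := h (model.h_mem he)
  have hγ' : γ = η * α ^ m * β ^ n := readIn_injective ψ <| by
    rw [hγ, map_mul, map_mul, map_zpow, map_zpow, hα, hβ, hη, HWRep.nf]
  have hα3 : rotPart 5 α ^ (3 : ℤ) = 1 := by
    rw [← map_zpow]
    exact rotPart_eq_one_of_translation (ψ := ψ) (by rw [map_zpow, hα]; exact modelA_pow_three)
  have hβ2 : rotPart 5 β ^ (2 : ℤ) = 1 := by
    rw [← map_zpow]
    exact rotPart_eq_one_of_translation (ψ := ψ) (by rw [map_zpow, hβ]; exact modelB_pow_two)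
  have hrot : rotPart 5 γ = rotPart 5 η * rotPart 5 α ^ (m % 3) * rotPart 5 β ^ (n % 2) := by
    rw [hγ', map_mul, map_mul, map_zpow, map_zpow, zpow_emod_of_pow_eq_one hα3 m,
      zpow_emod_of_pow_eq_one hβ2 n]
  have hA := rotPart_A hα
  have hB := rotPart_B hβ
  have hH := rotPart_H hη
  constructor
  · intro h1
    rw [hrot] at h1
    have hn : n % 2 = 0 := by
      rcases Int.emod_two_eq_zero_or_one n with hn | hn
      · exact hn
      exfalso
      have hA0 : ∀ k : ℕ, (rotPart 5 α ^ k) (frameVec ψ 0) = frameVec ψ 0 := by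
        intro k
        induction k with
        | zero => rfl
        | succ k ih =>
          rw [pow_succ]
          change (rotPart 5 α ^ k) (rotPart 5 α (frameVec ψ 0)) = _
          rw [hA]
          exact ih
      obtain ⟨k, hk⟩ := Int.eq_ofNat_of_zero_le (show 0 ≤ m % 3 by omega)
      rw [hn, zpow_one, hk, zpow_natCast] at h1
      have h2 := LinearIsometryEquiv.congr_fun h1 (frameVec ψ 0)
      change rotPart 5 η ((rotPart 5 α ^ k) (rotPart 5 β (frameVec ψ 0))) = frameVec ψ 0 at h2
      rw [hB, map_smul] at h2
      simp only [Matrix.cons_val_zero, hA0, map_neg, hH, neg_smul, one_smul] at h2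
      exact frameVec_ne_neg 0 h2.symm
    rw [hn, zpow_zero, mul_one] at h1
    have hm : m % 3 = 0 := by
      rcases Int.emod_three_cases m with hm | hm | hm
      · exact hm
      · exfalso
        rw [hm, zpow_one] at h1
        have h2 := LinearIsometryEquiv.congr_fun h1 (frameVec ψ 2)
        change rotPart 5 η (rotPart 5 α (frameVec ψ 2)) = frameVec ψ 2 at h2
        rw [hA, hH] at h2
        exact frameVec_ne_smul h (by decide) _ h2.symm
      · exfalso
        rw [hm, zpow_two] at h1
        have h2 := LinearIsometryEquiv.congr_fun h1 (frameVec ψ 2)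
        change rotPart 5 η (rotPart 5 α (rotPart 5 α (frameVec ψ 2))) = frameVec ψ 2 at h2
        rw [hA, hA, hH] at h2
        exact frameVec_ne_smul h (by decide) _ h2.symm
    rw [hm, zpow_zero, mul_one] at h1
    refine ⟨?_, ?_, hm, hn⟩
    · rcases Int.even_or_odd a with ha | ha
      · exact Int.even_iff.mp ha
      · exfalso
        have h2 := LinearIsometryEquiv.congr_fun h1 (frameVec ψ 3)
        rw [hH] at h2
        simp only [sg_odd ha] at h2
        refine frameVec_ne_neg (ψ := ψ) 3 (h2.symm.trans ?_)
        simp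
    · rcases Int.even_or_odd b with hb | hb
      · exact Int.even_iff.mp hb
      · exfalso
        have h2 := LinearIsometryEquiv.congr_fun h1 (frameVec ψ 4)
        rw [hH] at h2
        simp only [sg_odd hb] at h2
        refine frameVec_ne_neg (ψ := ψ) 4 (h2.symm.trans ?_)
        simp
  · rintro ⟨ha, hb, hm, hn⟩
    rw [Int.even_iff] at he
    have hη1 : rotPart 5 η = 1 := rotPart_eq_one_of_translation (ψ := ψ) (hη.trans (by
      rw [show a = 2 * (a / 2) by omega, show b = 2 * (b / 2) by omega,
        show c = 2 * (c / 2) by omega]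
      exact modelH_two_mul _ _ _))
    rw [hrot, hm, hn, hη1, zpow_zero, zpow_zero, one_mul, one_mul]

/-- The projection to the holonomy group. -/
def toHolonomy (Γ : Subgroup (Isom 5)) : Γ →* holonomy Γ := (rotPart 5).subgroupMap Γ

theorem toHolonomy_surjective (Γ : Subgroup (Isom 5)) : Function.Surjective (toHolonomy Γ) :=
  (rotPart 5).subgroupMap_surjective Γ

theorem coe_toHolonomy (γ : Γ) : (toHolonomy Γ γ : _ ≃ₗᵢ[ℝ] _) = rotPart 5 γ := rfl

/-- The homomorphism from the group to `S₄`. -/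
def toS4 (hΓ : Γ.map (readIn ψ) = model.group) : Γ →* Equiv.Perm (Fin 4) :=
  s4Hom.comp (modelEquiv hΓ).toMonoidHom

/-- Two surjections from Γ with the same kernel have isomorphic images. The compatibility with
`toS4` locates the Sylow subgroups concretely. -/
theorem exists_holonomy_equiv (hΓ : Γ.map (readIn ψ) = model.group) :
    ∃ e : holonomy Γ ≃* Equiv.Perm (Fin 4), ∀ γ : Γ,
      e (toHolonomy Γ γ) = toS4 hΓ γ := by
  refine exists_mulEquiv_of_ker_eq (toHolonomy_surjective Γ)
    (s4Hom_surjective.comp (modelEquiv hΓ).surjective) ?_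
  ext γ
  obtain ⟨a, b, c, m, n, he, hp⟩ := model.mem_group_iff.mp (modelEquiv hΓ γ).2
  rw [MonoidHom.mem_ker, MonoidHom.mem_ker]
  change _ ↔ s4Hom (modelEquiv hΓ γ) = 1
  rw [s4Hom_eq he hp, s4Rep_nf_eq_one_iff,
    ← rotPart_eq_one_iff (hΓ ▸ Subgroup.map_le_range _ _) he hp, ← Subtype.val_inj,
    coe_toHolonomy]
  rfl

theorem mem_holonomyPreimage {S : Subgroup (holonomy Γ)} {γ : Isom 5} :
    γ ∈ holonomyPreimage Γ S ↔ ∃ h : γ ∈ Γ, toHolonomy Γ ⟨γ, h⟩ ∈ S := by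
  constructor
  · rintro ⟨h, ⟨s, hs, hsγ⟩⟩
    refine ⟨h, ?_⟩
    have : toHolonomy Γ ⟨γ, h⟩ = s := Subtype.ext hsγ.symm
    rw [this]
    exact hs
  · rintro ⟨h, hs⟩
    exact ⟨h, ⟨_, hs, rfl⟩⟩

theorem holonomyPreimage_le (S : Subgroup (holonomy Γ)) : holonomyPreimage Γ S ≤ Γ := inf_le_left

theorem map_holonomyPreimage (hΓ : Γ.map (readIn ψ) = model.group)
    {e : holonomy Γ ≃* Equiv.Perm (Fin 4)}
    (he : ∀ γ : Γ, e (toHolonomy Γ γ) = toS4 hΓ γ) :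
    (holonomyPreimage Γ (s4Sylow.comap e.toMonoidHom)).map (readIn ψ) = sylowModel := by
  ext p
  rw [mem_sylowModel]
  constructor
  · rintro ⟨γ, hγ, rfl⟩
    obtain ⟨h, hs⟩ := mem_holonomyPreimage.mp hγ
    refine ⟨hΓ ▸ Subgroup.mem_map_of_mem _ h, ?_⟩
    have h1 := he ⟨γ, h⟩
    change e _ ∈ s4Sylow at hs
    rw [h1] at hs
    exact hs
  · rintro ⟨hp, hs⟩
    have hp' := hp
    rw [← hΓ] at hp'
    obtain ⟨γ, hγ, rfl⟩ := hp'
    refine ⟨γ, mem_holonomyPreimage.mpr ⟨hγ, ?_⟩, rfl⟩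
    change e _ ∈ s4Sylow
    rw [he]
    exact hs

theorem card_holonomy (e : holonomy Γ ≃* Equiv.Perm (Fin 4)) : Nat.card (holonomy Γ) = 24 := by
  rw [Nat.card_congr e.toEquiv, Nat.card_perm, Nat.card_fin]
  rfl

theorem factorization_card : (24 : ℕ).factorization 2 = 3 := by
  have hp : Fact (Nat.Prime 2) := ⟨Nat.prime_two⟩
  rw [Nat.factorization_def _ Nat.prime_two, show 24 = 2 ^ 3 * 3 by rfl,
    padicValNat.mul (by decide) (by decide), padicValNat.prime_pow,
    padicValNat.eq_zero_of_not_dvd (by decide)]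

theorem nonempty_comap_equiv {G H : Type*} [Group G] [Group H] (e : G ≃* H) (K : Subgroup H) :
    Nonempty (K.comap e.toMonoidHom ≃* K) :=
  ⟨(e.subgroupMap (K.comap e.toMonoidHom)).trans (MulEquiv.subgroupCongr
    (Subgroup.map_comap_eq_self_of_surjective e.surjective K))⟩

theorem exists_sylow (e : holonomy Γ ≃* Equiv.Perm (Fin 4)) :
    ∃ S : Sylow 2 (holonomy Γ), (S : Subgroup (holonomy Γ)) = s4Sylow.comap e.toMonoidHom := by
  have hfin : Finite (holonomy Γ) := Finite.of_equiv _ e.symm.toEquiv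
  have hp : Fact (Nat.Prime 2) := ⟨Nat.prime_two⟩
  have hc : Nat.card (s4Sylow.comap e.toMonoidHom) = 2 ^ (Nat.card (holonomy Γ)).factorization 2 := by
    obtain ⟨i⟩ := nonempty_comap_equiv e s4Sylow
    rw [card_holonomy e, factorization_card, Nat.card_congr i.toEquiv, card_s4Sylow]
    rfl
  exact ⟨Sylow.ofCard _ hc, rfl⟩

/-- Conjugate Sylow subgroups have preimages conjugate in Γ, so one of them decides the count for
all. -/
theorem holonomyPreimage_smul {S : Subgroup (holonomy Γ)} (γ : Γ) :
    holonomyPreimage Γ (MulAut.conj (toHolonomy Γ γ) • S) =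
      (holonomyPreimage Γ S).map (MulAut.conj (γ : Isom 5)).toMonoidHom := by
  ext δ
  rw [mem_holonomyPreimage]
  constructor
  · rintro ⟨h, hs⟩
    rw [Subgroup.mem_pointwise_smul_iff_inv_smul_mem] at hs
    refine ⟨(γ : Isom 5)⁻¹ * δ * γ, mem_holonomyPreimage.mpr ⟨mul_mem (mul_mem (inv_mem γ.2) h) γ.2, ?_⟩, ?_⟩
    · convert hs using 1
      rw [← map_inv MulAut.conj, MulAut.smul_def, MulAut.conj_apply, inv_inv, ← map_inv, ← map_mul,
        ← map_mul]
      rfl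
    · change (γ : Isom 5) * ((γ : Isom 5)⁻¹ * δ * γ) * (γ : Isom 5)⁻¹ = δ
      group
  · rintro ⟨δ, hδ, rfl⟩
    obtain ⟨h, hs⟩ := mem_holonomyPreimage.mp hδ
    refine ⟨mul_mem (mul_mem γ.2 h) (inv_mem γ.2), ?_⟩
    have h1 := Subgroup.smul_mem_pointwise_smul _ (MulAut.conj (toHolonomy Γ γ)) S hs
    rw [MulAut.smul_def, MulAut.conj_apply, ← map_inv, ← map_mul, ← map_mul] at h1
    exact h1

/-- A lift on Γ restricts to every subgroup, so existence never has to be proved again and only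
characters are counted. -/
theorem card_spinClasses_of_le (hΓ : Γ.map (readIn ψ) = model.group) {Δ : Subgroup (Isom 5)}
    (hΔ : Δ ≤ Γ) : Nat.card (SpinClasses Δ) = Nat.card (Δ →* ℤˣ) := by
  have ho := isOrientable_of_readIn hΓ
  have hu : UniformlyFree Γ := uniformlyFree_of_readIn_mem
    fun γ hγ => hΓ ▸ Subgroup.mem_map_of_mem _ hγ
  obtain ⟨ε, hε⟩ := exists_spin_lift hΓ ho
  have ho' : IsOrientable Δ := fun γ hγ => ho γ (hΔ hγ)
  exact card_spinClasses (hu.mono hΔ) ho' (ε.comp (Subgroup.inclusion hΔ)) fun γ => hε _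

theorem card_characters_congr {G H M : Type*} [Group G] [Group H] [CommGroup M] (e : G ≃* H) :
    Nat.card (G →* M) = Nat.card (H →* M) :=
  Nat.card_congr (e.monoidHomCongrLeft).toEquiv

theorem card_sylow_spinClasses (hΓ : Γ.map (readIn ψ) = model.group)
    {e : holonomy Γ ≃* Equiv.Perm (Fin 4)} (he : ∀ γ : Γ, e (toHolonomy Γ γ) = toS4 hΓ γ)
    (S : Sylow 2 (holonomy Γ)) :
    Nonempty ((S : Subgroup (holonomy Γ)) ≃* DihedralGroup 4) ∧
      Nat.card (SpinClasses (holonomyPreimage Γ S)) = 8 := by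
  have hp : Fact (Nat.Prime 2) := ⟨Nat.prime_two⟩
  have hfin : Finite (holonomy Γ) := Finite.of_equiv _ e.symm.toEquiv
  obtain ⟨S₀, hS₀⟩ := exists_sylow e
  constructor
  · obtain ⟨i⟩ := nonempty_comap_equiv e s4Sylow
    obtain ⟨j⟩ := nonempty_s4Sylow_equiv
    exact ⟨((S.equiv S₀).trans (MulEquiv.subgroupCongr hS₀)).trans (i.trans j)⟩
  · obtain ⟨g, hg⟩ := MulAction.exists_smul_eq (holonomy Γ) S₀ S
    obtain ⟨γ, rfl⟩ := toHolonomy_surjective Γ g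
    have h1 : (S : Subgroup (holonomy Γ)) = MulAut.conj (toHolonomy Γ γ) •
        s4Sylow.comap e.toMonoidHom := by
      rw [← hg, ← hS₀]
      rfl
    rw [card_spinClasses_of_le hΓ (holonomyPreimage_le _), h1, holonomyPreimage_smul]
    refine (card_characters_congr ((MulAut.conj (γ : Isom 5)).subgroupMap _)).symm.trans ?_
    rw [card_characters_congr (modelEquiv (map_holonomyPreimage hΓ he)),
      Nat.card_congr (Equiv.ofBijective _ bijective_sylowModel_characters)]
    simp

theorem nonempty_singularH1_equiv (hΓ : Γ.map (readIn ψ) = model.group) :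
    Nonempty (SingularH1 (ZMod 2) (FlatManifold Γ) ≃+ (ZMod 2 × ZMod 2)) := by
  have hu : UniformlyFree Γ := uniformlyFree_of_readIn_mem
    fun γ hγ => hΓ ▸ Subgroup.mem_map_of_mem _ hγ
  let α : Γ := (modelEquiv hΓ).symm ⟨modelA, modelA_mem⟩
  let β : Γ := (modelEquiv hΓ).symm ⟨modelB, modelB_mem⟩
  let f : (Additive Γ →+ ZMod 2) →+ ZMod 2 × ZMod 2 :=
    { toFun χ := (χ (Additive.ofMul α), χ (Additive.ofMul β))
      map_zero' := rfl
      map_add' _ _ := rfl }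
  have hM : ∀ x : Multiplicative (ZMod 2), x * x = 1 := fun x => CharTwo.add_self_eq_zero (R := ZMod 2) x
  have h0 : Function.Bijective
      ((modelEquiv hΓ).monoidHomCongrLeft (N := Multiplicative (ZMod 2))) :=
    MulEquiv.bijective _
  have h1 : Function.Bijective (AddMonoidHom.toMultiplicativeRight :
      (Additive Γ →+ ZMod 2) ≃ (Γ →* Multiplicative (ZMod 2))) := Equiv.bijective _
  -- Additive homomorphisms to ℤ/2 are characters of the model in a group of exponent two,
  -- determined freely by the values at A and B.
  have hf : Function.Bijective f := (bijective_model_characters hM).comp (h0.comp h1)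
  exact ⟨(singularH1Equiv (ZMod 2) hu).toAddEquiv.trans (AddEquiv.ofBijective f hf)⟩

end Forms

end FlatSpin
end
noncomputable section
namespace FlatSpin

/-! ### The two matrix groups in adapted coordinates, and the theorem -/

theorem isEuclideanForm_caratGroup_iff (φ : (Fin 5 → ℝ) ≃ᵃ[ℝ] EuclideanSpace ℝ (Fin 5))
    (Γ : Subgroup (Isom 5)) : IsEuclideanForm caratGroup φ Γ ↔
      Γ.map (readIn (adapted.symm.trans φ)) = model.group :=
  isEuclideanForm_iff (fun _ => exists_actsAs_of_mem_caratGroup) model_group_le_actionImage φ Γ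

theorem isEuclideanForm_caratSylowGroup_iff
    (φ : (Fin 5 → ℝ) ≃ᵃ[ℝ] EuclideanSpace ℝ (Fin 5)) (Γ : Subgroup (Isom 5)) :
    IsEuclideanForm caratSylowGroup φ Γ ↔
      Γ.map (readIn (adapted.symm.trans φ)) = sylowModel :=
  isEuclideanForm_iff
    (fun _ => exists_actsAs_of_mem_caratSylowGroup modelA_pow_three_mem_sylowModel
      modelB_mem_sylowModel fun _ _ _ => modelH_mem_sylowModel)
    (sylowModel_le modelA_pow_three_mem_actionImage modelH_modelB_mem_actionImage.2
      modelH_modelB_mem_actionImage.1) φ Γ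

end FlatSpin
end

theorem mainTheorem4 :
    (∃ (φ : (Fin 5 → ℝ) ≃ᵃ[ℝ] EuclideanSpace ℝ (Fin 5)) (Γ : Subgroup (FlatSpin.Isom 5)),
      FlatSpin.IsEuclideanForm FlatSpin.caratGroup φ Γ) ∧
    ∀ (φ : (Fin 5 → ℝ) ≃ᵃ[ℝ] EuclideanSpace ℝ (Fin 5)) (Γ : Subgroup (FlatSpin.Isom 5)),
      FlatSpin.IsEuclideanForm FlatSpin.caratGroup φ Γ →
        FlatSpin.IsBieberbach Γ ∧
        FlatSpin.IsOrientable Γ ∧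
        Nonempty (FlatSpin.holonomy Γ ≃* Equiv.Perm (Fin 4)) ∧
        (∀ S : Sylow 2 (FlatSpin.holonomy Γ),
          Nonempty ((S : Subgroup (FlatSpin.holonomy Γ)) ≃* DihedralGroup 4) ∧
          Nat.card (FlatSpin.SpinClasses (FlatSpin.holonomyPreimage Γ S)) = 8) ∧
        (∃ S : Sylow 2 (FlatSpin.holonomy Γ),
          FlatSpin.IsEuclideanForm FlatSpin.caratSylowGroup φ (FlatSpin.holonomyPreimage Γ S)) ∧
        Nonempty (FlatSpin.SpinStructure Γ) ∧
        Nonempty (FlatSpin.SingularH1 (ZMod 2) (FlatSpin.FlatManifold Γ) ≃+ (ZMod 2 × ZMod 2)) ∧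
        Nat.card (FlatSpin.SpinClasses Γ) = 4 := by
  constructor
  · obtain ⟨Γ, hΓ⟩ := FlatSpin.exists_standard_form
    refine ⟨FlatSpin.adapted.trans (FlatSpin.standard 5), Γ,
      (FlatSpin.isEuclideanForm_caratGroup_iff _ _).mpr ?_⟩
    rw [← AffineEquiv.trans_assoc, AffineEquiv.symm_trans_self]
    exact hΓ
  · intro φ Γ hform
    have hΓ := (FlatSpin.isEuclideanForm_caratGroup_iff φ Γ).mp hform
    have hu : FlatSpin.UniformlyFree Γ := FlatSpin.uniformlyFree_of_readIn_mem
      fun γ hγ => hΓ ▸ Subgroup.mem_map_of_mem _ hγ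
    have ho := FlatSpin.isOrientable_of_readIn hΓ
    obtain ⟨ε, hε⟩ := FlatSpin.exists_spin_lift hΓ ho
    obtain ⟨e, he⟩ := FlatSpin.exists_holonomy_equiv hΓ
    refine ⟨⟨hu.discreteTopology, FlatSpin.compactSpace_flatManifold hΓ.ge, hu.torsionFree⟩, ho, ⟨e⟩,
      FlatSpin.card_sylow_spinClasses hΓ he, ?_, ⟨FlatSpin.liftSpinStructure ho ε hε hu⟩,
      FlatSpin.nonempty_singularH1_equiv hΓ, ?_⟩
    · obtain ⟨S, hS⟩ := FlatSpin.exists_sylow e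
      refine ⟨S, (FlatSpin.isEuclideanForm_caratSylowGroup_iff φ _).mpr ?_⟩
      rw [hS]
      exact FlatSpin.map_holonomyPreimage hΓ he
    · rw [FlatSpin.card_spinClasses_of_le hΓ le_rfl,
        FlatSpin.card_characters_congr (FlatSpin.modelEquiv hΓ),
        Nat.card_congr (Equiv.ofBijective _
          (FlatSpin.bijective_model_characters Int.units_mul_self))]
      simp
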